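/- **Setting.** Let $(\mathcal M,g)$ be a smooth connected complete Riemannian manifold, $o\in\mathcal M$, $r(x)=d(o,x)$. Let $E_1,\dots,E_D$ be a frame, i.e. smooth vector fields spanning $T_x\mathcal M$ at each $x$, with $|E_d|$ bounded. Let $\mathcal C_P^\infty$ be the set of smooth $\phi:\mathcal M\to\mathbb R$ such that each iterated derivative $E_{d_q}[\cdots E_{d_1}[\phi]\cdots]$, $q\ge 0$, is bounded by $C(1+r^\kappa)$ for some $C,\kappa$. Let $F=\sum_d f^dE_d$, where the $f^d\in\mathcal C_P^\infty$ are Lipschitz continuous. Fix $N\ge1$, and let $\xi^{d,l}$ ($1\le d\le D$, $1\le l\le L$) be independent real random variables that are standard Gaussian or, more generally, have finite moments of all orders, vanishing odd moments, and the moments of the standard Gaussian up to order $2N$. **Method.** Let $Z^0_{i,j,k},\hat Z_{i,k,l},z^0_{i,k},\hat z_{k,l}\in\mathbb R$ ($1\le i,j\le s$, $1\le k\le K$, $1\le l\le L$), $Z^d_{i,k}=\sum_l\hat Z_{i,k,l}\xi^{d,l}$ and $z^d_k=\sum_l\hat z_{k,l}\xi^{d,l}$. Here $\exp(\sum_dg^dE_d)p$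 is the value at time $1$ of the integral curve of $\sum_dg^dE_d$ ($g^d$ constant) starting at $p$. One step, of size $h$, of the (possibly implicit) frozen flow method from $X_0=p$ is $$H^i=\exp\Big(\sum_d\big(h\sum_jZ^0_{i,j,K}f^d(H^j)+\sqrt h\,Z^d_{i,K}\big)E_d\Big)\cdots\exp\Big(\sum_d\big(h\sum_jZ^0_{i,j,1}f^d(H^j)+\sqrt h\,Z^d_{i,1}\big)E_d\Big)p,$$ $$X_1=\exp\Big(\sum_d\big(h\sum_iz^0_{i,K}f^d(H^i)+\sqrt h\,z^d_K\big)E_d\Big)\cdots\exp\Big(\sum_d\big(h\sum_iz^0_{i,1}f^d(H^i)+\sqrt h\,z^d_1\big)E_d\Big)p.$$ Suppose that for all sufficiently small $h>0$ and all $p$, $X_1$ is an $\mathcal M$-valued random variable given by the method (almost surely, there are $H^1,\dots,H^s$ satisfying these equations). **Exotic forests.** An exotic forest $\pi$ is a (possibly empty) planar forest, with set $V=V_\bullet\sqcup V_\circ$ of black and white nodes, the white nodes being leaves, together with a partition $\mathcal L$ of $V_\circ$ into pairs (lianas). Its order is $|\pi|=|V_\bullet|+|V_\circ|/2$; $EF$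 is the set of exotic forests, $\mathcal{EF}$ its real span, $\mathbf 1$ the empty forest. With $R=(r_1,\dots,r_n)$ the roots and $\Pi(v)$ the children of $v$, listed from left to right, and with $E_{(i_1,\dots,i_q)}[\psi]=E_{i_1}[\cdots E_{i_q}[\psi]\cdots]$, put $$\mathbb F(\pi)\triangleright\phi=\sum_{i:V\to\{1,\dots,D\}}\delta_i\Big(\prod_{v\in V_\bullet}E_{i(\Pi(v))}[f^{i_v}]\Big)E_{i(R)}[\phi],$$ where $\delta_i=1$ if $i_v=i_w$ for each liana $\{v,w\}$, and $\delta_i=0$ otherwise. For a linear form $a$ on $\mathcal{EF}$ the exotic Lie S-series is the formal power series $S_h(a)\triangleright\phi=\sum_{\pi\in EF}h^{|\pi|}a(\pi)\,\mathbb F(\pi)\triangleright\phi$. The shuffle product $\pi_1\mathbin{\sqcup\!\sqcup}\pi_2$ is the sum (with multiplicity) of the exotic forests obtained by interlacing the trees of $\pi_1$ and $\pi_2$, keeping the order of the trees of each one and all the lianas. **Coefficients.** Let $\mathrm{Lab}_K(\pi)$ be the set of maps $\mathbf k:V\to\{1,\dots,K\}$ that do not decrease from left to right along the roots and along the children of each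 black node. Let $\mathbf k!$ be the product, over the family of roots and the families of children of each black node, and over $\kappa\in\{1,\dots,K\}$, of the factorial of the number of nodes of the family with label $\kappa$. Let $w=w(v)$ denote the parent of $v$, if $v$ is not a root. Let $a$ be the linear form on $\mathcal{EF}$ with $$a(\pi)=\sum_{i:V_\bullet\to\{1,\dots,s\}}\ \sum_{\mathbf k\in\mathrm{Lab}_K(\pi)}\frac1{\mathbf k!}\ \prod_{v\in V_\bullet\setminus R}Z^0_{i_w,i_v,k_v}\prod_{v\in V_\bullet\cap R}z^0_{i_v,k_v}\ \sum_{l:V_\circ\to\{1,\dots,L\}}\delta_l\prod_{v\in V_\circ\setminus R}\hat Z_{i_w,k_v,l_v}\prod_{v\in V_\circ\cap R}\hat z_{k_v,l_v},$$ where $\delta_l=1$ if $l$ takes the same value at the two ends of each liana, and $\delta_l=0$ otherwise. **Theorem.** 1. The Talay–Tubaro expansion of the method up to order $N$ is the exotic Lie series $S_h(a)$: there is $h_0>0$ such that for every $\phi\in\mathcal C_P^\infty$ there are $C,\kappa$ such that, for all $0<h\le h_0$ and $p\in\mathcal M$, $\phi(X_1)$ is integrable and $$\Big|\mathbb E[\phi(X_1)\,|\,X_0=p]-\sum_{|\pi|\le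 N}h^{|\pi|}a(\pi)\,\mathbb F(\pi)\triangleright\phi(p)\Big|\le C\,(1+r(p)^\kappa)\,h^{N+1}.$$ In particular, for Gaussian $\xi^{d,l}$, where all $N$ are allowed, $\mathbb E[\phi(X_1)|X_0=p]=S_h(a)\triangleright\phi(p)$ in the sense of asymptotic series. 2. For every $\pi\in EF$ and every $d:V_\circ\to\{1,\dots,D\}$ that takes the same value at the two ends of each liana, $$a(\pi)=\sum_{i:V_\bullet\to\{1,\dots,s\}}\ \sum_{\mathbf k\in\mathrm{Lab}_K(\pi)}\frac1{\mathbf k!}\ \prod_{v\in V_\bullet\setminus R}Z^0_{i_w,i_v,k_v}\prod_{v\in V_\bullet\cap R}z^0_{i_v,k_v}\ \prod_{\ell\in\mathcal L}\mathbb E\Big[\prod_{v\in\ell\setminus R}Z^{d_v}_{i_w,k_v}\prod_{v\in\ell\cap R}z^{d_v}_{k_v}\Big].$$ 3. $a$ is a character of the shuffle algebra of exotic forests: $a(\mathbf 1)=1$ and $a(x\mathbin{\sqcup\!\sqcup}y)=a(x)\,a(y)$ for all $x,y\in\mathcal{EF}$. -/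

import Mathlib

open scoped Manifold ContDiff
open MeasureTheory ProbabilityTheory

noncomputable section

namespace FrozenFlow

/-! ### Planar forests with black nodes and white leaves -/

/-- Planar (ordered) forests whose nodes are black or white, the white nodes being leaves.
A nonempty forest is read from left to right: `black c r` is the forest whose leftmost tree has a
black root carrying the child forest `c`, followed by the forest `r`; `white r` is the forest whose
leftmost tree is a single white node, followed by `r`. -/
inductive Planar : Type
  | nil : Planar
  | black (c r : Planar) : Planar
  | white (r : Planar) : Planar

namespace Planar

/-- The set of black nodes. In `black c r`, `none` is the leftmost root. -/
def Black : Planar → Type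
  | nil => Empty
  | black c r => Option (Black c ⊕ Black r)
  | white r => Black r

/-- The set of white nodes. In `white r`, `Sum.inl ()` is the leftmost root. -/
def White : Planar → Type
  | nil => Empty
  | black c r => White c ⊕ White r
  | white r => Unit ⊕ White r

/-- The set of all nodes. -/
abbrev Node (S : Planar) : Type := Black S ⊕ White S

instance instFintypeBlack : (S : Planar) → Fintype (Black S)
  | nil => inferInstanceAs (Fintype Empty)
  | black c r =>
    letI := instFintypeBlack c
    letI := instFintypeBlack r
    inferInstanceAs (Fintype (Option (Black c ⊕ Black r)))
  | white r => instFintypeBlack r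

instance instFintypeWhite : (S : Planar) → Fintype (White S)
  | nil => inferInstanceAs (Fintype Empty)
  | black c r =>
    letI := instFintypeWhite c
    letI := instFintypeWhite r
    inferInstanceAs (Fintype (White c ⊕ White r))
  | white r =>
    letI := instFintypeWhite r
    inferInstanceAs (Fintype (Unit ⊕ White r))

instance instDecidableEqBlack : (S : Planar) → DecidableEq (Black S)
  | nil => inferInstanceAs (DecidableEq Empty)
  | black c r =>
    letI := instDecidableEqBlack c
    letI := instDecidableEqBlack r
    inferInstanceAs (DecidableEq (Option (Black c ⊕ Black r)))
  | white r => instDecidableEqBlack r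

instance instDecidableEqWhite : (S : Planar) → DecidableEq (White S)
  | nil => inferInstanceAs (DecidableEq Empty)
  | black c r =>
    letI := instDecidableEqWhite c
    letI := instDecidableEqWhite r
    inferInstanceAs (DecidableEq (White c ⊕ White r))
  | white r =>
    letI := instDecidableEqWhite r
    inferInstanceAs (DecidableEq (Unit ⊕ White r))

/-- The roots, from left to right. -/
def roots : (S : Planar) → List (Node S)
  | nil => []
  | black _ r => Sum.inl none :: (roots r).map (Sum.map (fun v => some (Sum.inr v)) Sum.inr)
  | white r => Sum.inr (Sum.inl ()) :: (roots r).map (Sum.map id Sum.inr)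

/-- The children (predecessors) of a black node, from left to right. -/
def children : (S : Planar) → Black S → List (Node S)
  | black c _, none => (roots c).map (Sum.map (fun v => some (Sum.inl v)) Sum.inl)
  | black c _, some (Sum.inl v) =>
    (children c v).map (Sum.map (fun v => some (Sum.inl v)) Sum.inl)
  | black _ r, some (Sum.inr v) =>
    (children r v).map (Sum.map (fun v => some (Sum.inr v)) Sum.inr)
  | white r, v => (children r v).map (Sum.map id Sum.inr)

/-- The parent of a black node (`none` for a root). -/
def blackParent : (S : Planar) → Black S → Option (Black S)
  | black _ _, none => none
  | black c _, some (Sum.inl v) => some ((blackParent c v).map Sum.inl)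
  | black _ r, some (Sum.inr v) => (blackParent r v).map (fun w => some (Sum.inr w))
  | white r, v => blackParent r v

/-- The parent of a white node (`none` for a root). -/
def whiteParent : (S : Planar) → White S → Option (Black S)
  | black c _, Sum.inl v => some ((whiteParent c v).map Sum.inl)
  | black _ r, Sum.inr v => (whiteParent r v).map (fun w => some (Sum.inr w))
  | white _, Sum.inl _ => none
  | white r, Sum.inr v => whiteParent r v

/-- The number of nodes. -/
def size : Planar → ℕ
  | nil => 0
  | black c r => size c + size r + 1
  | white r => size r + 1

theorem card_node : (S : Planar) →
    Fintype.card (Black S) + Fintype.card (White S) = size S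
  | nil => rfl
  | black c r => by
    have h1 : Fintype.card (Black (black c r)) =
        Fintype.card (Option (Black c ⊕ Black r)) := rfl
    have h2 : Fintype.card (White (black c r)) = Fintype.card (White c ⊕ White r) := rfl
    rw [h1, h2, Fintype.card_option, Fintype.card_sum, Fintype.card_sum, size,
      ← card_node c, ← card_node r]
    ring
  | white r => by
    have h1 : Fintype.card (Black (white r)) = Fintype.card (Black r) := rfl
    have h2 : Fintype.card (White (white r)) = Fintype.card (Unit ⊕ White r) := rfl
    rw [h1, h2, Fintype.card_sum, size, ← card_node r, Fintype.card_unit]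
    ring

theorem finite_size_le (n : ℕ) : {S : Planar | size S ≤ n}.Finite := by
  induction n with
  | zero =>
    refine (Set.finite_singleton nil).subset ?_
    rintro (_ | ⟨c, r⟩ | r) h
    · rfl
    · simp [size] at h
    · simp [size] at h
  | succ n ih =>
    refine (((Set.finite_singleton nil).union (ih.image2 black ih)).union
      (ih.image white)).subset ?_
    rintro (_ | ⟨c, r⟩ | r) h
    · exact Or.inl (Or.inl rfl)
    · simp only [size, Set.mem_ofPred_eq] at h
      exact Or.inl (Or.inr ⟨c, by simp only [Set.mem_ofPred_eq]; omega,
        r, by simp only [Set.mem_ofPred_eq]; omega, rfl⟩)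
    · simp only [size, Set.mem_ofPred_eq] at h
      exact Or.inr ⟨r, by simp only [Set.mem_ofPred_eq]; omega, rfl⟩

/-- Bookkeeping of white nodes when a tree with white nodes `A` is put in front of a shuffle and
comes from the left operand. -/
def whiteLeft {A R T U : Type} (e : U ≃ R ⊕ T) : A ⊕ U ≃ (A ⊕ R) ⊕ T :=
  (Equiv.sumCongr (Equiv.refl A) e).trans (Equiv.sumAssoc A R T).symm

/-- Bookkeeping of white nodes when a tree with white nodes `A` is put in front of a shuffle and
comes from the right operand. -/
def whiteRight {A S R U : Type} (e : U ≃ S ⊕ R) : A ⊕ U ≃ S ⊕ (A ⊕ R) :=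
  (whiteLeft e).trans
    ((Equiv.sumCongr (Equiv.sumComm A S) (Equiv.refl R)).trans (Equiv.sumAssoc S A R))

/-- The shuffles of two planar forests, listed with multiplicity: for trees `τ`, `γ` and forests
`π`, `η`, `τπ ⧢ γη = τ(π ⧢ γη) + γ(τπ ⧢ η)`, the empty forest being neutral. Each shuffle is
recorded together with the identification of its white nodes with those of the two operands. -/
def shuffle : (S T : Planar) → List (Σ U : Planar, White U ≃ White S ⊕ White T)
  | nil, T => [⟨T, (Equiv.emptySum Empty (White T)).symm⟩]
  | black c r, nil => [⟨black c r, (Equiv.sumEmpty (White (black c r)) Empty).symm⟩]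
  | white r, nil => [⟨white r, (Equiv.sumEmpty (White (white r)) Empty).symm⟩]
  | black c r, black c' r' =>
    (shuffle r (black c' r')).map (fun u => ⟨black c u.1, whiteLeft u.2⟩) ++
      (shuffle (black c r) r').map (fun u => ⟨black c' u.1, whiteRight u.2⟩)
  | black c r, white r' =>
    (shuffle r (white r')).map (fun u => ⟨black c u.1, whiteLeft u.2⟩) ++
      (shuffle (black c r) r').map (fun u => ⟨white u.1, whiteRight u.2⟩)
  | white r, black c' r' =>
    (shuffle r (black c' r')).map (fun u => ⟨white u.1, whiteLeft u.2⟩) ++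
      (shuffle (white r) r').map (fun u => ⟨black c' u.1, whiteRight u.2⟩)
  | white r, white r' =>
    (shuffle r (white r')).map (fun u => ⟨white u.1, whiteLeft u.2⟩) ++
      (shuffle (white r) r').map (fun u => ⟨white u.1, whiteRight u.2⟩)
termination_by S T => size S + size T
decreasing_by all_goals simp only [size]; omega

end Planar

open Planar

/-! ### Exotic forests -/

/-- An exotic forest: a planar forest with black nodes and white leaves, the white leaves being
grouped in pairs (lianas). The pairs are given by the involution without fixed point that sends a
white leaf to the other end of its liana; this is the same as numbering the white leaves so that
each number used occurs exactly twice, up to a permutation of the numbers. -/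
structure ExoticForest where
  shape : Planar
  pair : White shape → White shape
  pair_pair : ∀ v, pair (pair v) = v
  pair_ne : ∀ v, pair v ≠ v

namespace ExoticForest

/-- The order `|V_•| + |V_∘| / 2` (the number of white leaves is even). -/
def order (π : ExoticForest) : ℕ :=
  Fintype.card (Black π.shape) + Fintype.card (White π.shape) / 2

theorem finite_order_eq (n : ℕ) : {π : ExoticForest | π.order = n}.Finite := by
  have h : (⋃ S ∈ {S : Planar | size S ≤ 2 * n + 1},
      Set.range (fun q : {q : White S → White S // (∀ v, q (q v) = v) ∧ ∀ v, q v ≠ v} =>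
        (⟨S, q.1, q.2.1, q.2.2⟩ : ExoticForest))).Finite :=
    (finite_size_le (2 * n + 1)).biUnion fun S _ => Set.finite_range _
  refine h.subset ?_
  rintro ⟨S, q, h1, h2⟩ hπ
  have hc := card_node S
  simp only [Set.mem_ofPred_eq, order] at hπ
  refine Set.mem_biUnion (x := S) ?_ ⟨⟨q, h1, h2⟩, rfl⟩
  simp only [Set.mem_ofPred_eq]
  omega

/-- The finite set of exotic forests of order `n`. -/
def ofOrder (n : ℕ) : Finset ExoticForest := (finite_order_eq n).toFinset

/-- The empty forest. -/
def one : ExoticForest :=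
  ⟨nil, fun v => v, fun _ => rfl, fun v => Empty.elim v⟩

/-- The shuffles of two exotic forests, listed with multiplicity: the roots of the two forests are
interlaced and the lianas are kept. -/
def shuffle (π η : ExoticForest) : List ExoticForest :=
  (Planar.shuffle π.shape η.shape).map fun u =>
    { shape := u.1
      pair := fun v => u.2.symm (Sum.map π.pair η.pair (u.2 v))
      pair_pair := fun v => by
        rcases hv : u.2 v with w | w
        · simp [hv, π.pair_pair, Equiv.symm_apply_eq]
        · simp [hv, η.pair_pair, Equiv.symm_apply_eq]
      pair_ne := fun v => by
        rcases hv : u.2 v with w | w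
        · simp only [Sum.map_inl, ne_eq, Equiv.symm_apply_eq, hv, Sum.inl.injEq]
          exact π.pair_ne w
        · simp only [Sum.map_inr, ne_eq, Equiv.symm_apply_eq, hv, Sum.inr.injEq]
          exact η.pair_ne w }

/-- The lianas, as the set of pairs `{v, w}` of white leaves. -/
def lianas (π : ExoticForest) : Finset (Finset (White π.shape)) :=
  Finset.univ.image fun v => {v, π.pair v}

end ExoticForest

/-- The vector space spanned by the exotic forests. -/
abbrev ExoticSpace : Type := ExoticForest →₀ ℝ

/-- The shuffle product on the span of the exotic forests. -/
def shuffleProduct (x y : ExoticSpace) : ExoticSpace :=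
  x.sum fun π c => y.sum fun η c' =>
    (c * c') • ((π.shuffle η).map fun ρ => (Finsupp.single ρ 1 : ExoticSpace)).sum

/-- A character of the shuffle algebra of exotic forests. -/
def IsShuffleCharacter (a : Module.Dual ℝ ExoticSpace) : Prop :=
  a (Finsupp.single ExoticForest.one 1) = 1 ∧ ∀ x y, a (shuffleProduct x y) = a x * a y

/-! ### Frozen flow methods and their coefficient map -/

/-- The coefficients of a frozen flow method with `s` stages, `K` exponentials per stage and `L`
random variables per direction: `Z0 i j k` is `Z⁰_{i,j,k}`, `Zhat i k l` is `Ẑ_{i,k,l}`,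
`z0 i k` is `z⁰_{i,k}`, and `zhat k l` is `ẑ_{k,l}`. -/
structure Tableau (s K L : ℕ) where
  Z0 : Fin s → Fin s → Fin K → ℝ
  Zhat : Fin s → Fin K → Fin L → ℝ
  z0 : Fin s → Fin K → ℝ
  zhat : Fin K → Fin L → ℝ

section Coefficients

variable {s K L : ℕ}

/-- A labelling with values in `{1, …, K}`: in each family of siblings, and among the roots, the
labels do not decrease from left to right. -/
def IsLabelling (S : Planar) (k : Node S → Fin K) : Prop :=
  ((roots S).map k).Pairwise (· ≤ ·) ∧ ∀ v : Black S, ((children S v).map k).Pairwise (· ≤ ·)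

open Classical in
/-- The set of labellings of a forest. -/
def labellings (S : Planar) (K : ℕ) : Finset (Node S → Fin K) :=
  Finset.univ.filter fun k => IsLabelling S k

/-- The factorial `r₁! ⋯ r_p!` of a multi-index, the `r_q` being the numbers of occurrences of its
values. -/
def multiFactorial (k : List (Fin K)) : ℕ := ∏ κ : Fin K, (k.count κ).factorial

/-- The factorial of a labelling: the product of the factorials of the multi-indices given by the
labels of the roots and by the labels of the children of each node. -/
def labelFactorial (S : Planar) (k : Node S → Fin K) : ℕ :=
  multiFactorial ((roots S).map k) * ∏ v : Black S, multiFactorial ((children S v).map k)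

/-- The coefficient of a black node: `Z⁰_{i_w,i_v,k_v}` if `v` has the parent `w`, and
`z⁰_{i_v,k_v}` if `v` is a root. -/
def blackCoeff (A : Tableau s K L) (S : Planar) (i : Black S → Fin s) (k : Node S → Fin K)
    (v : Black S) : ℝ :=
  match blackParent S v with
  | none => A.z0 (i v) (k (Sum.inl v))
  | some w => A.Z0 (i w) (i v) (k (Sum.inl v))

/-- The coefficients of a white node: `Ẑ_{i_w,k_v,l}` if `v` has the parent `w`, and `ẑ_{k_v,l}`
if `v` is a root. -/
def whiteCoeff (A : Tableau s K L) (S : Planar) (i : Black S → Fin s) (k : Node S → Fin K)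
    (v : White S) (l : Fin L) : ℝ :=
  match whiteParent S v with
  | none => A.zhat (k (Sum.inr v)) l
  | some w => A.Zhat (i w) (k (Sum.inr v)) l

/-- The coefficient `a(π)` of a frozen flow method. The indices `l` of the random variables agree
at the two ends of each liana. -/
def coeff (A : Tableau s K L) (π : ExoticForest) : ℝ :=
  ∑ i : Black π.shape → Fin s, ∑ k ∈ labellings π.shape K,
    (1 / (labelFactorial π.shape k : ℝ)) * (∏ v, blackCoeff A π.shape i k v) *
      ∑ l : White π.shape → Fin L,
        if ∀ v, l v = l (π.pair v) then ∏ v, whiteCoeff A π.shape i k v (l v) else 0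

/-- The coefficient map as a linear form on the span of the exotic forests. -/
def coeffMap (A : Tableau s K L) : Module.Dual ℝ ExoticSpace :=
  Finsupp.linearCombination ℝ (coeff A)

/-- The coefficient `a(π)` through the covariances of the random Runge-Kutta coefficients
`Z^d_{i,k} = ∑ₗ Ẑ_{i,k,l} ξ^{d,l}`, `z^d_k = ∑ₗ ẑ_{k,l} ξ^{d,l}`: the factor of the liana
`{v, w}` is the expectation of the product of the coefficients of `v` and `w`, for the directions
`d_v`, `d_w`. -/
def coeffByExpectation {Ω : Type*} [MeasurableSpace Ω] (P : Measure Ω) {D : ℕ}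
    (ξ : Fin D → Fin L → Ω → ℝ) (A : Tableau s K L) (π : ExoticForest)
    (d : White π.shape → Fin D) : ℝ :=
  ∑ i : Black π.shape → Fin s, ∑ k ∈ labellings π.shape K,
    (1 / (labelFactorial π.shape k : ℝ)) * (∏ v, blackCoeff A π.shape i k v) *
      ∏ ℓ ∈ π.lianas, ∫ z, ∏ v ∈ ℓ, ∑ l : Fin L, whiteCoeff A π.shape i k v l * ξ (d v) l z ∂P

end Coefficients

/-- Independent random variables with the moments of standard Gaussian variables up to order `2N`,
vanishing odd moments, and finite moments of all orders. Independent standard Gaussian variables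
are of this kind for all `N`. -/
structure IsNoise {Ω : Type*} [MeasurableSpace Ω] (P : Measure Ω) {D L : ℕ} (N : ℕ)
    (ξ : Fin D → Fin L → Ω → ℝ) : Prop where
  aemeasurable : ∀ d l, AEMeasurable (ξ d l) P
  indep : iIndepFun (fun (q : Fin D × Fin L) => ξ q.1 q.2) P
  integrable : ∀ d l (n : ℕ), Integrable (fun z => ξ d l z ^ n) P
  odd : ∀ d l (n : ℕ), Odd n → ∫ z, ξ d l z ^ n ∂P = 0
  moment : ∀ d l (n : ℕ), n ≤ 2 * N →
    ∫ z, ξ d l z ^ n ∂P = ∫ x, x ^ n ∂(gaussianReal 0 1)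

/-! ### Vector fields, elementary differentials, and exotic Lie series on a manifold -/

section Manifold

variable {m : ℕ} {M : Type*} [TopologicalSpace M] [ChartedSpace (EuclideanSpace ℝ (Fin m)) M]
  {D : ℕ}

/-- The derivative `X[φ]` of a function in the direction of a vector field. -/
def lieDeriv (X : (x : M) → TangentSpace (𝓡 m) x) (φ : M → ℝ) (x : M) : ℝ :=
  mfderiv (𝓡 m) 𝓘(ℝ, ℝ) φ x (X x)

/-- The iterated derivative `E_{i_p}[⋯ E_{i_1}[φ] ⋯]` for the list `[i_p, …, i_1]`. -/
def iterDeriv (E : Fin D → (x : M) → TangentSpace (𝓡 m) x) (I : List (Fin D)) (φ : M → ℝ) :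
    M → ℝ :=
  I.foldr (fun d ψ => lieDeriv (E d) ψ) φ

/-- The elementary differential `𝔽(π) ▷ φ` for the vector field `∑ f^d E_d`. -/
def elemDiff (E : Fin D → (x : M) → TangentSpace (𝓡 m) x) (f : Fin D → M → ℝ)
    (π : ExoticForest) (φ : M → ℝ) (x : M) : ℝ :=
  ∑ i : Node π.shape → Fin D,
    (if ∀ v : White π.shape, i (Sum.inr v) = i (Sum.inr (π.pair v)) then 1 else 0) *
      (∏ v : Black π.shape, iterDeriv E ((children π.shape v).map i) (f (i (Sum.inl v))) x) *
        iterDeriv E ((roots π.shape).map i) φ x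

/-- The exotic Lie S-series `S_h(a) ▷ φ` at `p`, as a formal power series in `h`. -/
def lieSeries (E : Fin D → (x : M) → TangentSpace (𝓡 m) x) (f : Fin D → M → ℝ)
    (a : Module.Dual ℝ ExoticSpace) (φ : M → ℝ) (p : M) : PowerSeries ℝ :=
  PowerSeries.mk fun j =>
    ∑ π ∈ ExoticForest.ofOrder j, a (Finsupp.single π 1) * elemDiff E f π φ p

/-- Smooth vector fields that span the tangent space at each point. -/
def IsFrame [IsManifold (𝓡 m) ∞ M] (E : Fin D → (x : M) → TangentSpace (𝓡 m) x) : Prop :=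
  (∀ d, ContMDiff (𝓡 m) (𝓡 m).tangent ∞
    (fun x => (⟨x, E d x⟩ : TangentBundle (𝓡 m) M))) ∧
  ∀ x, Submodule.span ℝ (Set.range fun d => E d x) = ⊤

/-- `q = exp(∑ g^d E_d) p`: the time-one flow of the frozen vector field `∑ g^d E_d`, with constant
coefficients `g^d`, sends `p` to `q`. -/
def FlowsTo (E : Fin D → (x : M) → TangentSpace (𝓡 m) x) (g : Fin D → ℝ) (p q : M) : Prop :=
  ∃ γ : ℝ → M, IsMIntegralCurve (I := 𝓡 m) γ (fun x => ∑ d, g d • E d x) ∧ γ 0 = p ∧ γ 1 = q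

/-- `q = exp(∑ g_K^d E_d) ⋯ exp(∑ g_1^d E_d) p`. -/
def FlowsThrough {K : ℕ} (E : Fin D → (x : M) → TangentSpace (𝓡 m) x) (g : Fin K → Fin D → ℝ)
    (p q : M) : Prop :=
  ∃ y : Fin (K + 1) → M, y 0 = p ∧ y (Fin.last K) = q ∧
    ∀ k : Fin K, FlowsTo E (g k) (y k.castSucc) (y k.succ)

/-- One step of the frozen flow method, of size `h`, from `p` to `q`, with internal stages
`H^1, …, H^s` and the value `ξ` of the random variables. The method may be implicit. -/
structure IsStep {s K L : ℕ} (A : Tableau s K L) (E : Fin D → (x : M) → TangentSpace (𝓡 m) x)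
    (f : Fin D → M → ℝ) (h : ℝ) (ξ : Fin D → Fin L → ℝ) (p : M) (H : Fin s → M) (q : M) :
    Prop where
  stage : ∀ i, FlowsThrough E
    (fun k d => h * ∑ j, A.Z0 i j k * f d (H j) + √h * ∑ l, A.Zhat i k l * ξ d l) p (H i)
  update : FlowsThrough E
    (fun k d => h * ∑ i, A.z0 i k * f d (H i) + √h * ∑ l, A.zhat k l * ξ d l) p q

end Manifold

section Metric

variable {m : ℕ} {M : Type*} [MetricSpace M] [ChartedSpace (EuclideanSpace ℝ (Fin m)) M] {D : ℕ}

/-- Smooth functions all of whose iterated frame derivatives have polynomial growth, with respect to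
the distance to `o`. -/
def IsTestFunction (E : Fin D → (x : M) → TangentSpace (𝓡 m) x) (o : M) (φ : M → ℝ) : Prop :=
  ContMDiff (𝓡 m) 𝓘(ℝ, ℝ) ∞ φ ∧
    ∀ I : List (Fin D), ∃ (C : ℝ) (κ : ℕ), ∀ x, |iterDeriv E I φ x| ≤ C * (1 + dist o x ^ κ)

/-- The Talay-Tubaro expansion up to order `N` of the one-step method `X`, where `X h p` is the
random point `X₁` reached from `X₀ = p` with the stepsize `h`: the expectation of `φ(X₁)` is the
truncation at order `N` of the formal power series `S φ p` in `h`, up to a remainder bounded by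
`C (1 + r(p)^κ) h^(N+1)`, with `C` and `κ` independent of `h` and `p`. -/
def HasTalayTubaroExpansion {Ω : Type*} [MeasurableSpace Ω] (P : Measure Ω)
    (E : Fin D → (x : M) → TangentSpace (𝓡 m) x) (o : M) (X : ℝ → M → Ω → M) (N : ℕ)
    (S : (M → ℝ) → M → PowerSeries ℝ) : Prop :=
  ∃ h₀ : ℝ, 0 < h₀ ∧ ∀ φ : M → ℝ, IsTestFunction E o φ →
    ∃ (C : ℝ) (κ : ℕ), ∀ h : ℝ, 0 < h → h ≤ h₀ → ∀ p : M,
      Integrable (fun z => φ (X h p z)) P ∧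
      |∫ z, φ (X h p z) ∂P - (PowerSeries.trunc (N + 1) (S φ p)).eval h| ≤
        C * (1 + dist o p ^ κ) * h ^ (N + 1)

end Metric

end FrozenFlow

end

/-!
A step of the method is expanded in powers of `√h`, for each value of the noise; Wick's formula then
turns the expectation of the expansion into the exotic Lie series.

*Expansion of a step.* Along one exponential, the derivative of `φ` is the derivative in the
direction of the frozen field, so that a Taylor expansion through the `K` exponentials gives a sum
over words of pairs (exponential, direction), a word being weighted by `1 / 𝐤!` if its labels
increase weakly and by zero otherwise (`sortedWeight`, `polyO_flowsThrough`). The coefficients of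
the frozen fields contain the values `f^d(H^j)` at the stages. Expanding these in the same way and
substituting, one obtains by induction on the power of `√h` a sum over planar forests: a letter of a
word comes either from the noise (a white root) or from a stage (a black root, which carries the
forest of the expansion of `f^d(H^j)`). This is `polyO_step`; the sum over the decorations of a
forest is organised by `Weights.gen`, a recursion over the forest that `Weights.gen_eq_sum` unfolds
into the sum over all maps from nodes to stages, labels and directions. All remainders are bounded
by powers of `(1 + r(p)) (1 + ∑ |ξ^{d,l}|)`; for the stages of an implicit method this bound comes
from the Lipschitz continuity of the `f^d` and a small stepsize (`exists_dist_stage_le`), the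
distance travelled along a frozen flow being controlled by the coefficients because the frame is
bounded.

*Expectation.* The terms of order at most `2 N + 1` in `√h` contain at most `2 N + 1` factors `ξ`.
Up to this order the moments are Gaussian, and the expectation of such a product is the number of
pairings of equal factors (`IsNoise.integral_prod`). A pairing of the white nodes of a planar forest
is a choice of lianas, and the conditions on directions and on indices of the random variables
separate: the former give the elementary differential, the latter the coefficient `a(π)`
(`integral_forestWeights_gen`). The noise has finite moments, so that the expectation of the
remainder is of order `h ^ (N + 1)` (`hasTalayTubaroExpansion_lieSeries`).

*Coefficients.* The formula with covariances is the factorisation of a sum over labels that agree on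
the lianas (`sum_invariant_prod`) and the fact that the noise has covariance the identity. For the
character property, the weight `1 / 𝐤!` on weakly increasing words is a character of the shuffle
algebra of words (`shuffleSum_sortedWeight`), and the recursion `Weights.gen` carries shuffles of
forests to shuffles of words of root labels (`Weights.genShuffle_eq`).
-/

noncomputable section

namespace FrozenFlow

open Planar

/-! ### Weighted sums over decorated forests -/

/-- Weights for decorations of planar forests: black nodes carry a stage in `Fin s` and a letter in
`κ`, white nodes a letter in `κ` and a given label in `Λ`. `black o i x` is the weight of a black
node with stage `i` and letter `x`, `white o x l` that of a white node with letter `x` and label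
`l`, where `o` is the stage of the parent; `family x w` is the weight of the word `w` of letters of
the children of a black node with letter `x`. -/
structure Weights (s : ℕ) (κ Λ : Type*) where
  black : Option (Fin s) → Fin s → κ → ℝ
  white : Option (Fin s) → κ → Λ → ℝ
  family : κ → List κ → ℝ

section Gen

variable {s : ℕ} {κ Λ : Type*}

/-- The weight of a black node of a decorated forest. -/
def Weights.blackAt (T : Weights s κ Λ) (o : Option (Fin s)) (S : Planar) (i : Black S → Fin s)
    (k : Node S → κ) (v : Black S) : ℝ :=
  T.black ((blackParent S v).elim o fun w => some (i w)) (i v) (k (Sum.inl v))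

/-- The weight of a white node of a decorated forest. -/
def Weights.whiteAt (T : Weights s κ Λ) (o : Option (Fin s)) (S : Planar) (i : Black S → Fin s)
    (k : Node S → κ) (l : White S → Λ) (v : White S) : ℝ :=
  T.white ((whiteParent S v).elim o fun w => some (i w)) (k (Sum.inr v)) (l v)

theorem sum_option_sum_fun {A B α : Type*} [Fintype A] [Fintype B] [DecidableEq A] [DecidableEq B]
    [Fintype α] (F : (Option (A ⊕ B) → α) → ℝ) :
    ∑ i, F i = ∑ x, ∑ i₁ : A → α, ∑ i₂ : B → α, F fun v => v.elim x (Sum.elim i₁ i₂) := by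
  let e : (α × (A → α) × (B → α)) ≃ (Option (A ⊕ B) → α) :=
    { toFun := fun q v => v.elim q.1 (Sum.elim q.2.1 q.2.2)
      invFun := fun i => (i none, fun a => i (some (Sum.inl a)), fun a => i (some (Sum.inr a)))
      left_inv := fun q => by rfl
      right_inv := fun i => by
        funext v
        rcases v with _ | (v | v) <;> rfl }
  rw [← e.sum_comp F, Fintype.sum_prod_type]
  simp only [Fintype.sum_prod_type]
  rfl

theorem sum_node_black {A B C D α : Type*} [Fintype A] [Fintype B] [DecidableEq A] [DecidableEq B]
    [Fintype C] [Fintype D] [DecidableEq C] [DecidableEq D]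
    [Fintype α] (F : (Option (A ⊕ B) ⊕ (C ⊕ D) → α) → ℝ) :
    ∑ k, F k = ∑ x, ∑ k₁ : A ⊕ C → α, ∑ k₂ : B ⊕ D → α,
      F (Sum.elim (fun v => v.elim x (Sum.elim (fun a => k₁ (Sum.inl a)) fun a => k₂ (Sum.inl a)))
        (Sum.elim (fun a => k₁ (Sum.inr a)) fun a => k₂ (Sum.inr a))) := by
  let e : (α × (A ⊕ C → α) × (B ⊕ D → α)) ≃ (Option (A ⊕ B) ⊕ (C ⊕ D) → α) :=
    { toFun := fun q => Sum.elim
        (fun v => v.elim q.1 (Sum.elim (fun a => q.2.1 (Sum.inl a)) fun a => q.2.2 (Sum.inl a)))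
        (Sum.elim (fun a => q.2.1 (Sum.inr a)) fun a => q.2.2 (Sum.inr a))
      invFun := fun i => (i (Sum.inl none),
        Sum.elim (fun a => i (Sum.inl (some (Sum.inl a)))) (fun a => i (Sum.inr (Sum.inl a))),
        Sum.elim (fun a => i (Sum.inl (some (Sum.inr a)))) (fun a => i (Sum.inr (Sum.inr a))))
      left_inv := fun q => by
        refine Prod.ext rfl (Prod.ext ?_ ?_) <;> funext v <;> rcases v with v | v <;> rfl
      right_inv := fun i => by
        funext v
        rcases v with (_ | (v | v)) | (v | v) <;> rfl }
  rw [← e.sum_comp F, Fintype.sum_prod_type]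
  simp only [Fintype.sum_prod_type]
  rfl

theorem sum_node_white {B D α : Type*} [Fintype B] [DecidableEq B]
    [Fintype D] [DecidableEq D] [Fintype α] (F : (B ⊕ (Unit ⊕ D) → α) → ℝ) :
    ∑ k, F k = ∑ x, ∑ k₂ : B ⊕ D → α,
      F (Sum.elim (fun a => k₂ (Sum.inl a)) (Sum.elim (fun _ => x) fun a => k₂ (Sum.inr a))) := by
  let e : (α × (B ⊕ D → α)) ≃ (B ⊕ (Unit ⊕ D) → α) :=
    { toFun := fun q => Sum.elim (fun a => q.2 (Sum.inl a))
        (Sum.elim (fun _ => q.1) fun a => q.2 (Sum.inr a))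
      invFun := fun i => (i (Sum.inr (Sum.inl ())),
        Sum.elim (fun a => i (Sum.inl a)) (fun a => i (Sum.inr (Sum.inr a))))
      left_inv := fun q => by
        refine Prod.ext rfl ?_; funext v; rcases v with v | v <;> rfl
      right_inv := fun i => by
        funext v
        rcases v with v | (v | v) <;> rfl }
  rw [← e.sum_comp F, Fintype.sum_prod_type]
  rfl

theorem prod_option_sum {A B : Type*} [Fintype A] [Fintype B] (F : Option (A ⊕ B) → ℝ) :
    ∏ v, F v = F none * ((∏ v, F (some (Sum.inl v))) * ∏ v, F (some (Sum.inr v))) := by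
  rw [Fintype.prod_option, Fintype.prod_sum_type]

theorem prod_unit_sum {B : Type*} [Fintype B] (F : Unit ⊕ B → ℝ) :
    ∏ v, F v = F (Sum.inl ()) * ∏ v, F (Sum.inr v) := by
  rw [Fintype.prod_sum_type, Fintype.prod_unique]

theorem prod_black_black (c r : Planar) (F : Black (.black c r) → ℝ) :
    ∏ v, F v = F none * ((∏ v : Black c, F (some (Sum.inl v))) *
      ∏ v : Black r, F (some (Sum.inr v))) :=
  prod_option_sum (A := Black c) (B := Black r) F

theorem prod_white_black (c r : Planar) (F : White (.black c r) → ℝ) :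
    ∏ v, F v = (∏ v : White c, F (Sum.inl v)) * ∏ v : White r, F (Sum.inr v) :=
  Fintype.prod_sum_type (α₁ := White c) (α₂ := White r) F

theorem prod_white_white (r : Planar) (F : White (.white r) → ℝ) :
    ∏ v, F v = F (Sum.inl ()) * ∏ v : White r, F (Sum.inr v) :=
  prod_unit_sum (B := White r) F

/-- The decoration of the black nodes of `black c r` assembled from those of the leftmost root and
of the black nodes of `c` and `r`. -/
def joinBlack {α : Type*} {c r : Planar} (x : α) (i₁ : Black c → α) (i₂ : Black r → α) :
    Black (.black c r) → α :=
  fun v => Option.elim v x (Sum.elim i₁ i₂)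

/-- The decoration of `black c r` assembled from those of the leftmost root, of `c` and of `r`. -/
def joinNode {α : Type*} {c r : Planar} (x : α) (k₁ : Node c → α) (k₂ : Node r → α) :
    Node (.black c r) → α :=
  Sum.elim (joinBlack x (fun a => k₁ (Sum.inl a)) fun a => k₂ (Sum.inl a))
    (Sum.elim (fun a => k₁ (Sum.inr a)) fun a => k₂ (Sum.inr a))

/-- The black nodes of `white r` are those of `r`. -/
def ofBlack {α : Type*} {r : Planar} (i : Black r → α) : Black (.white r) → α := i

/-- The decoration of `white r` assembled from those of the leftmost root and of `r`. -/
def consNode {α : Type*} {r : Planar} (x : α) (k₂ : Node r → α) : Node (.white r) → α :=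
  Sum.elim (ofBlack fun a => k₂ (Sum.inl a)) (Sum.elim (fun _ => x) fun a => k₂ (Sum.inr a))

section join

variable {α : Type*} {c r : Planar} (x : α) (k₁ : Node c → α) (k₂ : Node r → α)

theorem map_map_of_comp {β γ δ : Type*} (g : β → γ) (f : γ → δ) (l : List β) (h : β → δ)
    (e : ∀ v, f (g v) = h v) : (l.map g).map f = l.map h := by
  rw [List.map_map]
  exact List.map_congr_left fun v _ => e v

theorem map_roots_black :
    (roots (.black c r)).map (joinNode x k₁ k₂) = x :: (roots r).map k₂ :=
  congrArg (x :: ·) (map_map_of_comp _ _ _ _ (by rintro (v | v) <;> rfl))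

theorem map_roots_white :
    (roots (.white r)).map (consNode x k₂) = x :: (roots r).map k₂ :=
  congrArg (x :: ·) (map_map_of_comp _ _ _ _ (by rintro (v | v) <;> rfl))

theorem map_children_none :
    (children (.black c r) none).map (joinNode x k₁ k₂) = (roots c).map k₁ :=
  map_map_of_comp _ _ _ _ (by rintro (v | v) <;> rfl)

theorem map_children_left (v : Black c) :
    (children (.black c r) (some (Sum.inl v))).map (joinNode x k₁ k₂) =
      (children c v).map k₁ :=
  map_map_of_comp _ _ _ _ (by rintro (v | v) <;> rfl)

theorem map_children_right (v : Black r) :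
    (children (.black c r) (some (Sum.inr v))).map (joinNode x k₁ k₂) =
      (children r v).map k₂ :=
  map_map_of_comp _ _ _ _ (by rintro (v | v) <;> rfl)

theorem map_children_white (v : Black r) :
    (children (.white r) v).map (consNode x k₂) = (children r v).map k₂ :=
  map_map_of_comp _ _ _ _ (by rintro (v | v) <;> rfl)

end join

/-- The product of all the weights of a decorated forest. -/
def Weights.term (T : Weights s κ Λ) (o : Option (Fin s)) (S : Planar) (l : White S → Λ)
    (b : List κ → ℝ) (i : Black S → Fin s) (k : Node S → κ) : ℝ :=
  (∏ v, T.blackAt o S i k v * T.family (k (Sum.inl v)) ((children S v).map k)) *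
    (∏ v, T.whiteAt o S i k l v) * b ((roots S).map k)

theorem Weights.term_black (T : Weights s κ Λ) (o : Option (Fin s)) (c r : Planar)
    (l : White (.black c r) → Λ) (b : List κ → ℝ) (j : Fin s) (i₁ : Black c → Fin s)
    (i₂ : Black r → Fin s) (x : κ) (k₁ : Node c → κ) (k₂ : Node r → κ) :
    T.term o (.black c r) l b (joinBlack j i₁ i₂) (joinNode x k₁ k₂) =
      T.black o j x * T.term (some j) c (fun v => l (Sum.inl v)) (T.family x) i₁ k₁ *
        T.term o r (fun v => l (Sum.inr v)) (fun w => b (x :: w)) i₂ k₂ := by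
  have e1 : T.blackAt o (.black c r) (joinBlack j i₁ i₂) (joinNode x k₁ k₂) none =
    T.black o j x := rfl
  have e2 : ∀ v : Black c, T.blackAt o (.black c r) (joinBlack j i₁ i₂) (joinNode x k₁ k₂)
      (some (Sum.inl v)) = T.blackAt (some j) c i₁ k₁ v := by
    intro v
    simp only [blackAt, blackParent, Option.elim]
    cases blackParent c v <;> rfl
  have e3 : ∀ v : Black r, T.blackAt o (.black c r) (joinBlack j i₁ i₂) (joinNode x k₁ k₂)
      (some (Sum.inr v)) = T.blackAt o r i₂ k₂ v := by
    intro v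
    simp only [blackAt, blackParent]
    cases blackParent r v <;> rfl
  have e4 : ∀ v : White c, T.whiteAt o (.black c r) (joinBlack j i₁ i₂) (joinNode x k₁ k₂) l
      (Sum.inl v) = T.whiteAt (some j) c i₁ k₁ (fun v => l (Sum.inl v)) v := by
    intro v
    simp only [whiteAt, whiteParent, Option.elim]
    cases whiteParent c v <;> rfl
  have e5 : ∀ v : White r, T.whiteAt o (.black c r) (joinBlack j i₁ i₂) (joinNode x k₁ k₂) l
      (Sum.inr v) = T.whiteAt o r i₂ k₂ (fun v => l (Sum.inr v)) v := by
    intro v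
    simp only [whiteAt, whiteParent]
    cases whiteParent r v <;> rfl
  rw [term, prod_black_black, prod_white_black, map_roots_black, map_children_none, e1]
  simp only [e2, e3, e4, e5, map_children_left, map_children_right]
  simp only [term]
  have f1 : joinNode x k₁ k₂ (Sum.inl none) = x := rfl
  have f2 : ∀ v, joinNode x k₁ k₂ (Sum.inl (some (Sum.inl v))) = k₁ (Sum.inl v) := fun _ => rfl
  have f3 : ∀ v, joinNode x k₁ k₂ (Sum.inl (some (Sum.inr v))) = k₂ (Sum.inl v) := fun _ => rfl
  simp only [f1, f2, f3]
  ring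

theorem Weights.term_white (T : Weights s κ Λ) (o : Option (Fin s)) (r : Planar)
    (l : White (.white r) → Λ) (b : List κ → ℝ)
    (i₂ : Black r → Fin s) (x : κ) (k₂ : Node r → κ) :
    T.term o (.white r) l b (ofBlack i₂) (consNode x k₂) =
      T.white o x (l (Sum.inl ())) *
        T.term o r (fun v => l (Sum.inr v)) (fun w => b (x :: w)) i₂ k₂ := by
  have e1 : T.whiteAt o (.white r) (ofBlack i₂) (consNode x k₂) l (Sum.inl ()) =
    T.white o x (l (Sum.inl ())) := rfl
  have e3 : ∀ v : White r, T.whiteAt o (.white r) (ofBlack i₂) (consNode x k₂) l (Sum.inr v) =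
      T.whiteAt o r i₂ k₂ (fun v => l (Sum.inr v)) v := fun v => rfl
  have e4 : ∏ v : Black (.white r), T.blackAt o (.white r) (ofBlack i₂) (consNode x k₂) v *
      T.family (consNode x k₂ (Sum.inl v)) ((children (.white r) v).map (consNode x k₂)) =
      ∏ v : Black r, T.blackAt o r i₂ k₂ v *
        T.family (k₂ (Sum.inl v)) ((children r v).map k₂) :=
    Finset.prod_congr rfl fun v _ => congrArg₂ (· * ·) rfl
      (congrArg (T.family _) (map_children_white x k₂ v))
  rw [term, prod_white_white, map_roots_white, e1, e4]
  simp only [e3, term]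
  ring

variable [Fintype κ]

/-- The sum over all decorations of a forest of the product of the weights of its nodes, times the
weight `b w` of the word `w` of letters of the roots, computed by recursion on the forest. The roots
count as children of a node of stage `o`, and `l` labels the white nodes. -/
def Weights.gen (T : Weights s κ Λ) :
    Option (Fin s) → (S : Planar) → (White S → Λ) → (List κ → ℝ) → ℝ
  | _, nil, _, b => b []
  | o, .black c r, l, b => ∑ x, (∑ i, T.black o i x *
      gen T (some i) c (fun v => l (Sum.inl v)) (T.family x)) *
        gen T o r (fun v => l (Sum.inr v)) (fun w => b (x :: w))
  | o, .white r, l, b => ∑ x, T.white o x (l (Sum.inl ())) *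
        gen T o r (fun v => l (Sum.inr v)) (fun w => b (x :: w))

/-- The recursive sum `Weights.gen`, written out as a sum over all decorations. -/
theorem Weights.gen_eq_sum (T : Weights s κ Λ) (o : Option (Fin s)) (S : Planar) (l : White S → Λ)
    (b : List κ → ℝ) :
    T.gen o S l b = ∑ i : Black S → Fin s, ∑ k : Node S → κ, T.term o S l b i k := by
  induction S generalizing o b with
  | nil =>
    have : IsEmpty (Black nil) := inferInstanceAs (IsEmpty Empty)
    have : IsEmpty (White nil) := inferInstanceAs (IsEmpty Empty)
    have : IsEmpty (Node nil) := inferInstanceAs (IsEmpty (Empty ⊕ Empty))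
    simp [gen, roots, term]
  | black c r ihc ihr =>
    have h1 : ∀ F : (Black (.black c r) → Fin s) → ℝ, ∑ i, F i =
        ∑ x, ∑ i₁ : Black c → Fin s, ∑ i₂ : Black r → Fin s, F (joinBlack x i₁ i₂) :=
      fun F => sum_option_sum_fun F
    have h2 : ∀ F : (Node (.black c r) → κ) → ℝ, ∑ k, F k =
        ∑ x, ∑ k₁ : Node c → κ, ∑ k₂ : Node r → κ, F (joinNode x k₁ k₂) :=
      fun F => sum_node_black F
    rw [h1]
    simp only [h2, gen, ihc, ihr, T.term_black]
    have h3 : ∀ (j : Fin s) (i₁ : Black c → Fin s),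
        ∑ i₂ : Black r → Fin s, ∑ x, ∑ k₁ : Node c → κ, ∑ k₂ : Node r → κ,
          T.black o j x * T.term (some j) c (fun v => l (Sum.inl v)) (T.family x) i₁ k₁ *
            T.term o r (fun v => l (Sum.inr v)) (fun w => b (x :: w)) i₂ k₂ =
        ∑ x, ∑ k₁ : Node c → κ,
          T.black o j x * T.term (some j) c (fun v => l (Sum.inl v)) (T.family x) i₁ k₁ *
            ∑ i₂ : Black r → Fin s, ∑ k₂ : Node r → κ,
              T.term o r (fun v => l (Sum.inr v)) (fun w => b (x :: w)) i₂ k₂ := by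
      intro j i₁
      rw [Finset.sum_comm]
      refine Finset.sum_congr rfl fun x _ => ?_
      rw [Finset.sum_comm]
      simp only [Finset.mul_sum]
    simp only [h3]
    have h4 : ∀ j : Fin s, (∑ i₁ : Black c → Fin s, ∑ x, ∑ k₁ : Node c → κ,
          T.black o j x * T.term (some j) c (fun v => l (Sum.inl v)) (T.family x) i₁ k₁ *
            ∑ i₂ : Black r → Fin s, ∑ k₂ : Node r → κ,
              T.term o r (fun v => l (Sum.inr v)) (fun w => b (x :: w)) i₂ k₂) =
        ∑ x, (T.black o j x * ∑ i₁ : Black c → Fin s, ∑ k₁ : Node c → κ,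
          T.term (some j) c (fun v => l (Sum.inl v)) (T.family x) i₁ k₁) *
            ∑ i₂ : Black r → Fin s, ∑ k₂ : Node r → κ,
              T.term o r (fun v => l (Sum.inr v)) (fun w => b (x :: w)) i₂ k₂ := by
      intro j
      rw [Finset.sum_comm]
      simp only [← Finset.sum_mul, ← Finset.mul_sum]
    simp only [h4]
    rw [Finset.sum_comm]
    simp only [← Finset.sum_mul]
  | white r ihr =>
    have h1 : ∀ F : (Black (.white r) → Fin s) → ℝ, ∑ i, F i =
        ∑ i : Black r → Fin s, F (ofBlack i) := fun F => rfl
    have h2 : ∀ F : (Node (.white r) → κ) → ℝ, ∑ k, F k =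
        ∑ x, ∑ k₂ : Node r → κ, F (consNode x k₂) :=
      fun F => sum_node_white F
    rw [h1]
    simp only [h2, gen, ihr, T.term_white]
    rw [Finset.sum_comm]
    simp only [Finset.mul_sum]

/-! ### Shuffles -/

/-- `Weights.gen` as a linear functional of the weight of the word of the roots. -/
def Weights.genLin (T : Weights s κ Λ) (o : Option (Fin s)) (S : Planar) (l : White S → Λ) :
    (List κ → ℝ) →ₗ[ℝ] ℝ where
  toFun := T.gen o S l
  map_add' b b' := by
    simp only [gen_eq_sum, term, Pi.add_apply, mul_add, Finset.sum_add_distrib]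
  map_smul' a b := by
    simp only [gen_eq_sum, term, Pi.smul_apply, smul_eq_mul, Finset.mul_sum, RingHom.id_apply]
    refine Finset.sum_congr rfl fun i _ => Finset.sum_congr rfl fun k _ => ?_
    ring

/-- The shuffles of two words, listed with multiplicity. -/
def wordShuffle {κ : Type*} : List κ → List κ → List (List κ)
  | [], v => [v]
  | x :: u, [] => [x :: u]
  | x :: u, y :: v => (wordShuffle u (y :: v)).map (x :: ·) ++ (wordShuffle (x :: u) v).map (y :: ·)
termination_by u v => u.length + v.length

/-- The sum of the values of `b` at the shuffles of two words. -/
def shuffleSum {κ : Type*} (b : List κ → ℝ) (u v : List κ) : ℝ := ((wordShuffle u v).map b).sum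

theorem shuffleSum_nil_left {κ : Type*} (b : List κ → ℝ) (v : List κ) :
    shuffleSum b [] v = b v := by
  simp [shuffleSum, wordShuffle]

theorem shuffleSum_nil_right {κ : Type*} (b : List κ → ℝ) (u : List κ) :
    shuffleSum b u [] = b u := by
  cases u <;> simp [shuffleSum, wordShuffle]

theorem shuffleSum_cons_cons {κ : Type*} (b : List κ → ℝ) (x y : κ) (u v : List κ) :
    shuffleSum b (x :: u) (y :: v) = shuffleSum (fun w => b (x :: w)) u (y :: v) +
      shuffleSum (fun w => b (y :: w)) (x :: u) v := by
  simp [shuffleSum, wordShuffle, List.map_map, Function.comp_def]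

/-- If two linear functionals on functions of words arise by putting a letter in front, then so
does the functional that pairs them by means of shuffles. -/
theorem shuffleSum_step {A B : κ → ℝ} {G G' H H' : (List κ → ℝ) →ₗ[ℝ] ℝ}
    (hG : ∀ b, G b = ∑ x, A x * G' fun w => b (x :: w))
    (hH : ∀ b, H b = ∑ x, B x * H' fun w => b (x :: w)) (b : List κ → ℝ) :
    (G fun u => H fun v => shuffleSum b u v) =
      ∑ x, A x * (G' fun u => H fun v => shuffleSum (fun w => b (x :: w)) u v) +
      ∑ y, B y * (G fun u => H' fun v => shuffleSum (fun w => b (y :: w)) u v) := by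
  have e1 : ∀ x u, (H fun v => shuffleSum b (x :: u) v) =
      (H fun v => shuffleSum (fun w => b (x :: w)) u v) +
        ∑ y, B y * H' fun v => shuffleSum (fun w => b (y :: w)) (x :: u) v := by
    intro x u
    rw [hH, hH]
    simp only [shuffleSum_cons_cons]
    rw [← Finset.sum_add_distrib]
    refine Finset.sum_congr rfl fun y _ => ?_
    rw [← mul_add, ← map_add]
    rfl
  have e2 : ∀ x, (G' fun u => H fun v => shuffleSum b (x :: u) v) =
      (G' fun u => H fun v => shuffleSum (fun w => b (x :: w)) u v) +
        ∑ y, B y * G' fun u => H' fun v => shuffleSum (fun w => b (y :: w)) (x :: u) v := by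
    intro x
    simp only [e1]
    have : (fun u => (H fun v => shuffleSum (fun w => b (x :: w)) u v) +
        ∑ y, B y * H' fun v => shuffleSum (fun w => b (y :: w)) (x :: u) v) =
        (fun u => H fun v => shuffleSum (fun w => b (x :: w)) u v) +
          ∑ y, B y • fun u => H' fun v => shuffleSum (fun w => b (y :: w)) (x :: u) v := by
      funext u
      simp
    rw [this, map_add, map_sum]
    simp
  rw [hG]
  simp only [e2, mul_add, Finset.sum_add_distrib]
  congr 1
  simp only [Finset.mul_sum]
  rw [Finset.sum_comm]
  refine Finset.sum_congr rfl fun y _ => ?_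
  rw [hG, Finset.mul_sum]
  exact Finset.sum_congr rfl fun x _ => by ring

theorem sum_map_sum {α β : Type*} [Fintype β] (l : List α) (F : α → β → ℝ) :
    (l.map fun a => ∑ x, F a x).sum = ∑ x, (l.map fun a => F a x).sum := by
  induction l with
  | nil => simp
  | cons a l ih => simp [ih, Finset.sum_add_distrib]

theorem Weights.genLin_black (T : Weights s κ Λ) (o : Option (Fin s)) (c r : Planar)
    (l : White (.black c r) → Λ) (b : List κ → ℝ) :
    T.genLin o (.black c r) l b = ∑ x, (∑ i, T.black o i x *
      T.gen (some i) c (fun v => l (Sum.inl v)) (T.family x)) *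
        T.genLin o r (fun v => l (Sum.inr v)) (fun w => b (x :: w)) := rfl

theorem Weights.genLin_white (T : Weights s κ Λ) (o : Option (Fin s)) (r : Planar)
    (l : White (.white r) → Λ) (b : List κ → ℝ) :
    T.genLin o (.white r) l b = ∑ x, T.white o x (l (Sum.inl ())) *
        T.genLin o r (fun v => l (Sum.inr v)) (fun w => b (x :: w)) := rfl

theorem elim_whiteLeft_inr {A R T' U : Type} {Λ : Type*} (e : U ≃ R ⊕ T') (l : A ⊕ R → Λ)
    (l' : T' → Λ) (v : U) : Sum.elim l l' (whiteLeft e (Sum.inr v)) =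
      Sum.elim (fun v => l (Sum.inr v)) l' (e v) := by
  simp only [whiteLeft, Equiv.trans_apply, Equiv.sumCongr_apply, Sum.map_inr]
  cases e v <;> rfl

theorem elim_whiteRight_inr {A R T' U : Type} {Λ : Type*} (e : U ≃ T' ⊕ R) (l : T' → Λ)
    (l' : A ⊕ R → Λ) (v : U) : Sum.elim l l' (whiteRight e (Sum.inr v)) =
      Sum.elim l (fun v => l' (Sum.inr v)) (e v) := by
  simp only [whiteRight, whiteLeft, Equiv.trans_apply, Equiv.sumCongr_apply, Sum.map_inr]
  cases e v <;> rfl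

theorem Weights.genLin_black_left (T : Weights s κ Λ) (o : Option (Fin s)) (c r S' U : Planar)
    (e : White U ≃ White r ⊕ White S') (l : White (.black c r) → Λ) (l' : White S' → Λ)
    (b : List κ → ℝ) :
    T.genLin o (.black c U) (fun v => Sum.elim l l' (whiteLeft e v)) b =
      ∑ x, (∑ i, T.black o i x *
        T.gen (some i) c (fun v => l (Sum.inl v)) (T.family x)) *
          T.genLin o U (fun v => Sum.elim (fun v => l (Sum.inr v)) l' (e v))
            (fun w => b (x :: w)) :=
  (T.genLin_black o c U _ b).trans (Finset.sum_congr rfl fun _ _ => congrArg₂ (· * ·) rfl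
    (congrArg (fun m => T.genLin o U m _) (funext fun v =>
      elim_whiteLeft_inr (A := White c) (R := White r) e l l' v)))

theorem Weights.genLin_black_right (T : Weights s κ Λ) (o : Option (Fin s)) (c r S' U : Planar)
    (e : White U ≃ White S' ⊕ White r) (l : White S' → Λ) (l' : White (.black c r) → Λ)
    (b : List κ → ℝ) :
    T.genLin o (.black c U) (fun v => Sum.elim l l' (whiteRight e v)) b =
      ∑ x, (∑ i, T.black o i x *
        T.gen (some i) c (fun v => l' (Sum.inl v)) (T.family x)) *
          T.genLin o U (fun v => Sum.elim l (fun v => l' (Sum.inr v)) (e v))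
            (fun w => b (x :: w)) :=
  (T.genLin_black o c U _ b).trans (Finset.sum_congr rfl fun _ _ => congrArg₂ (· * ·) rfl
    (congrArg (fun m => T.genLin o U m _) (funext fun v =>
      elim_whiteRight_inr (A := White c) (R := White r) e l l' v)))

theorem Weights.genLin_white_left (T : Weights s κ Λ) (o : Option (Fin s)) (r S' U : Planar)
    (e : White U ≃ White r ⊕ White S') (l : White (.white r) → Λ) (l' : White S' → Λ)
    (b : List κ → ℝ) :
    T.genLin o (.white U) (fun v => Sum.elim l l' (whiteLeft e v)) b =
      ∑ x, T.white o x (l (Sum.inl ())) *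
          T.genLin o U (fun v => Sum.elim (fun v => l (Sum.inr v)) l' (e v))
            (fun w => b (x :: w)) :=
  (T.genLin_white o U _ b).trans (Finset.sum_congr rfl fun _ _ => congrArg₂ (· * ·) rfl
    (congrArg (fun m => T.genLin o U m _) (funext fun v =>
      elim_whiteLeft_inr (A := Unit) (R := White r) e l l' v)))

theorem Weights.genLin_white_right (T : Weights s κ Λ) (o : Option (Fin s)) (r S' U : Planar)
    (e : White U ≃ White S' ⊕ White r) (l : White S' → Λ) (l' : White (.white r) → Λ)
    (b : List κ → ℝ) :
    T.genLin o (.white U) (fun v => Sum.elim l l' (whiteRight e v)) b =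
      ∑ x, T.white o x (l' (Sum.inl ())) *
          T.genLin o U (fun v => Sum.elim l (fun v => l' (Sum.inr v)) (e v))
            (fun w => b (x :: w)) :=
  (T.genLin_white o U _ b).trans (Finset.sum_congr rfl fun _ _ => congrArg₂ (· * ·) rfl
    (congrArg (fun m => T.genLin o U m _) (funext fun v =>
      elim_whiteRight_inr (A := Unit) (R := White r) e l l' v)))

/-- The sum of `T.gen o` over the shuffles of two forests. -/
def Weights.genShuffle (T : Weights s κ Λ) (o : Option (Fin s)) (S S' : Planar) (l : White S → Λ)
    (l' : White S' → Λ) (b : List κ → ℝ) : ℝ :=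
  ((Planar.shuffle S S').map fun u => T.genLin o u.1 (fun v => Sum.elim l l' (u.2 v)) b).sum

/-- Shuffling two forests shuffles the words of the letters of their roots, and leaves all the other
factors of a decorated forest alone. The two recursions agree: one of the two leftmost roots comes
first in the shuffle. -/
theorem Weights.genShuffle_eq (T : Weights s κ Λ) (o : Option (Fin s)) (S S' : Planar)
    (l : White S → Λ) (l' : White S' → Λ) (b : List κ → ℝ) :
    T.genShuffle o S S' l l' b =
      T.genLin o S l fun u => T.genLin o S' l' fun v => shuffleSum b u v := by
  induction S, S' using Planar.shuffle.induct generalizing b with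
  | case1 S' =>
    simp only [genShuffle, Planar.shuffle, List.map_cons, List.map_nil, List.sum_cons,
      List.sum_nil, add_zero]
    have h : ∀ F, T.genLin o nil l F = F [] := fun F => rfl
    rw [h]
    simp only [shuffleSum_nil_left]
    rfl
  | case2 c r =>
    have h : ∀ F, T.genLin o nil l' F = F [] := fun F => rfl
    simp only [h, shuffleSum_nil_right]
    simp only [genShuffle, Planar.shuffle, List.map_cons, List.map_nil, List.sum_cons,
      List.sum_nil, add_zero]
    rfl
  | case3 r =>
    have h : ∀ F, T.genLin o nil l' F = F [] := fun F => rfl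
    simp only [h, shuffleSum_nil_right]
    simp only [genShuffle, Planar.shuffle, List.map_cons, List.map_nil, List.sum_cons,
      List.sum_nil, add_zero]
    rfl
  | case4 c r c' r' ih1 ih2 =>
    rw [shuffleSum_step (T.genLin_black o c r l) (T.genLin_black o c' r' l') b]
    simp only [← ih1, ← ih2]
    simp only [genShuffle, ← List.sum_map_mul_left, ← sum_map_sum]
    rw [Planar.shuffle, List.map_append, List.map_map, List.map_map, List.sum_append]
    exact congrArg₂ (· + ·)
      (congrArg List.sum (List.map_congr_left fun u _ => T.genLin_black_left o c r _ _ _ _ _ _))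
      (congrArg List.sum (List.map_congr_left fun u _ => T.genLin_black_right o c' r' _ _ _ _ _ _))
  | case5 c r r' ih1 ih2 =>
    rw [shuffleSum_step (T.genLin_black o c r l) (T.genLin_white o r' l') b]
    simp only [← ih1, ← ih2]
    simp only [genShuffle, ← List.sum_map_mul_left, ← sum_map_sum]
    rw [Planar.shuffle, List.map_append, List.map_map, List.map_map, List.sum_append]
    exact congrArg₂ (· + ·)
      (congrArg List.sum (List.map_congr_left fun u _ => T.genLin_black_left o c r _ _ _ _ _ _))
      (congrArg List.sum (List.map_congr_left fun u _ => T.genLin_white_right o r' _ _ _ _ _ _))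
  | case6 r c' r' ih1 ih2 =>
    rw [shuffleSum_step (T.genLin_white o r l) (T.genLin_black o c' r' l') b]
    simp only [← ih1, ← ih2]
    simp only [genShuffle, ← List.sum_map_mul_left, ← sum_map_sum]
    rw [Planar.shuffle, List.map_append, List.map_map, List.map_map, List.sum_append]
    exact congrArg₂ (· + ·)
      (congrArg List.sum (List.map_congr_left fun u _ => T.genLin_white_left o r _ _ _ _ _ _))
      (congrArg List.sum (List.map_congr_left fun u _ => T.genLin_black_right o c' r' _ _ _ _ _ _))
  | case7 r r' ih1 ih2 =>
    rw [shuffleSum_step (T.genLin_white o r l) (T.genLin_white o r' l') b]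
    simp only [← ih1, ← ih2]
    simp only [genShuffle, ← List.sum_map_mul_left, ← sum_map_sum]
    rw [Planar.shuffle, List.map_append, List.map_map, List.map_map, List.sum_append]
    exact congrArg₂ (· + ·)
      (congrArg List.sum (List.map_congr_left fun u _ => T.genLin_white_left o r _ _ _ _ _ _))
      (congrArg List.sum (List.map_congr_left fun u _ => T.genLin_white_right o r' _ _ _ _ _ _))

end Gen

/-! ### Weights of nondecreasing words -/

section Sorted

variable {K : ℕ}

open Classical in
/-- The weight of a word of labels: the inverse of its factorial if it does not decrease, and `0`
otherwise. -/
def sortedWeight (w : List (Fin K)) : ℝ :=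
  if w.Pairwise (· ≤ ·) then 1 / (multiFactorial w : ℝ) else 0

theorem sortedWeight_nil : sortedWeight ([] : List (Fin K)) = 1 := by
  simp [sortedWeight, multiFactorial]

theorem multiFactorial_cons (x : Fin K) (w : List (Fin K)) :
    multiFactorial (x :: w) = (w.count x + 1) * multiFactorial w := by
  have h : ∀ κ, ((x :: w).count κ).factorial =
      (if κ = x then w.count x + 1 else 1) * (w.count κ).factorial := by
    intro κ
    rcases eq_or_ne κ x with rfl | hκ
    · simp [Nat.factorial_succ]
    · rw [List.count_cons_of_ne (Ne.symm hκ)]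
      simp [hκ]
  simp only [multiFactorial, h, Finset.prod_mul_distrib]
  simp

theorem multiFactorial_pos (w : List (Fin K)) : 0 < multiFactorial w :=
  Finset.prod_pos fun _ _ => Nat.factorial_pos _

open Classical in
theorem sortedWeight_cons (x : Fin K) (w : List (Fin K)) :
    sortedWeight (x :: w) = (if ∀ y ∈ w, x ≤ y then 1 / ((w.count x : ℝ) + 1) else 0) *
      sortedWeight w := by
  simp only [sortedWeight, List.pairwise_cons, multiFactorial_cons]
  by_cases h1 : ∀ y ∈ w, x ≤ y <;> by_cases h2 : w.Pairwise (· ≤ ·)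
  · simp [h2, mul_comm]
  all_goals simp [h1, h2]

theorem mem_wordShuffle {κ : Type*} [DecidableEq κ] (u v : List κ) :
    ∀ w ∈ wordShuffle u v, w.Perm (u ++ v) := by
  induction u, v using wordShuffle.induct with
  | case1 v => simp [wordShuffle]
  | case2 x u => simp [wordShuffle]
  | case3 x u y v ih1 ih2 =>
    intro w hw
    rw [wordShuffle, List.mem_append, List.mem_map, List.mem_map] at hw
    rcases hw with ⟨w', h, rfl⟩ | ⟨w', h, rfl⟩
    · simpa using ih1 _ h
    · exact ((ih2 _ h).cons y).trans List.perm_middle.symm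

open Classical in
theorem shuffleSum_sortedWeight_cons (x : Fin K) (u v : List (Fin K)) :
    shuffleSum (fun w => sortedWeight (x :: w)) u v =
      (if ∀ y ∈ u ++ v, x ≤ y then 1 / (((u ++ v).count x : ℝ) + 1) else 0) *
        shuffleSum sortedWeight u v := by
  simp only [shuffleSum, ← List.sum_map_mul_left]
  refine congrArg List.sum (List.map_congr_left fun w hw => ?_)
  have h := mem_wordShuffle u v w hw
  rw [sortedWeight_cons, h.count_eq]
  simp only [h.mem_iff]

/-- The weights of nondecreasing words are multiplicative for the shuffle product, like the
coefficients of a product of exponentials. -/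
theorem shuffleSum_sortedWeight (u v : List (Fin K)) :
    shuffleSum sortedWeight u v = sortedWeight u * sortedWeight v := by
  induction u, v using wordShuffle.induct with
  | case1 v => rw [shuffleSum_nil_left, sortedWeight_nil, one_mul]
  | case2 x u => rw [shuffleSum_nil_right, sortedWeight_nil, mul_one]
  | case3 x u y v ih1 ih2 =>
    rw [shuffleSum_cons_cons, shuffleSum_sortedWeight_cons, shuffleSum_sortedWeight_cons, ih1, ih2,
      sortedWeight_cons x u, sortedWeight_cons y v]
    -- For `x ≠ y` only one of the two summands survives; for `x = y` they add up since
    -- `1 / (c' + 1) + 1 / (c + 1) = (c + c' + 2) / ((c + 1) (c' + 1))`.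
    rcases lt_trichotomy x y with hxy | rfl | hxy
    · have hn : ¬ ∀ z ∈ x :: u ++ v, y ≤ z := fun h => absurd (h x (by simp)) (not_le.2 hxy)
      rw [if_neg hn, zero_mul, add_zero]
      by_cases hv : ∀ z ∈ v, y ≤ z
      · have hc : (u ++ y :: v).count x = u.count x := by
          rw [List.count_append, List.count_eq_zero_of_not_mem (l := y :: v), add_zero]
          intro hx
          rcases List.mem_cons.1 hx with rfl | hx
          · exact lt_irrefl _ hxy
          · exact absurd (hv x hx) (not_le.2 hxy)
        have he : (∀ z ∈ u ++ y :: v, x ≤ z) ↔ ∀ z ∈ u, x ≤ z := by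
          refine ⟨fun h z hz => h z (List.mem_append_left _ hz), fun h z hz => ?_⟩
          rcases List.mem_append.1 hz with hz | hz
          · exact h z hz
          rcases List.mem_cons.1 hz with rfl | hz
          · exact hxy.le
          · exact hxy.le.trans (hv z hz)
        rw [hc, if_congr he rfl rfl]
        ring
      · rw [if_neg hv]
        ring
    · have he1 : (∀ z ∈ u ++ x :: v, x ≤ z) ↔ (∀ z ∈ u, x ≤ z) ∧ ∀ z ∈ v, x ≤ z := by
        simp only [List.mem_append, List.mem_cons]
        refine ⟨fun h => ⟨fun z hz => h z (Or.inl hz), fun z hz => h z (Or.inr (Or.inr hz))⟩, ?_⟩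
        rintro ⟨h1, h2⟩ z (hz | rfl | hz)
        exacts [h1 z hz, le_rfl, h2 z hz]
      have he2 : (∀ z ∈ x :: u ++ v, x ≤ z) ↔ (∀ z ∈ u, x ≤ z) ∧ ∀ z ∈ v, x ≤ z := by
        simp only [List.mem_append, List.mem_cons]
        refine ⟨fun h => ⟨fun z hz => h z (Or.inl (Or.inr hz)), fun z hz => h z (Or.inr hz)⟩, ?_⟩
        rintro ⟨h1, h2⟩ z ((rfl | hz) | hz)
        exacts [le_rfl, h1 z hz, h2 z hz]
      have hc1 : (u ++ x :: v).count x = u.count x + v.count x + 1 := by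
        rw [List.count_append, List.count_cons_self, add_assoc]
      have hc2 : (x :: u ++ v).count x = u.count x + v.count x + 1 := by
        rw [List.count_append, List.count_cons_self]
        ring
      rw [hc1, hc2, if_congr he1 rfl rfl, if_congr he2 rfl rfl]
      by_cases h1 : ∀ z ∈ u, x ≤ z <;> by_cases h2 : ∀ z ∈ v, x ≤ z
      · rw [if_pos ⟨h1, h2⟩, if_pos h1, if_pos h2]
        have p1 : ((u.count x : ℝ) + 1) ≠ 0 := by positivity
        have p2 : ((v.count x : ℝ) + 1) ≠ 0 := by positivity
        have p3 : ((u.count x : ℝ) + v.count x + 1 + 1) ≠ 0 := by positivity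
        push_cast
        field_simp
        ring
      · rw [if_neg (fun h => h2 h.2), if_neg h2]
        ring
      · rw [if_neg (fun h => h1 h.1), if_neg h1]
        ring
      · rw [if_neg (fun h => h1 h.1), if_neg h1]
        ring
    · have hn : ¬ ∀ z ∈ u ++ y :: v, x ≤ z := fun h => absurd (h y (by simp)) (not_le.2 hxy)
      rw [if_neg hn, zero_mul, zero_add]
      by_cases hu : ∀ z ∈ u, x ≤ z
      · have hc : (x :: u ++ v).count y = v.count y := by
          rw [List.count_append, List.count_eq_zero_of_not_mem (l := x :: u), zero_add]
          intro hx
          rcases List.mem_cons.1 hx with rfl | hx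
          · exact lt_irrefl _ hxy
          · exact absurd (hu y hx) (not_le.2 hxy)
        have he : (∀ z ∈ x :: u ++ v, y ≤ z) ↔ ∀ z ∈ v, y ≤ z := by
          refine ⟨fun h z hz => h z (List.mem_append_right _ hz), fun h z hz => ?_⟩
          rcases List.mem_append.1 hz with hz | hz
          · rcases List.mem_cons.1 hz with rfl | hz
            · exact hxy.le
            · exact hxy.le.trans (hu z hz)
          · exact h z hz
        rw [hc, if_congr he rfl rfl]
        ring
      · rw [if_neg hu]
        ring

end Sorted

/-! ### The coefficient map -/

section Coefficients

variable {s K L : ℕ}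

/-- The weights whose sum over decorations gives the coefficients of a frozen flow method. -/
def Tableau.weights (A : Tableau s K L) : Weights s (Fin K) (Fin L) where
  black o i k := o.elim (A.z0 i k) fun w => A.Z0 w i k
  white o k l := o.elim (A.zhat k l) fun w => A.Zhat w k l
  family _ := sortedWeight

theorem Tableau.weights_blackAt (A : Tableau s K L) (S : Planar) (i : Black S → Fin s)
    (k : Node S → Fin K) (v : Black S) :
    A.weights.blackAt none S i k v = blackCoeff A S i k v := by
  simp only [Weights.blackAt, blackCoeff, weights]
  cases blackParent S v <;> rfl

theorem Tableau.weights_whiteAt (A : Tableau s K L) (S : Planar) (i : Black S → Fin s)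
    (k : Node S → Fin K) (l : White S → Fin L) (v : White S) :
    A.weights.whiteAt none S i k l v = whiteCoeff A S i k v (l v) := by
  simp only [Weights.whiteAt, whiteCoeff, weights]
  cases whiteParent S v <;> rfl

open Classical in
theorem prod_sortedWeight (S : Planar) (k : Node S → Fin K) :
    (∏ v, sortedWeight ((children S v).map k)) * sortedWeight ((roots S).map k) =
      if IsLabelling S k then 1 / (labelFactorial S k : ℝ) else 0 := by
  split_ifs with h
  · simp only [sortedWeight, if_pos h.1, if_pos (h.2 _), labelFactorial]
    push_cast
    simp only [one_div, Finset.prod_inv_distrib, mul_inv, mul_comm]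
  · by_cases h1 : ((roots S).map k).Pairwise (· ≤ ·)
    · have h2 : ∃ v, ¬ ((children S v).map k).Pairwise (· ≤ ·) := by
        by_contra h2
        push Not at h2
        exact h ⟨h1, h2⟩
      obtain ⟨v, hv⟩ := h2
      rw [Finset.prod_eq_zero (Finset.mem_univ v), zero_mul]
      simp only [sortedWeight, if_neg hv]
    · simp only [sortedWeight, if_neg h1, mul_zero]

theorem sum_labellings (S : Planar) (F : (Node S → Fin K) → ℝ) :
    ∑ k ∈ labellings S K, (1 / (labelFactorial S k : ℝ)) * F k =
      ∑ k, (∏ v, sortedWeight ((children S v).map k)) * sortedWeight ((roots S).map k) * F k := by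
  classical
  rw [labellings, Finset.sum_filter]
  refine Finset.sum_congr rfl fun k _ => ?_
  rw [prod_sortedWeight]
  split_ifs <;> simp

/-- The coefficients of a frozen flow method as sums of weights over the labellings of the lianas
with random variables. -/
theorem coeff_eq_sum_gen (A : Tableau s K L) (π : ExoticForest) :
    coeff A π = ∑ l : White π.shape → Fin L, if ∀ v, l v = l (π.pair v) then
      A.weights.gen none π.shape l sortedWeight else 0 := by
  have h : ∀ l : White π.shape → Fin L, (if ∀ v, l v = l (π.pair v) then
      A.weights.gen none π.shape l sortedWeight else 0) =
      ∑ i : Black π.shape → Fin s, ∑ k ∈ labellings π.shape K,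
        (1 / (labelFactorial π.shape k : ℝ)) * ((∏ v, blackCoeff A π.shape i k v) *
        if ∀ v, l v = l (π.pair v) then ∏ v, whiteCoeff A π.shape i k v (l v) else 0) := by
    intro l
    simp only [sum_labellings]
    split_ifs
    · rw [Weights.gen_eq_sum]
      refine Finset.sum_congr rfl fun i _ => Finset.sum_congr rfl fun k _ => ?_
      simp only [Weights.term, Tableau.weights_blackAt, Tableau.weights_whiteAt,
        Finset.prod_mul_distrib]
      have : ∀ x w, A.weights.family x w = sortedWeight w := fun _ _ => rfl
      simp only [this]
      ring
    · simp
  simp only [h, coeff]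
  rw [Finset.sum_comm (s := (Finset.univ : Finset (White π.shape → Fin L)))]
  refine Finset.sum_congr rfl fun i _ => ?_
  rw [Finset.sum_comm (s := (Finset.univ : Finset (White π.shape → Fin L)))]
  refine Finset.sum_congr rfl fun k _ => ?_
  simp only [Finset.mul_sum, mul_assoc]

theorem coeffMap_single (A : Tableau s K L) (π : ExoticForest) :
    coeffMap A (Finsupp.single π 1) = coeff A π := by
  simp [coeffMap]

theorem coeff_one (A : Tableau s K L) : coeff A ExoticForest.one = 1 := by
  have : IsEmpty (White ExoticForest.one.shape) := inferInstanceAs (IsEmpty Empty)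
  rw [coeff_eq_sum_gen]
  simp only [IsEmpty.forall_iff, if_true]
  have h : ∀ l, A.weights.gen none ExoticForest.one.shape l sortedWeight = 1 := fun l =>
    sortedWeight_nil
  simp [h]

/-- Multiplicativity for single forests: a labelling of the white nodes of a shuffle is a pair of
labellings of the white nodes of the two operands, and the lianas are kept. -/
theorem sum_map_coeff_shuffle (A : Tableau s K L) (π η : ExoticForest) :
    ((π.shuffle η).map (coeff A)).sum = coeff A π * coeff A η := by
  have h1 : ∀ (l : White π.shape → Fin L) (m : White η.shape → Fin L),
      A.weights.gen none π.shape l sortedWeight * A.weights.gen none η.shape m sortedWeight =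
        A.weights.genShuffle none π.shape η.shape l m sortedWeight := by
    intro l m
    rw [Weights.genShuffle_eq]
    simp only [shuffleSum_sortedWeight]
    have e1 : ∀ u : List (Fin K),
        (A.weights.genLin none η.shape m fun v => sortedWeight u * sortedWeight v) =
        A.weights.genLin none η.shape m sortedWeight * sortedWeight u := fun u => by
      have := (A.weights.genLin none η.shape m).map_smul (sortedWeight u) sortedWeight
      rw [smul_eq_mul] at this
      rw [mul_comm]
      exact this
    simp only [e1]
    have := (A.weights.genLin none π.shape l).map_smul
      (A.weights.genLin none η.shape m sortedWeight) sortedWeight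
    rw [smul_eq_mul] at this
    rw [mul_comm]
    exact this.symm
  have h2 : coeff A π * coeff A η = ∑ l : White π.shape → Fin L, ∑ m : White η.shape → Fin L,
      if (∀ v, l v = l (π.pair v)) ∧ ∀ v, m v = m (η.pair v) then
        A.weights.genShuffle none π.shape η.shape l m sortedWeight else 0 := by
    rw [coeff_eq_sum_gen, coeff_eq_sum_gen, Finset.sum_mul_sum]
    refine Finset.sum_congr rfl fun l _ => Finset.sum_congr rfl fun m _ => ?_
    rw [← h1, ite_zero_mul_ite_zero]
  rw [h2, ExoticForest.shuffle, List.map_map]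
  have h3 : ∀ (l : White π.shape → Fin L) (m : White η.shape → Fin L),
      (if (∀ v, l v = l (π.pair v)) ∧ ∀ v, m v = m (η.pair v) then
        A.weights.genShuffle none π.shape η.shape l m sortedWeight else 0) =
      ((Planar.shuffle π.shape η.shape).map fun u =>
        if (∀ v, l v = l (π.pair v)) ∧ ∀ v, m v = m (η.pair v) then
          A.weights.gen none u.1 (fun v => Sum.elim l m (u.2 v)) sortedWeight else 0).sum := by
    intro l m
    split_ifs
    · rfl
    · simp
  simp only [h3, ← sum_map_sum]
  refine congrArg List.sum (List.map_congr_left fun u _ => ?_)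
  rw [Function.comp_apply, coeff_eq_sum_gen]
  let e : (White u.1 → Fin L) ≃ (White π.shape → Fin L) × (White η.shape → Fin L) :=
    (Equiv.arrowCongr u.2 (Equiv.refl _)).trans (Equiv.sumArrowEquivProdArrow _ _ _)
  rw [← e.symm.sum_comp, Fintype.sum_prod_type]
  refine Finset.sum_congr rfl fun l _ => Finset.sum_congr rfl fun m _ => ?_
  have e1 : e.symm (l, m) = fun v => Sum.elim l m (u.2 v) := by
    funext v
    rfl
  rw [e1]
  refine if_congr ?_ rfl rfl
  constructor
  · intro h
    refine ⟨fun v => ?_, fun v => ?_⟩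
    · simpa using h (u.2.symm (Sum.inl v))
    · simpa using h (u.2.symm (Sum.inr v))
  · rintro ⟨ha, hb⟩ v
    simp only [Equiv.apply_symm_apply]
    rcases u.2 v with w | w
    · exact ha w
    · exact hb w

/-- The coefficient map is a character of the shuffle algebra. -/
theorem isShuffleCharacter_coeffMap (A : Tableau s K L) : IsShuffleCharacter (coeffMap A) := by
  refine ⟨by rw [coeffMap_single, coeff_one], fun x y => ?_⟩
  have h : ∀ π η, coeffMap A
      (((π.shuffle η).map fun ρ => (Finsupp.single ρ 1 : ExoticSpace)).sum) =
        coeff A π * coeff A η := by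
    intro π η
    rw [map_list_sum, List.map_map, ← sum_map_coeff_shuffle]
    refine congrArg List.sum (List.map_congr_left fun ρ _ => ?_)
    exact coeffMap_single A ρ
  simp only [shuffleProduct, Finsupp.sum, map_sum, map_smul, h]
  simp only [coeffMap, Finsupp.linearCombination_apply, Finsupp.sum, Finset.sum_mul_sum,
    smul_eq_mul]
  refine Finset.sum_congr rfl fun π _ => Finset.sum_congr rfl fun η _ => ?_
  ring

end Coefficients

/-! ### Moments of the Gaussian and pairings -/

/-- The pairings of a set, as involutions without fixed point. -/
@[ext]
structure Pairing (V : Type*) where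
  toFun : V → V
  apply_apply : ∀ v, toFun (toFun v) = v
  apply_ne : ∀ v, toFun v ≠ v

open Classical in
instance (V : Type*) [Fintype V] : Fintype (Pairing V) :=
  Fintype.ofInjective Pairing.toFun fun _ _ h => Pairing.ext h

/-- The moments of the standard Gaussian distribution. -/
def gaussianMoment (n : ℕ) : ℝ := ∫ x, x ^ n ∂(gaussianReal 0 1)

theorem gaussianPDFReal_zero_one (x : ℝ) :
    gaussianPDFReal 0 1 x = (√(2 * Real.pi))⁻¹ * Real.exp (-(1 / 2) * x ^ 2) := by
  rw [gaussianPDFReal]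
  congr 2
  · simp
  · simp only [NNReal.coe_one]; ring

theorem integrable_pow_mul_gaussianPDFReal (n : ℕ) :
    Integrable (fun x : ℝ => x ^ n * gaussianPDFReal 0 1 x) := by
  have h := integrable_rpow_mul_exp_neg_mul_sq (b := 1 / 2) (by norm_num) (s := n)
    (by have : (0 : ℝ) ≤ n := Nat.cast_nonneg n
        linarith)
  simp only [Real.rpow_natCast] at h
  refine (h.const_mul (√(2 * Real.pi))⁻¹).congr (Filter.Eventually.of_forall fun x => ?_)
  simp only [gaussianPDFReal_zero_one]
  ring

theorem gaussianMoment_eq (n : ℕ) : gaussianMoment n = ∫ x, x ^ n * gaussianPDFReal 0 1 x := by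
  rw [gaussianMoment, integral_gaussianReal_eq_integral_smul one_ne_zero]
  simp only [smul_eq_mul, mul_comm]

theorem hasDerivAt_gaussianPDFReal (x : ℝ) :
    HasDerivAt (fun x => -gaussianPDFReal 0 1 x) (x * gaussianPDFReal 0 1 x) x := by
  have h : HasDerivAt (fun x : ℝ => -(1 / 2) * x ^ 2) (-(1 / 2) * (2 * x)) x := by
    simpa using (hasDerivAt_pow 2 x).const_mul (-(1 / 2) : ℝ)
  refine (((h.exp).const_mul (√(2 * Real.pi))⁻¹).neg.congr_deriv ?_).congr_of_eventuallyEq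
    (Filter.Eventually.of_forall fun y => by simp [gaussianPDFReal_zero_one])
  rw [gaussianPDFReal_zero_one]
  ring

theorem gaussianMoment_zero : gaussianMoment 0 = 1 := by
  simp [gaussianMoment]

theorem gaussianMoment_one : gaussianMoment 1 = 0 := by
  simp [gaussianMoment]

/-- Integration by parts. -/
theorem gaussianMoment_add_two (n : ℕ) :
    gaussianMoment (n + 2) = (n + 1) * gaussianMoment n := by
  have h := integral_mul_deriv_eq_deriv_mul_of_integrable (A := ℝ)
    (u := fun x => x ^ (n + 1)) (u' := fun x => ((n : ℝ) + 1) * x ^ n)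
    (v := fun x => -gaussianPDFReal 0 1 x) (v' := fun x => x * gaussianPDFReal 0 1 x)
    (fun x _ => by simpa using hasDerivAt_pow (n + 1) x)
    (fun x _ => hasDerivAt_gaussianPDFReal x)
    ((integrable_pow_mul_gaussianPDFReal (n + 2)).congr
      (Filter.Eventually.of_forall fun x => by simp only [Pi.mul_apply]; ring))
    (((integrable_pow_mul_gaussianPDFReal n).const_mul (-((n : ℝ) + 1))).congr
      (Filter.Eventually.of_forall fun x => by simp only [Pi.mul_apply]; ring))
    ((integrable_pow_mul_gaussianPDFReal (n + 1)).neg.congr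
      (Filter.Eventually.of_forall fun x => by simp only [Pi.mul_apply, Pi.neg_apply]; ring))
  rw [gaussianMoment_eq, gaussianMoment_eq, ← integral_const_mul]
  calc ∫ x, x ^ (n + 2) * gaussianPDFReal 0 1 x
      = ∫ x, x ^ (n + 1) * (x * gaussianPDFReal 0 1 x) := by
        congr 1; funext x; ring
    _ = -∫ x, ((n : ℝ) + 1) * x ^ n * -gaussianPDFReal 0 1 x := h
    _ = ∫ x, ((n : ℝ) + 1) * (x ^ n * gaussianPDFReal 0 1 x) := by
        rw [← integral_neg]; congr 1; funext x; ring

theorem gaussianMoment_odd (n : ℕ) : gaussianMoment (2 * n + 1) = 0 := by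
  induction n with
  | zero => exact gaussianMoment_one
  | succ n ih => rw [show 2 * (n + 1) + 1 = 2 * n + 1 + 2 by ring, gaussianMoment_add_two, ih,
      mul_zero]

theorem gaussianMoment_even (n : ℕ) :
    gaussianMoment (2 * n) * (2 ^ n * n.factorial) = (2 * n).factorial := by
  induction n with
  | zero => simp [gaussianMoment_zero]
  | succ n ih =>
    rw [show 2 * (n + 1) = 2 * n + 2 by ring, gaussianMoment_add_two, Nat.factorial_succ,
      Nat.factorial_succ (2 * n + 1), Nat.factorial_succ (2 * n)]
    push_cast
    rw [← ih]
    ring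

theorem cycleType_eq_replicate_iff {V : Type*} [Fintype V] [DecidableEq V] (g : Equiv.Perm V)
    (n : ℕ) (hn : Fintype.card V = 2 * n) :
    g.cycleType = Multiset.replicate n 2 ↔ (∀ v, g (g v) = v) ∧ ∀ v, g v ≠ v := by
  have : Fact (Nat.Prime 2) := ⟨Nat.prime_two⟩
  have h2 : (∀ v, g (g v) = v) ↔ ∀ c ∈ g.cycleType, c = 2 := by
    rw [← Equiv.Perm.pow_prime_eq_one_iff, Equiv.ext_iff]
    simp [pow_two]
  have hs := g.sum_cycleType
  have h3 : (∀ v, g v ≠ v) ↔ g.support.card = Fintype.card V := by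
    rw [Finset.card_eq_iff_eq_univ, Finset.eq_univ_iff_forall]
    simp [Equiv.Perm.mem_support]
  rw [Multiset.eq_replicate, h2, h3, and_comm]
  refine and_congr_right fun hc => ?_
  have : g.cycleType = Multiset.replicate (Multiset.card g.cycleType) 2 :=
    Multiset.eq_replicate.2 ⟨rfl, hc⟩
  rw [this, Multiset.sum_replicate, smul_eq_mul] at hs
  omega

/-- Pairings are the permutations whose cycles all have length two, which Mathlib counts. -/
theorem card_pairing_eq {V : Type*} [Fintype V] [DecidableEq V] (n : ℕ)
    (hn : Fintype.card V = 2 * n) : Fintype.card (Pairing V) =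
      (Finset.univ.filter fun g : Equiv.Perm V => g.cycleType = Multiset.replicate n 2).card := by
  rw [← Fintype.card_subtype]
  refine Fintype.card_congr
    { toFun := fun q => ⟨Function.Involutive.toPerm q.1 q.2,
        (cycleType_eq_replicate_iff _ n hn).2 ⟨q.2, q.3⟩⟩
      invFun := fun g => ⟨g.1, ((cycleType_eq_replicate_iff _ n hn).1 g.2).1,
        ((cycleType_eq_replicate_iff _ n hn).1 g.2).2⟩
      left_inv := fun q => rfl
      right_inv := fun g => Subtype.ext (Equiv.ext fun v => rfl) }

theorem isEmpty_pairing {V : Type*} [Fintype V] (hV : Odd (Fintype.card V)) :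
    IsEmpty (Pairing V) := by
  classical
  refine ⟨fun q => ?_⟩
  have : Fact (Nat.Prime 2) := ⟨Nat.prime_two⟩
  let g := Function.Involutive.toPerm q.1 q.2
  have h1 : ∀ c ∈ g.cycleType, c = 2 := by
    rw [← Equiv.Perm.pow_prime_eq_one_iff, Equiv.ext_iff]
    intro v
    exact q.2 v
  have h2 : g.support = Finset.univ := Finset.eq_univ_iff_forall.2 fun v =>
    Equiv.Perm.mem_support.2 (q.3 v)
  have hs := g.sum_cycleType
  rw [Multiset.eq_replicate.2 ⟨rfl, h1⟩, Multiset.sum_replicate, smul_eq_mul, h2,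
    Finset.card_univ] at hs
  rw [← hs] at hV
  exact (Nat.not_odd_iff_even.2 (even_two.mul_left _)) hV

/-- The moments of the Gaussian count pairings. -/
theorem card_pairing (V : Type*) [Fintype V] :
    (Fintype.card (Pairing V) : ℝ) = gaussianMoment (Fintype.card V) := by
  classical
  rcases Nat.even_or_odd' (Fintype.card V) with ⟨n, hn | hn⟩
  · have h := Equiv.Perm.card_of_cycleType_mul_eq V (Multiset.replicate n 2)
    have h0 : ∏ m ∈ (Multiset.replicate n 2).toFinset,
        (Multiset.count m (Multiset.replicate n 2)).factorial = n.factorial := by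
      rcases Nat.eq_zero_or_pos n with rfl | hpos
      · simp
      · rw [Multiset.toFinset_replicate, if_neg hpos.ne', Finset.prod_singleton,
          Multiset.count_replicate_self]
    rw [if_pos ⟨by simp [hn, mul_comm], fun a ha => (Multiset.eq_of_mem_replicate ha).ge⟩, h0,
      ← card_pairing_eq n hn, Multiset.sum_replicate, Multiset.prod_replicate, hn, smul_eq_mul,
      mul_comm n 2, Nat.sub_self, Nat.factorial_zero, one_mul] at h
    have hm := gaussianMoment_even n
    rw [← h] at hm
    push_cast at hm
    rw [hn]
    have : ((2 : ℝ) ^ n * n.factorial) ≠ 0 := by positivity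
    exact (mul_right_cancel₀ this hm).symm
  · have := isEmpty_pairing (V := V) (by rw [hn]; exact odd_two_mul_add_one n)
    rw [hn, gaussianMoment_odd, Fintype.card_eq_zero, Nat.cast_zero]

/-- A pairing that preserves colours is a family of pairings of the colour classes. -/
def pairingFiberEquiv {V C : Type*} (χ : V → C) :
    {q : Pairing V // ∀ v, χ (q.1 v) = χ v} ≃ ∀ c, Pairing {v // χ v = c} where
  toFun q c := ⟨fun v => ⟨q.1.1 v.1, (q.2 v.1).trans v.2⟩,
    fun v => Subtype.ext (q.1.2 v.1), fun v h => q.1.3 v.1 (congrArg Subtype.val h)⟩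
  invFun p :=
    have key : ∀ (c : C) (v : V) (h : χ v = c),
        ((p (χ v)).1 ⟨v, rfl⟩).1 = ((p c).1 ⟨v, h⟩).1 := by
      intro c v h
      subst h
      rfl
    ⟨⟨fun v => ((p (χ v)).1 ⟨v, rfl⟩).1,
      fun v => (key (χ v) _ ((p (χ v)).1 ⟨v, rfl⟩).2).trans
        (congrArg Subtype.val ((p (χ v)).2 ⟨v, rfl⟩)),
      fun v h => (p (χ v)).3 ⟨v, rfl⟩ (Subtype.ext h)⟩,
      fun v => ((p (χ v)).1 ⟨v, rfl⟩).2⟩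
  left_inv q := rfl
  right_inv p := by
    funext c
    refine Pairing.ext (funext fun v => Subtype.ext ?_)
    obtain ⟨v, rfl⟩ := v
    rfl

theorem card_pairing_color {V C : Type*} [Fintype V] [Fintype C] [DecidableEq C] (χ : V → C) :
    (Fintype.card {q : Pairing V // ∀ v, χ (q.1 v) = χ v} : ℝ) =
      ∏ c, gaussianMoment (Fintype.card {v // χ v = c}) := by
  classical
  rw [Fintype.card_congr (pairingFiberEquiv χ), Fintype.card_pi]
  push_cast
  simp only [card_pairing]

/-! ### Moments of the noise -/

section Noise

variable {Ω : Type*} [MeasurableSpace Ω] {P : Measure Ω} {D L N : ℕ}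
  {ξ : Fin D → Fin L → Ω → ℝ}

theorem IsNoise.moment_eq (hξ : IsNoise P N ξ) (d : Fin D) (l : Fin L) {n : ℕ}
    (hn : n ≤ 2 * N + 1) : ∫ z, ξ d l z ^ n ∂P = gaussianMoment n := by
  rcases Nat.even_or_odd' n with ⟨j, hj | hj⟩
  · exact hξ.moment d l n (by omega)
  · rw [hξ.odd d l n (by rw [hj]; exact odd_two_mul_add_one j), hj, gaussianMoment_odd]

/-- Wick's formula: the joint moments of the noise, up to order `2 N + 1`, count the pairings of the
factors that pair equal variables. -/
theorem IsNoise.integral_prod (hξ : IsNoise P N ξ) {V : Type*} [Fintype V]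
    (hV : Fintype.card V ≤ 2 * N + 1) (χ : V → Fin D × Fin L) :
    ∫ z, ∏ v, ξ (χ v).1 (χ v).2 z ∂P =
      ∑ q : Pairing V, if ∀ v, χ v = χ (q.1 v) then 1 else 0 := by
  -- Grouping equal variables gives a product of independent powers; the pairings that respect the
  -- groups are families of pairings of the groups.
  have h1 : ∀ z, ∏ v, ξ (χ v).1 (χ v).2 z =
      ∏ c : Fin D × Fin L, ξ c.1 c.2 z ^ Fintype.card {v // χ v = c} := by
    intro z
    rw [← Fintype.prod_fiberwise' χ fun c => ξ c.1 c.2 z]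
    simp
  have h2 := hξ.indep.integral_fun_prod_comp (𝕜 := ℝ)
    (f := fun c x => x ^ Fintype.card {v // χ v = c})
    (fun c => hξ.aemeasurable c.1 c.2)
    (fun c => (measurable_id.pow_const _).aestronglyMeasurable)
  simp only [h1]
  rw [h2, Finset.sum_boole, ← Fintype.card_subtype]
  refine Eq.trans ?_ ((card_pairing_color χ).symm.trans (congrArg Nat.cast
    (Fintype.card_congr (Equiv.subtypeEquivRight fun q => forall_congr' fun v => eq_comm))))
  refine Finset.prod_congr rfl fun c _ => hξ.moment_eq c.1 c.2 ?_
  exact (Fintype.card_subtype_le _).trans hV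

/-- A weight that dominates the noise. -/
def noiseWeight (x : Fin D → Fin L → ℝ) : ℝ := 1 + ∑ d, ∑ l, |x d l|

theorem one_le_noiseWeight (x : Fin D → Fin L → ℝ) : 1 ≤ noiseWeight x :=
  le_add_of_nonneg_right (Finset.sum_nonneg fun _ _ => Finset.sum_nonneg fun _ _ => abs_nonneg _)

theorem abs_le_noiseWeight (x : Fin D → Fin L → ℝ) (d : Fin D) (l : Fin L) :
    |x d l| ≤ noiseWeight x := by
  have h1 : |x d l| ≤ ∑ l, |x d l| :=
    Finset.single_le_sum (f := fun l => |x d l|) (fun _ _ => abs_nonneg _) (Finset.mem_univ l)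
  have h2 : ∑ l, |x d l| ≤ ∑ d, ∑ l, |x d l| :=
    Finset.single_le_sum (f := fun d => ∑ l, |x d l|)
      (fun _ _ => Finset.sum_nonneg fun _ _ => abs_nonneg _) (Finset.mem_univ d)
  rw [noiseWeight]
  linarith

theorem IsNoise.memLp [IsProbabilityMeasure P] (hξ : IsNoise P N ξ) (d : Fin D) (l : Fin L)
    (n : ℕ) : MemLp (ξ d l) n P := by
  have h : MemLp (ξ d l) ((2 * (n + 1) : ℕ) : ENNReal) P := by
    rw [← integrable_norm_rpow_iff (hξ.aemeasurable d l).aestronglyMeasurable (by simp)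
      (ENNReal.natCast_ne_top _)]
    refine (hξ.integrable d l (2 * (n + 1))).norm.congr (Filter.Eventually.of_forall fun z => ?_)
    simp only [ENNReal.toReal_natCast, Real.rpow_natCast, norm_pow]
  exact h.mono_exponent (by exact_mod_cast (by omega : n ≤ 2 * (n + 1)))

theorem IsNoise.integrable_noiseWeight_pow [IsProbabilityMeasure P] (hξ : IsNoise P N ξ) (n : ℕ) :
    Integrable (fun z => noiseWeight (fun d l => ξ d l z) ^ n) P := by
  have h : MemLp (fun z => noiseWeight (fun d l => ξ d l z)) n P := by
    have h1 : MemLp (fun z => ∑ d, ∑ l, |ξ d l z|) n P :=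
      memLp_finsetSum _ fun d _ => memLp_finsetSum _ fun l _ => (hξ.memLp d l n).norm
    exact (memLp_const (1 : ℝ)).add h1
  rcases Nat.eq_zero_or_pos n with rfl | hn
  · simp
  refine (h.integrable_norm_pow hn.ne').congr (Filter.Eventually.of_forall fun z => ?_)
  simp only [Real.norm_eq_abs]
  rw [abs_of_nonneg (zero_le_one.trans (one_le_noiseWeight _))]

theorem IsNoise.integrable_prod [IsProbabilityMeasure P] (hξ : IsNoise P N ξ) {V : Type*}
    (t : Finset V) (χ : V → Fin D × Fin L) :
    Integrable (fun z => ∏ v ∈ t, ξ (χ v).1 (χ v).2 z) P := by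
  refine (hξ.integrable_noiseWeight_pow t.card).mono' ?_ (Filter.Eventually.of_forall fun z => ?_)
  · exact (Finset.aemeasurable_fun_prod _ fun v _ => hξ.aemeasurable _ _).aestronglyMeasurable
  · rw [Real.norm_eq_abs, Finset.abs_prod]
    refine (Finset.prod_le_prod (fun _ _ => abs_nonneg _) fun v _ =>
      abs_le_noiseWeight (fun d l => ξ d l z) _ _).trans ?_
    rw [Finset.prod_const]

theorem IsNoise.integral_mul (hξ : IsNoise P N ξ) (hN : 1 ≤ N) (d : Fin D) (l l' : Fin L) :
    ∫ z, ξ d l z * ξ d l' z ∂P = if l = l' then 1 else 0 := by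
  by_cases h : l = l'
  · subst h
    rw [if_pos rfl]
    have := hξ.moment_eq d l (n := 2) (by omega)
    rw [show (2 : ℕ) = 0 + 2 from rfl, gaussianMoment_add_two, gaussianMoment_zero] at this
    simpa [pow_two] using this
  · rw [if_neg h]
    have hi : IndepFun (ξ d l) (ξ d l') P := hξ.indep.indepFun (i := (d, l)) (j := (d, l'))
      (by simpa using h)
    have h0 : ∫ z, ξ d l z ∂P = 0 := by simpa using hξ.odd d l 1 odd_one
    have := hi.integral_mul_eq_mul_integral (hξ.aemeasurable d l).aestronglyMeasurable
      (hξ.aemeasurable d l').aestronglyMeasurable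
    rw [h0, zero_mul] at this
    exact this

/-- The covariance of two linear combinations of the noise in the same direction. -/
theorem IsNoise.integral_sum_mul_sum [IsProbabilityMeasure P] (hξ : IsNoise P N ξ) (hN : 1 ≤ N)
    (d : Fin D) (a b : Fin L → ℝ) :
    ∫ z, (∑ l, a l * ξ d l z) * ∑ l, b l * ξ d l z ∂P = ∑ l, a l * b l := by
  have hint : ∀ l l', Integrable (fun z => ξ d l z * ξ d l' z) P := by
    intro l l'
    have := hξ.integrable_prod Finset.univ (fun v : Fin 2 => ((d, ![l, l'] v) : Fin D × Fin L))
    simpa [Fin.prod_univ_two] using this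
  have h : ∀ z, (∑ l, a l * ξ d l z) * ∑ l, b l * ξ d l z =
      ∑ l, ∑ l', a l * b l' * (ξ d l z * ξ d l' z) := by
    intro z
    rw [Finset.sum_mul_sum]
    exact Finset.sum_congr rfl fun l _ => Finset.sum_congr rfl fun l' _ => by ring
  simp only [h]
  rw [integral_finsetSum _ fun l _ => integrable_finsetSum _ fun l' _ => (hint l l').const_mul _]
  refine Finset.sum_congr rfl fun l _ => ?_
  rw [integral_finsetSum _ fun l' _ => (hint l l').const_mul _]
  simp only [integral_const_mul, hξ.integral_mul hN]
  simp

end Noise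

/-! ### Lianas -/

open Classical in
/-- A sum over labels that agree on the blocks `{v, q v}` is a product of sums over one label for
each block. -/
theorem sum_invariant_prod {V Λ : Type*} [Fintype V] [DecidableEq V] [Fintype Λ] (q : V → V)
    (hq : ∀ v, q (q v) = v) (c : V → Λ → ℝ) :
    ∑ l : V → Λ, (if ∀ v, l v = l (q v) then ∏ v, c v (l v) else 0) =
      ∏ ℓ ∈ (Finset.univ.image fun v => ({v, q v} : Finset V)), ∑ x, ∏ v ∈ ℓ, c v x := by
  set B := Finset.univ.image fun v => ({v, q v} : Finset V) with hB
  have hmem : ∀ v, ({v, q v} : Finset V) ∈ B := fun v =>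
    Finset.mem_image_of_mem _ (Finset.mem_univ v)
  have hblock : ∀ v w : V, ({v, q v} : Finset V) = {w, q w} ↔ v ∈ ({w, q w} : Finset V) := by
    intro v w
    constructor
    · intro h
      rw [← h]
      simp
    · intro h
      simp only [Finset.mem_insert, Finset.mem_singleton] at h
      rcases h with rfl | rfl
      · rfl
      · rw [hq, Finset.pair_comm]
  have hfib : ∀ ℓ ∈ B, (Finset.univ.filter fun v => ({v, q v} : Finset V) = ℓ) = ℓ := by
    intro ℓ hℓ
    obtain ⟨w, -, rfl⟩ := Finset.mem_image.1 hℓ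
    ext v
    simp only [Finset.mem_filter, Finset.mem_univ, true_and]
    exact hblock v w
  rw [← Finset.prod_coe_sort B fun ℓ => ∑ x, ∏ v ∈ ℓ, c v x, Finset.prod_univ_sum,
    Fintype.piFinset_univ, ← Finset.sum_filter]
  symm
  let lift : (B → Λ) → V → Λ := fun g v => g ⟨{v, q v}, hmem v⟩
  have hchoose : ∀ ℓ : B, ∃ w, ({w, q w} : Finset V) = ℓ.1 := fun ℓ => by
    obtain ⟨w, -, hw⟩ := Finset.mem_image.1 ℓ.2
    exact ⟨w, hw⟩
  choose rep hrep using hchoose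
  refine Finset.sum_nbij' (i := lift) (j := fun l ℓ => l (rep ℓ)) ?_ (fun _ _ => Finset.mem_univ _)
    ?_ ?_ ?_
  · intro g _
    refine Finset.mem_filter.2 ⟨Finset.mem_univ _, fun v => ?_⟩
    refine congrArg g (Subtype.ext ?_)
    simp only [hq]
    exact Finset.pair_comm _ _
  · intro g _
    funext ℓ
    exact congrArg g (Subtype.ext (hrep ℓ))
  · intro l hl
    funext v
    have hl' := (Finset.mem_filter.1 hl).2
    have h := (hblock _ _).1 (hrep ⟨{v, q v}, hmem v⟩)
    simp only [Finset.mem_insert, Finset.mem_singleton] at h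
    rcases h with h | h
    · simp only [lift, h]
    · simp only [lift]
      rw [h, ← hl']
  · intro g _
    rw [← Finset.prod_fiberwise_of_maps_to (t := B) (g := fun v => ({v, q v} : Finset V))
      (fun v _ => hmem v), ← Finset.prod_coe_sort B]
    refine Finset.prod_congr rfl fun ℓ _ => ?_
    rw [hfib ℓ.1 ℓ.2]
    refine Finset.prod_congr rfl fun v hv => ?_
    refine congrArg (c v) (congrArg g (Subtype.ext ?_))
    have : v ∈ Finset.univ.filter fun v => ({v, q v} : Finset V) = ℓ.1 := by
      rw [hfib ℓ.1 ℓ.2]; exact hv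
    exact (Finset.mem_filter.1 this).2.symm

/-- The factor of a liana is the covariance of two linear combinations of the noise, for any common
direction of its two ends. -/
theorem coeff_eq_coeffByExpectation {s K L D N : ℕ} (hN : 1 ≤ N) {Ω : Type*} [MeasurableSpace Ω]
    (P : Measure Ω) [IsProbabilityMeasure P] (ξ : Fin D → Fin L → Ω → ℝ) (hξ : IsNoise P N ξ)
    (A : Tableau s K L) (π : ExoticForest) (d : White π.shape → Fin D)
    (hd : ∀ v, d v = d (π.pair v)) : coeff A π = coeffByExpectation P ξ A π d := by
  classical
  refine Finset.sum_congr rfl fun i _ => Finset.sum_congr rfl fun k _ => ?_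
  congr 1
  have h := sum_invariant_prod π.pair π.pair_pair (whiteCoeff A π.shape i k)
  refine (Finset.sum_congr rfl fun l _ => ?_).trans (h.trans ?_)
  · congr
  have e2 : π.lianas = Finset.univ.image fun v => ({v, π.pair v} : Finset (White π.shape)) := by
    ext; simp [ExoticForest.lianas]
  rw [e2]
  refine Finset.prod_congr rfl fun ℓ hℓ => ?_
  obtain ⟨v, -, rfl⟩ := Finset.mem_image.1 hℓ
  simp only [Finset.prod_pair (π.pair_ne v).symm, ← hd v]
  exact (hξ.integral_sum_mul_sum hN (d v) _ _).symm

/-! ### Vector fields and their integral curves -/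

section Geometry

variable {m : ℕ} {M : Type*}

section Topological

variable [TopologicalSpace M] [ChartedSpace (EuclideanSpace ℝ (Fin m)) M]

theorem iterDeriv_append {D : ℕ} (E : Fin D → (x : M) → TangentSpace (𝓡 m) x)
    (I J : List (Fin D)) (φ : M → ℝ) :
    iterDeriv E (I ++ J) φ = iterDeriv E I (iterDeriv E J φ) := by
  simp [iterDeriv, List.foldr_append]

/-- The derivative of a function along an integral curve of a frozen vector field. -/
theorem hasDerivAt_comp_integralCurve {D : ℕ} {E : Fin D → (x : M) → TangentSpace (𝓡 m) x}
    {g : Fin D → ℝ} {γ : ℝ → M}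
    (hγ : IsMIntegralCurve (I := 𝓡 m) γ (fun x => ∑ d, g d • E d x)) {φ : M → ℝ}
    (hφ : ContMDiff (𝓡 m) 𝓘(ℝ, ℝ) ∞ φ) (t : ℝ) :
    HasDerivAt (fun t => φ (γ t)) (∑ d, g d * lieDeriv (E d) φ (γ t)) t := by
  have h1 : HasMFDerivAt (𝓡 m) 𝓘(ℝ, ℝ) φ (γ t) (mfderiv (𝓡 m) 𝓘(ℝ, ℝ) φ (γ t)) :=
    (hφ.mdifferentiable (by simp) (γ t)).hasMFDerivAt
  have h2 := h1.comp t (hγ t)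
  let T : ℝ →L[ℝ] ℝ := (mfderiv (𝓡 m) 𝓘(ℝ, ℝ) φ (γ t)).comp
    ((1 : ℝ →L[ℝ] ℝ).smulRight (∑ d, g d • E d (γ t)))
  have h3 : HasFDerivAt (fun t => φ (γ t)) T t := h2.hasFDerivAt
  refine h3.hasDerivAt.congr_deriv ?_
  have h4 : mfderiv (𝓡 m) 𝓘(ℝ, ℝ) φ (γ t) (∑ d, g d • E d (γ t)) =
      ∑ d, g d * lieDeriv (E d) φ (γ t) := by
    rw [map_sum]
    refine Finset.sum_congr rfl fun d _ => ?_
    rw [map_smul]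
    rfl
  rw [← h4]
  exact congrArg (mfderiv (𝓡 m) 𝓘(ℝ, ℝ) φ (γ t)) (one_smul ℝ (∑ d, g d • E d (γ t)))

variable [IsManifold (𝓡 m) ∞ M]

theorem contMDiff_lieDeriv {X : (x : M) → TangentSpace (𝓡 m) x}
    (hX : ContMDiff (𝓡 m) (𝓡 m).tangent ∞ (fun x => (⟨x, X x⟩ : TangentBundle (𝓡 m) M)))
    {φ : M → ℝ} (hφ : ContMDiff (𝓡 m) 𝓘(ℝ, ℝ) ∞ φ) :
    ContMDiff (𝓡 m) 𝓘(ℝ, ℝ) ∞ (lieDeriv X φ) := by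
  have h1 : ContMDiff (𝓡 m).tangent 𝓘(ℝ, ℝ).tangent ∞ (tangentMap (𝓡 m) 𝓘(ℝ, ℝ) φ) :=
    hφ.contMDiff_tangentMap (m := ∞) (n := ∞) le_rfl
  have h2 := (contMDiff_snd_tangentBundle_modelSpace (n := ∞) ℝ 𝓘(ℝ, ℝ)).comp (h1.comp hX)
  exact h2

theorem contMDiff_iterDeriv {D : ℕ} {E : Fin D → (x : M) → TangentSpace (𝓡 m) x}
    (hE : IsFrame E) {φ : M → ℝ} (hφ : ContMDiff (𝓡 m) 𝓘(ℝ, ℝ) ∞ φ) (I : List (Fin D)) :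
    ContMDiff (𝓡 m) 𝓘(ℝ, ℝ) ∞ (iterDeriv E I φ) := by
  induction I with
  | nil => exact hφ
  | cons d I ih => exact contMDiff_lieDeriv (hE.1 d) ih

/-- Integral curves of a continuous vector field are continuously differentiable. -/
theorem contMDiff_integralCurve {v : (x : M) → TangentSpace (𝓡 m) x}
    (hv : Continuous (fun x => (⟨x, v x⟩ : TangentBundle (𝓡 m) M))) {γ : ℝ → M}
    (hγ : IsMIntegralCurve (I := 𝓡 m) γ v) : ContMDiff 𝓘(ℝ, ℝ) (𝓡 m) 1 γ := by
  intro t₀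
  rw [contMDiffAt_iff_target]
  refine ⟨hγ.continuous.continuousAt, ?_⟩
  rw [contMDiffAt_iff_contDiffAt, contDiffAt_one_iff]
  -- In the chart at `γ t₀`, the derivative of the curve is the vector field in the trivialization,
  -- which is continuous along the curve.
  let w : ℝ → EuclideanSpace ℝ (Fin m) := fun t =>
    (trivializationAt (EuclideanSpace ℝ (Fin m)) (TangentSpace (𝓡 m)) (γ t₀) ⟨γ t, v (γ t)⟩).2
  have hw : ∀ t, w t = tangentCoordChange (𝓡 m) (γ t) (γ t₀) (γ t) (v (γ t)) := by
    intro t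
    simp only [w, TangentBundle.trivializationAt_apply]
    rfl
  have hU : IsOpen (γ ⁻¹' (chartAt (EuclideanSpace ℝ (Fin m)) (γ t₀)).source) :=
    (chartAt (EuclideanSpace ℝ (Fin m)) (γ t₀)).open_source.preimage hγ.continuous
  have hwc : ContinuousOn w (γ ⁻¹' (chartAt (EuclideanSpace ℝ (Fin m)) (γ t₀)).source) := by
    refine continuous_snd.comp_continuousOn ?_
    refine (trivializationAt (EuclideanSpace ℝ (Fin m)) (TangentSpace (𝓡 m))
      (γ t₀)).continuousOn.comp (hv.comp hγ.continuous).continuousOn fun t ht => ?_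
    rw [TangentBundle.trivializationAt_source]
    exact ht
  have hd := (hγ.isMIntegralCurveAt t₀).eventually_hasDerivAt
  obtain ⟨u, hu, hu'⟩ := Filter.eventually_iff_exists_mem.1 hd
  refine ⟨fun t => (1 : ℝ →L[ℝ] ℝ).smulRight (w t),
    u ∩ γ ⁻¹' (chartAt (EuclideanSpace ℝ (Fin m)) (γ t₀)).source,
    Filter.inter_mem hu (hU.mem_nhds (mem_chart_source _ _)), ?_, ?_⟩
  · exact ((ContinuousLinearMap.smulRightL ℝ ℝ (EuclideanSpace ℝ (Fin m))
      (1 : ℝ →L[ℝ] ℝ)).continuous.comp_continuousOn hwc).mono Set.inter_subset_right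
  · intro t ht
    have := hu' t ht.1
    rw [← hw t] at this
    exact this.hasFDerivAt

end Topological

open scoped Bundle

section Metric

variable [MetricSpace M] [ChartedSpace (EuclideanSpace ℝ (Fin m)) M] [IsManifold (𝓡 m) ∞ M]
  [Bundle.RiemannianBundle (fun x : M => TangentSpace (𝓡 m) x)]
  [IsRiemannianManifold (𝓡 m) M]

/-- Along an integral curve of a frozen vector field, the distance to the initial point is bounded
by the size of the coefficients. -/
theorem dist_integralCurve_le {D : ℕ} {E : Fin D → (x : M) → TangentSpace (𝓡 m) x}
    (hE : IsFrame E) {C : ℝ} (hC : 0 ≤ C) (hEb : ∀ d x, ‖E d x‖ ≤ C)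
    {g : Fin D → ℝ} {γ : ℝ → M}
    (hγ : IsMIntegralCurve (I := 𝓡 m) γ (fun x => ∑ d, g d • E d x)) {t : ℝ} (h0 : 0 ≤ t)
    (h1 : t ≤ 1) : dist (γ 0) (γ t) ≤ C * ∑ d, |g d| := by
  have hsm : ContMDiff (𝓡 m) (𝓡 m).tangent ∞
      (fun x => (⟨x, ∑ d, g d • E d x⟩ : TangentBundle (𝓡 m) M)) :=
    ContMDiff.sum_section (s := Finset.univ) (t := fun d x => g d • E d x)
      fun d _ => ContMDiff.const_smul_section (a := g d) (hE.1 d)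
  have hreg := contMDiff_integralCurve hsm.continuous hγ
  have hb : ∀ x, ‖∑ d, g d • E d x‖ ≤ C * ∑ d, |g d| := by
    intro x
    refine (norm_sum_le _ _).trans ?_
    rw [Finset.mul_sum]
    refine Finset.sum_le_sum fun d _ => ?_
    rw [norm_smul, mul_comm, Real.norm_eq_abs]
    exact mul_le_mul_of_nonneg_right (hEb d x) (abs_nonneg _)
  have hA : 0 ≤ C * ∑ d, |g d| := mul_nonneg hC (Finset.sum_nonneg fun _ _ => abs_nonneg _)
  have he : edist (γ 0) (γ t) ≤ ENNReal.ofReal (C * ∑ d, |g d|) := by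
    rw [IsRiemannianManifold.out (I := 𝓡 m) (γ 0) (γ t)]
    refine (Manifold.riemannianEDist_le_pathELength hreg.contMDiffOn rfl rfl h0).trans ?_
    rw [Manifold.pathELength_eq_lintegral_mfderiv_Icc]
    have hd : ∀ s, ‖mfderiv 𝓘(ℝ, ℝ) (𝓡 m) γ s 1‖ₑ ≤ ENNReal.ofReal (C * ∑ d, |g d|) := by
      intro s
      have h2 : mfderiv 𝓘(ℝ, ℝ) (𝓡 m) γ s 1 = ∑ d, g d • E d (γ s) :=
        (congrArg (fun T => T 1) (hγ s).mfderiv).trans (one_smul ℝ (∑ d, g d • E d (γ s)))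
      rw [h2, ← ofReal_norm]
      exact ENNReal.ofReal_le_ofReal (hb _)
    calc ∫⁻ s in Set.Icc 0 t, ‖mfderiv 𝓘(ℝ, ℝ) (𝓡 m) γ s 1‖ₑ
        ≤ ∫⁻ s in Set.Icc 0 t, ENNReal.ofReal (C * ∑ d, |g d|) := lintegral_mono hd
      _ = ENNReal.ofReal (C * ∑ d, |g d|) * ENNReal.ofReal t := by
        rw [setLIntegral_const, Real.volume_Icc, sub_zero]
      _ ≤ ENNReal.ofReal (C * ∑ d, |g d|) := by
        refine mul_le_of_le_one_right' ?_
        exact ENNReal.ofReal_le_one.2 h1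
  rw [edist_dist] at he
  exact (ENNReal.ofReal_le_ofReal_iff hA).1 he

end Metric

end Geometry

/-! ### Families of polynomial growth -/

section PolyO

variable {ι ι' : Type*}

/-- A scale: sizes `W` at least one and stepsizes `ε` in `[0, 1]`. -/
structure IsScale (W ε : ι → ℝ) : Prop where
  one_le : ∀ t, 1 ≤ W t
  nonneg : ∀ t, 0 ≤ ε t
  le_one : ∀ t, ε t ≤ 1

/-- `PolyO W ε n a`: the family `a` is of order `ε ^ n`, uniformly up to a polynomial in the
size `W`. -/
def PolyO (W ε : ι → ℝ) (n : ℕ) (a : ι → ℝ) : Prop :=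
  ∃ (C : ℝ) (κ : ℕ), 0 ≤ C ∧ ∀ t, |a t| ≤ C * W t ^ κ * ε t ^ n

variable {W ε : ι → ℝ} {n m : ℕ} {a b : ι → ℝ}

namespace PolyO

theorem comp (h : PolyO W ε n a) (e : ι' → ι) :
    PolyO (fun t => W (e t)) (fun t => ε (e t)) n (fun t => a (e t)) := by
  obtain ⟨C, κ, h0, h⟩ := h
  exact ⟨C, κ, h0, fun t => h _⟩

theorem of_le (hb : PolyO W ε n b) (h : ∀ t, |a t| ≤ |b t|) : PolyO W ε n a := by
  obtain ⟨C, κ, h0, hb⟩ := hb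
  exact ⟨C, κ, h0, fun t => (h t).trans (hb t)⟩

theorem const (c : ℝ) : PolyO W ε 0 (fun _ => c) :=
  ⟨|c|, 0, abs_nonneg _, fun _ => by simp⟩

theorem zero : PolyO W ε n (fun _ => 0) := ⟨0, 0, le_rfl, fun _ => by simp⟩

theorem size (hs : IsScale W ε) : PolyO W ε 0 W :=
  ⟨1, 1, zero_le_one, fun t => by
    rw [abs_of_nonneg (zero_le_one.trans (hs.one_le t))]; simp⟩

theorem step_pow (hs : IsScale W ε) (n : ℕ) : PolyO W ε n (fun t => ε t ^ n) :=
  ⟨1, 0, zero_le_one, fun t => by rw [abs_of_nonneg (pow_nonneg (hs.nonneg t) n)]; simp⟩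

theorem add (hs : IsScale W ε) (ha : PolyO W ε n a) (hb : PolyO W ε n b) :
    PolyO W ε n (fun t => a t + b t) := by
  obtain ⟨C, κ, h0, ha⟩ := ha
  obtain ⟨C', κ', h0', hb⟩ := hb
  refine ⟨C + C', κ + κ', add_nonneg h0 h0', fun t => ?_⟩
  have hε := pow_nonneg (hs.nonneg t) n
  have h1 : W t ^ κ ≤ W t ^ (κ + κ') := pow_le_pow_right₀ (hs.one_le t) (by omega)
  have h2 : W t ^ κ' ≤ W t ^ (κ + κ') := pow_le_pow_right₀ (hs.one_le t) (by omega)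
  calc |a t + b t| ≤ |a t| + |b t| := abs_add_le _ _
    _ ≤ C * W t ^ κ * ε t ^ n + C' * W t ^ κ' * ε t ^ n := add_le_add (ha t) (hb t)
    _ ≤ C * W t ^ (κ + κ') * ε t ^ n + C' * W t ^ (κ + κ') * ε t ^ n := by gcongr
    _ = (C + C') * W t ^ (κ + κ') * ε t ^ n := by ring

theorem neg (ha : PolyO W ε n a) : PolyO W ε n (fun t => -a t) :=
  ha.of_le fun _ => (abs_neg _).le

theorem sub (hs : IsScale W ε) (ha : PolyO W ε n a) (hb : PolyO W ε n b) :
    PolyO W ε n (fun t => a t - b t) := by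
  simpa only [sub_eq_add_neg] using ha.add hs hb.neg

theorem mul (ha : PolyO W ε n a) (hb : PolyO W ε m b) :
    PolyO W ε (n + m) (fun t => a t * b t) := by
  obtain ⟨C, κ, h0, ha⟩ := ha
  obtain ⟨C', κ', h0', hb⟩ := hb
  refine ⟨C * C', κ + κ', mul_nonneg h0 h0', fun t => ?_⟩
  calc |a t * b t| = |a t| * |b t| := abs_mul _ _
    _ ≤ (C * W t ^ κ * ε t ^ n) * (C' * W t ^ κ' * ε t ^ m) :=
        mul_le_mul (ha t) (hb t) (abs_nonneg _) ((abs_nonneg _).trans (ha t))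
    _ = C * C' * W t ^ (κ + κ') * ε t ^ (n + m) := by ring

theorem mono (hs : IsScale W ε) (ha : PolyO W ε n a) (h : m ≤ n) : PolyO W ε m a := by
  obtain ⟨C, κ, h0, ha⟩ := ha
  refine ⟨C, κ, h0, fun t => (ha t).trans ?_⟩
  have hW := pow_nonneg (zero_le_one.trans (hs.one_le t)) κ
  exact mul_le_mul_of_nonneg_left (pow_le_pow_of_le_one (hs.nonneg t) (hs.le_one t) h)
    (mul_nonneg h0 hW)

theorem const_mul (c : ℝ) (ha : PolyO W ε n a) :
    PolyO W ε n (fun t => c * a t) := by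
  simpa only [zero_add] using (PolyO.const c).mul ha

theorem sum (hs : IsScale W ε) {α : Type*} (s : Finset α) {a : α → ι → ℝ}
    (ha : ∀ x ∈ s, PolyO W ε n (a x)) : PolyO W ε n (fun t => ∑ x ∈ s, a x t) := by
  classical
  induction s using Finset.induction_on with
  | empty => simpa using PolyO.zero
  | insert x s hx ih =>
    simp only [Finset.sum_insert hx]
    exact (ha x (Finset.mem_insert_self _ _)).add hs
      (ih fun y hy => ha y (Finset.mem_insert_of_mem hy))

theorem pow (ha : PolyO W ε 0 a) (j : ℕ) :
    PolyO W ε 0 (fun t => a t ^ j) := by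
  induction j with
  | zero => simpa using PolyO.const 1
  | succ j ih => simpa only [pow_succ] using ih.mul ha

theorem list_prod {α : Type*} {a : α → ι → ℝ}
    (ha : ∀ x, PolyO W ε 1 (a x)) (w : List α) :
    PolyO W ε w.length (fun t => (w.map fun x => a x t).prod) := by
  induction w with
  | nil => simpa using PolyO.const 1
  | cons x w ih =>
    simp only [List.map_cons, List.prod_cons, List.length_cons]
    rw [add_comm]
    exact (ha x).mul ih

theorem list_prod_sub (hs : IsScale W ε) {α : Type*} {a b : α → ι → ℝ}
    (ha : ∀ x, PolyO W ε 1 (a x)) (hb : ∀ x, PolyO W ε 1 (b x))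
    (hab : ∀ x, PolyO W ε n (fun t => a x t - b x t)) (w : List α) :
    PolyO W ε n (fun t => (w.map fun x => a x t).prod - (w.map fun x => b x t).prod) := by
  induction w with
  | nil => simpa using PolyO.zero
  | cons x w ih =>
    have h1 := ((ha x).mono hs (Nat.zero_le 1)).mul ih
    have h2 := (hab x).mul ((PolyO.list_prod hb w).mono hs (Nat.zero_le _))
    rw [zero_add] at h1
    rw [add_zero] at h2
    refine (h1.add hs h2).of_le fun t => le_of_eq (congrArg abs ?_)
    simp only [List.map_cons, List.prod_cons]
    ring

end PolyO

end PolyO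

/-! ### Sums over words -/

section WordSum

variable {κ : Type*} [Fintype κ]

/-- The sum of `F` over all words of length `m`. -/
def wordSum : ℕ → (List κ → ℝ) → ℝ
  | 0, F => F []
  | m + 1, F => ∑ x, wordSum m fun w => F (x :: w)

theorem wordSum_concat (m : ℕ) (F : List κ → ℝ) :
    wordSum (m + 1) F = ∑ x, wordSum m fun w => F (w ++ [x]) := by
  induction m generalizing F with
  | zero => rfl
  | succ m ih =>
    change (∑ x, wordSum (m + 1) fun w => F (x :: w)) =
      ∑ x, ∑ y, wordSum m fun w => F (y :: (w ++ [x]))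
    simp only [ih]
    rw [Finset.sum_comm]

theorem wordSum_const_mul (m : ℕ) (c : ℝ) (F : List κ → ℝ) :
    wordSum m (fun w => c * F w) = c * wordSum m F := by
  induction m generalizing F with
  | zero => rfl
  | succ m ih => simp only [wordSum, ih, Finset.mul_sum]

theorem wordSum_zero (m : ℕ) : wordSum m (fun _ : List κ => (0 : ℝ)) = 0 := by
  simpa using wordSum_const_mul m 0 (fun _ : List κ => (0 : ℝ))

theorem wordSum_sub (m : ℕ) (F G : List κ → ℝ) :
    wordSum m (fun w => F w - G w) = wordSum m F - wordSum m G := by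
  induction m generalizing F G with
  | zero => rfl
  | succ m ih => simp only [wordSum, ih, Finset.sum_sub_distrib]

theorem hasDerivAt_wordSum (m : ℕ) {F : ℝ → List κ → ℝ} {F' : List κ → ℝ} {s : ℝ}
    (h : ∀ w, HasDerivAt (fun s => F s w) (F' w) s) :
    HasDerivAt (fun s => wordSum m (F s)) (wordSum m F') s := by
  induction m generalizing F F' with
  | zero => exact h []
  | succ m ih => exact HasDerivAt.fun_sum fun x _ => ih fun w => h (x :: w)

theorem PolyO.wordSum {ι : Type*} {W ε : ι → ℝ} (hs : IsScale W ε) {n : ℕ} (m : ℕ)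
    {F : ι → List κ → ℝ} (h : ∀ w : List κ, w.length = m → PolyO W ε n (fun t => F t w)) :
    PolyO W ε n (fun t => wordSum m (F t)) := by
  induction m generalizing F with
  | zero => exact h [] rfl
  | succ m ih => exact PolyO.sum hs _ fun x _ => ih fun w hw => h (x :: w) (by simp [hw])

end WordSum

/-! ### Composition of flows -/

section Weight

variable {K : ℕ}

theorem multiFactorial_concat (u : List (Fin K)) (x : Fin K) :
    multiFactorial (u ++ [x]) = (u.count x + 1) * multiFactorial u := by
  rw [← multiFactorial_cons]
  simp only [multiFactorial, (List.perm_append_singleton x u).count_eq]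

open Classical in
/-- The weight of a word of labels at the start of the flow number `j`: only labels less than `j`
occur. -/
def startWeight (j : ℕ) (u : List (Fin K)) : ℝ :=
  if u.Pairwise (· ≤ ·) ∧ ∀ y ∈ u, y.val < j then 1 / (multiFactorial u : ℝ) else 0

open Classical in
/-- The weight of a word of labels at the time `s` of the flow number `k`. -/
def flowWeight (k : Fin K) (s : ℝ) (u : List (Fin K)) : ℝ :=
  if u.Pairwise (· ≤ ·) ∧ ∀ y ∈ u, y ≤ k then s ^ u.count k / (multiFactorial u : ℝ) else 0

theorem startWeight_zero (u : List (Fin K)) : startWeight 0 u = if u = [] then 1 else 0 := by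
  cases u with
  | nil => simp [startWeight, multiFactorial]
  | cons x u =>
    rw [startWeight, if_neg fun h => Nat.not_lt_zero _ (h.2 x (by simp)), if_neg (by simp)]

theorem startWeight_last (u : List (Fin K)) : startWeight K u = sortedWeight u := by
  simp [startWeight, sortedWeight]

theorem flowWeight_zero (k : Fin K) (u : List (Fin K)) :
    flowWeight k 0 u = startWeight k.val u := by
  by_cases hk : k ∈ u
  · have h1 : ¬ ∀ y ∈ u, y.val < k.val := fun h => lt_irrefl _ (h k hk)
    have h2 : u.count k ≠ 0 := (List.count_pos_iff.2 hk).ne'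
    simp only [flowWeight, startWeight, h1, and_false, if_false, zero_pow h2, zero_div, ite_self]
  · have h1 : (∀ y ∈ u, y ≤ k) ↔ ∀ y ∈ u, y.val < k.val :=
      forall₂_congr fun y hy =>
        ⟨fun h => lt_of_le_of_ne h fun e => hk (Fin.ext e ▸ hy), fun h => h.le⟩
    simp only [flowWeight, startWeight, h1, List.count_eq_zero_of_not_mem hk, pow_zero]

theorem flowWeight_one (k : Fin K) (u : List (Fin K)) :
    flowWeight k 1 u = startWeight (k.val + 1) u := by
  have h1 : (∀ y ∈ u, y ≤ k) ↔ ∀ y ∈ u, y.val < k.val + 1 :=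
    forall₂_congr fun y hy => Nat.lt_succ_iff.symm
  simp only [flowWeight, startWeight, h1, one_pow]

theorem flowWeight_nil (k : Fin K) (s : ℝ) : flowWeight k s [] = 1 := by
  simp [flowWeight, multiFactorial]

/-- The derivative of the weight of a word removes the last letter. -/
theorem hasDerivAt_flowWeight (k x : Fin K) (u : List (Fin K)) (s : ℝ) :
    HasDerivAt (fun s => flowWeight k s (u ++ [x])) (if x = k then flowWeight k s u else 0) s := by
  by_cases hx : x = k
  · subst hx
    have h1 : ((u ++ [x]).Pairwise (· ≤ ·) ∧ ∀ y ∈ u ++ [x], y ≤ x) ↔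
        (u.Pairwise (· ≤ ·) ∧ ∀ y ∈ u, y ≤ x) := by
      simp only [List.pairwise_append, List.mem_append, List.mem_singleton]
      constructor
      · rintro ⟨⟨h, -, -⟩, h'⟩
        exact ⟨h, fun y hy => h' y (Or.inl hy)⟩
      · rintro ⟨h, h'⟩
        refine ⟨⟨h, by simp, fun y hy z hz => hz ▸ h' y hy⟩, ?_⟩
        rintro y (hy | rfl)
        exacts [h' y hy, le_rfl]
    rw [if_pos rfl]
    simp only [flowWeight, h1]
    split_ifs
    · have h2 : (u ++ [x]).count x = u.count x + 1 := by simp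
      rw [h2, multiFactorial_concat]
      refine ((hasDerivAt_pow (u.count x + 1) s).div_const _).congr_deriv ?_
      have h3 : (multiFactorial u : ℝ) ≠ 0 := by exact_mod_cast (multiFactorial_pos u).ne'
      have h4 : (u.count x : ℝ) + 1 ≠ 0 := by positivity
      push_cast
      field_simp
    · exact hasDerivAt_const _ _
  · rw [if_neg hx]
    have h : ∀ s, flowWeight k s (u ++ [x]) = flowWeight k 0 (u ++ [x]) := by
      intro s
      simp only [flowWeight]
      split_ifs with h
      · rw [List.count_eq_zero_of_not_mem, pow_zero, pow_zero]
        intro hk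
        have hxk : x < k := lt_of_le_of_ne (h.2 x (by simp)) hx
        rcases List.mem_append.1 hk with hk | hk
        · exact absurd ((List.pairwise_append.1 h.1).2.2 k hk x (by simp)) (not_le.2 hxk)
        · exact hx (List.mem_singleton.1 hk).symm
      · rfl
    simp only [h]
    exact hasDerivAt_const _ _

end Weight

section Flow

open scoped Bundle

variable {m : ℕ} {M : Type*} [MetricSpace M] [ChartedSpace (EuclideanSpace ℝ (Fin m)) M]
  {D : ℕ} {E : Fin D → (x : M) → TangentSpace (𝓡 m) x} {o : M}

/-- A truncated composition of exponentials of frozen vector fields: the sum over the words with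
less than `n` letters `(k, d)`, where `c` is the weight of the word of the labels `k`. -/
def wordExpansion (E : Fin D → (x : M) → TangentSpace (𝓡 m) x) {K : ℕ} (g : Fin K → Fin D → ℝ)
    (c : List (Fin K) → ℝ) (n : ℕ) (ψ : M → ℝ) (p : M) : ℝ :=
  ∑ j ∈ Finset.range n, wordSum j fun w : List (Fin K × Fin D) =>
    c (w.map Prod.fst) * (w.map fun x => g x.1 x.2).prod * iterDeriv E (w.map Prod.snd) ψ p

theorem wordExpansion_startWeight_zero {K : ℕ} (g : Fin K → Fin D → ℝ) (n : ℕ) (ψ : M → ℝ)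
    (p : M) : wordExpansion E g (startWeight 0) (n + 1) ψ p = ψ p := by
  rw [wordExpansion, Finset.sum_range_succ', Finset.sum_eq_zero, zero_add]
  · simp [wordSum, startWeight_zero, iterDeriv]
  · intro j _
    rw [wordSum]
    refine Finset.sum_eq_zero fun x _ => ?_
    simp only [List.map_cons, startWeight_zero]
    simpa using wordSum_zero j

/-- The weights of words satisfy the same differential equation as the flow: differentiating removes
the last letter, which is the derivation that acts first on `ψ`. -/
theorem hasDerivAt_wordExpansion {K : ℕ} (g : Fin K → Fin D → ℝ) (k : Fin K) (n : ℕ) (ψ : M → ℝ)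
    (p : M) (s : ℝ) :
    HasDerivAt (fun s => wordExpansion E g (flowWeight k s) (n + 1) ψ p)
      (∑ d, g k d * wordExpansion E g (flowWeight k s) n (lieDeriv (E d) ψ) p) s := by
  simp only [wordExpansion, Finset.sum_range_succ' _ n]
  have h0 : HasDerivAt (fun s => wordSum 0 fun w : List (Fin K × Fin D) =>
      flowWeight k s (w.map Prod.fst) * (w.map fun x => g x.1 x.2).prod *
        iterDeriv E (w.map Prod.snd) ψ p) 0 s := by
    simp only [wordSum, List.map_nil, flowWeight_nil]
    exact hasDerivAt_const _ _
  have h1 : ∀ j, HasDerivAt (fun s => wordSum (j + 1) fun w : List (Fin K × Fin D) =>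
      flowWeight k s (w.map Prod.fst) * (w.map fun x => g x.1 x.2).prod *
        iterDeriv E (w.map Prod.snd) ψ p)
      (∑ d, g k d * wordSum j fun w : List (Fin K × Fin D) =>
      flowWeight k s (w.map Prod.fst) * (w.map fun x => g x.1 x.2).prod *
        iterDeriv E (w.map Prod.snd) (lieDeriv (E d) ψ) p) s := by
    intro j
    simp only [wordSum_concat, Fintype.sum_prod_type]
    have h2 : ∀ (k' : Fin K) (d : Fin D), HasDerivAt (fun s => wordSum j
        fun w : List (Fin K × Fin D) => flowWeight k s ((w ++ [(k', d)]).map Prod.fst) *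
          ((w ++ [(k', d)]).map fun x => g x.1 x.2).prod *
            iterDeriv E ((w ++ [(k', d)]).map Prod.snd) ψ p)
        (if k' = k then g k d * wordSum j fun w : List (Fin K × Fin D) =>
          flowWeight k s (w.map Prod.fst) * (w.map fun x => g x.1 x.2).prod *
            iterDeriv E (w.map Prod.snd) (lieDeriv (E d) ψ) p else 0) s := by
      intro k' d
      have h3 := hasDerivAt_wordSum j (s := s)
        (F := fun s w => flowWeight k s ((w ++ [(k', d)]).map Prod.fst) *
          ((w ++ [(k', d)]).map fun x => g x.1 x.2).prod *
            iterDeriv E ((w ++ [(k', d)]).map Prod.snd) ψ p)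
        (F' := fun w => (if k' = k then flowWeight k s (w.map Prod.fst) else 0) *
          ((w ++ [(k', d)]).map fun x => g x.1 x.2).prod *
            iterDeriv E ((w ++ [(k', d)]).map Prod.snd) ψ p)
        (fun w => by
          have := hasDerivAt_flowWeight k k' (w.map Prod.fst) s
          rw [List.map_append]
          exact (this.mul_const _).mul_const _)
      refine h3.congr_deriv ?_
      by_cases hk : k' = k
      · subst hk
        simp only [if_true]
        rw [← wordSum_const_mul]
        congr 1
        funext w
        simp only [List.map_append, List.map_cons, List.map_nil, List.prod_append,
          List.prod_singleton, iterDeriv_append]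
        simp only [iterDeriv, List.foldr_cons, List.foldr_nil]
        ring
      · simp only [if_neg hk, zero_mul]
        exact wordSum_zero j
    refine (HasDerivAt.fun_sum fun k' _ => HasDerivAt.fun_sum fun d _ => h2 k' d).congr_deriv ?_
    rw [Finset.sum_eq_single k]
    · simp
    · intro k' _ hk'
      simp [hk']
    · simp
  refine ((HasDerivAt.fun_sum fun j _ => h1 j).add h0).congr_deriv ?_
  rw [add_zero, Finset.sum_comm]
  simp only [Finset.mul_sum]

theorem IsTestFunction.polyO {ι : Type*} {W ε : ι → ℝ} (hs : IsScale W ε) {φ : M → ℝ}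
    (hφ : IsTestFunction E o φ) {x : ι → M} (hx : PolyO W ε 0 (fun t => dist o (x t))) :
    PolyO W ε 0 (fun t => φ (x t)) := by
  obtain ⟨C, κ, h⟩ := hφ.2 []
  refine (((PolyO.const 1).add hs (hx.pow κ)).const_mul C).of_le fun t => ?_
  exact (h (x t)).trans (le_abs_self _)

theorem IsTestFunction.iterDeriv [IsManifold (𝓡 m) ∞ M] (hE : IsFrame E) {φ : M → ℝ}
    (hφ : IsTestFunction E o φ) (I : List (Fin D)) :
    IsTestFunction E o (iterDeriv E I φ) := by
  refine ⟨contMDiff_iterDeriv hE hφ.1 I, fun J => ?_⟩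
  rw [← iterDeriv_append]
  exact hφ.2 (J ++ I)

variable [IsManifold (𝓡 m) ∞ M] [Bundle.RiemannianBundle (fun x : M => TangentSpace (𝓡 m) x)]
  [IsRiemannianManifold (𝓡 m) M]

/-- The expansion of a test function along a composition of flows of frozen vector fields with
coefficients of order `ε`. Along the flow number `k`, the derivatives of `ψ` and of its expansion
with `n + 1` terms differ by `ε` times the corresponding differences for the functions `E_d[ψ]` and
expansions with `n` terms. -/
theorem polyO_flowsThrough (hE : IsFrame E) (hEb : ∃ C : ℝ, ∀ d x, ‖E d x‖ ≤ C)
    {ι : Type*} {W ε : ι → ℝ} (hs : IsScale W ε) {K : ℕ} {g : ι → Fin K → Fin D → ℝ}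
    (hg : ∀ k d, PolyO W ε 1 (fun t => g t k d)) {p q : ι → M}
    (hp : PolyO W ε 0 (fun t => dist o (p t))) (hf : ∀ t, FlowsThrough E (g t) (p t) (q t))
    (n : ℕ) {ψ : M → ℝ} (hψ : IsTestFunction E o ψ) :
    PolyO W ε n (fun t => ψ (q t) - wordExpansion E (g t) sortedWeight n ψ (p t)) := by
  choose y hy0 hyK hy using hf
  choose Γ hΓ hΓ0 hΓ1 using hy
  obtain ⟨C₀, hC₀⟩ := hEb
  have hC : ∀ d x, ‖E d x‖ ≤ max C₀ 0 := fun d x => (hC₀ d x).trans (le_max_left _ _)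
  have hC0 : 0 ≤ max C₀ 0 := le_max_right _ _
  have hdist : ∀ t k (s : Set.Icc (0 : ℝ) 1), dist (y t k.castSucc) (Γ t k s) ≤
      max C₀ 0 * ∑ d, |g t k d| := by
    intro t k s
    rw [← hΓ0 t k]
    exact dist_integralCurve_le hE hC0 hC (hΓ t k) s.2.1 s.2.2
  have hgabs : ∀ k, PolyO W ε 0 (fun t => max C₀ 0 * ∑ d, |g t k d|) := fun k =>
    (PolyO.sum hs _ fun d _ => ((hg k d).mono hs (Nat.zero_le 1)).of_le
      fun t => (abs_abs _).le).const_mul _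
  have hyd : ∀ j, PolyO W ε 0 (fun t => dist o (y t j)) := by
    intro j
    induction j using Fin.induction with
    | zero => simpa only [hy0] using hp
    | succ k ih =>
      refine (ih.add hs (hgabs k)).of_le fun t => ?_
      rw [abs_of_nonneg dist_nonneg]
      refine le_trans ?_ (le_abs_self _)
      have h1 := hdist t k ⟨1, zero_le_one, le_rfl⟩
      simp only [hΓ1] at h1
      exact (dist_triangle _ _ _).trans (add_le_add_right h1 _)
  -- The estimates have to be uniform in the time along each flow, which becomes part of the index.
  let W' : ι × Set.Icc (0 : ℝ) 1 → ℝ := fun r => W r.1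
  let ε' : ι × Set.Icc (0 : ℝ) 1 → ℝ := fun r => ε r.1
  have hs' : IsScale W' ε' := ⟨fun r => hs.one_le _, fun r => hs.nonneg _, fun r => hs.le_one _⟩
  have hΓd : ∀ k, PolyO W' ε' 0 (fun r => dist o (Γ r.1 k r.2)) := by
    intro k
    refine (((hyd k.castSucc).add hs (hgabs k)).comp Prod.fst).of_le fun r => ?_
    rw [abs_of_nonneg dist_nonneg]
    refine le_trans ?_ (le_abs_self _)
    exact (dist_triangle _ _ _).trans (add_le_add_right (hdist r.1 k r.2) _)
  have step : ∀ (n : ℕ) (ψ : M → ℝ), IsTestFunction E o ψ →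
      (∀ k, PolyO W' ε' (n + 1) (fun r => ∑ d, g r.1 k d * (lieDeriv (E d) ψ (Γ r.1 k r.2) -
        wordExpansion E (g r.1) (flowWeight k r.2) n (lieDeriv (E d) ψ) (p r.1)))) →
      (∀ k, PolyO W' ε' (n + 1) (fun r => ψ (Γ r.1 k r.2) -
        wordExpansion E (g r.1) (flowWeight k r.2) (n + 1) ψ (p r.1))) ∧
      ∀ j : Fin (K + 1), PolyO W ε (n + 1) (fun t => ψ (y t j) -
        wordExpansion E (g t) (startWeight j.val) (n + 1) ψ (p t)) := by
    intro n ψ hψ hder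
    have hk : ∀ k : Fin K, PolyO W ε (n + 1) (fun t => ψ (y t k.castSucc) -
        wordExpansion E (g t) (startWeight k.val) (n + 1) ψ (p t)) →
        PolyO W' ε' (n + 1) (fun r => ψ (Γ r.1 k r.2) -
          wordExpansion E (g r.1) (flowWeight k r.2) (n + 1) ψ (p r.1)) := by
      intro k h0
      obtain ⟨B, κ, hB, hB'⟩ := hder k
      have hinc : PolyO W' ε' (n + 1) (fun r => (ψ (Γ r.1 k r.2) -
          wordExpansion E (g r.1) (flowWeight k r.2) (n + 1) ψ (p r.1)) -
          (ψ (Γ r.1 k 0) - wordExpansion E (g r.1) (flowWeight k 0) (n + 1) ψ (p r.1))) := by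
        refine ⟨B, κ, hB, fun r => ?_⟩
        have hR : 0 ≤ B * W' r ^ κ * ε' r ^ (n + 1) := mul_nonneg (mul_nonneg hB
          (pow_nonneg (zero_le_one.trans (hs'.one_le r)) _)) (pow_nonneg (hs'.nonneg r) _)
        have hd : ∀ s ∈ Set.Icc (0 : ℝ) 1, HasDerivWithinAt (fun s => ψ (Γ r.1 k s) -
            wordExpansion E (g r.1) (flowWeight k s) (n + 1) ψ (p r.1))
            (∑ d, g r.1 k d * (lieDeriv (E d) ψ (Γ r.1 k s) -
              wordExpansion E (g r.1) (flowWeight k s) n (lieDeriv (E d) ψ) (p r.1)))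
            (Set.Icc 0 1) s := by
          intro s _
          refine (((hasDerivAt_comp_integralCurve (hΓ r.1 k) hψ.1 s).sub
            (hasDerivAt_wordExpansion (g r.1) k n ψ (p r.1) s)).congr_deriv
              ?_).hasDerivWithinAt
          simp only [mul_sub, Finset.sum_sub_distrib]
        -- The mean value inequality on the time interval of the flow number `k`.
        have := (convex_Icc (0 : ℝ) 1).norm_image_sub_le_of_norm_hasDerivWithin_le
          (C := B * W' r ^ κ * ε' r ^ (n + 1)) hd
          (fun s hs1 => hB' (r.1, ⟨s, hs1⟩)) (Set.left_mem_Icc.2 zero_le_one) r.2.2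
        refine this.trans ?_
        rw [sub_zero, Real.norm_eq_abs, abs_of_nonneg r.2.2.1]
        exact mul_le_of_le_one_right hR r.2.2.2
      refine (hinc.add hs' (h0.comp Prod.fst)).of_le fun r => le_of_eq (congrArg abs ?_)
      have h1 : wordExpansion E (g r.1) (flowWeight k 0) (n + 1) ψ (p r.1) =
          wordExpansion E (g r.1) (startWeight k.val) (n + 1) ψ (p r.1) := by
        rw [show flowWeight k 0 = startWeight k.val from funext (flowWeight_zero k)]
      rw [h1, hΓ0]
      ring
    have hj : ∀ j : Fin (K + 1), PolyO W ε (n + 1) (fun t => ψ (y t j) -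
        wordExpansion E (g t) (startWeight j.val) (n + 1) ψ (p t)) := by
      intro j
      induction j using Fin.induction with
      | zero =>
        refine PolyO.zero.of_le fun t => le_of_eq (congrArg abs ?_)
        rw [Fin.val_zero, wordExpansion_startWeight_zero, hy0, sub_self]
      | succ k ih =>
        refine ((hk k ih).comp fun t => (t, ⟨1, zero_le_one, le_rfl⟩)).of_le
          fun t => le_of_eq (congrArg abs ?_)
        rw [hΓ1, show flowWeight k 1 = startWeight (k.val + 1) from funext (flowWeight_one k)]
        rfl
    exact ⟨fun k => hk k (hj _), hj⟩
  have main : ∀ (n : ℕ) (ψ : M → ℝ), IsTestFunction E o ψ →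
      ∀ k, PolyO W' ε' n (fun r => ψ (Γ r.1 k r.2) -
        wordExpansion E (g r.1) (flowWeight k r.2) n ψ (p r.1)) := by
    intro n
    induction n with
    | zero =>
      intro ψ hψ k
      simp only [wordExpansion, Finset.range_zero, Finset.sum_empty, sub_zero]
      exact hψ.polyO hs' (hΓd k)
    | succ n ih =>
      intro ψ hψ
      refine (step n ψ hψ fun k => PolyO.sum hs' _ fun d _ => ?_).1
      rw [add_comm]
      exact ((hg k d).comp Prod.fst).mul (ih _ (hψ.iterDeriv hE [d]) k)
  cases n with
  | zero =>
    simp only [wordExpansion, Finset.range_zero, Finset.sum_empty, sub_zero]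
    refine hψ.polyO hs ?_
    simpa only [hyK] using hyd (Fin.last K)
  | succ n =>
    have h := (step n ψ hψ fun k => PolyO.sum hs' _ fun d _ => by
      rw [add_comm]
      exact ((hg k d).comp Prod.fst).mul (main n _ (hψ.iterDeriv hE [d]) k)).2 (Fin.last K)
    simpa only [hyK, Fin.val_last, show startWeight K = sortedWeight from
      funext (startWeight_last (K := K))] using h

end Flow

/-! ### Expansion in planar forests -/

/-- Twice the order of a forest: the power of `√h` in front of its contribution. -/
def twiceOrder : Planar → ℕ
  | nil => 0
  | .black c r => 2 + twiceOrder c + twiceOrder r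
  | .white r => 1 + twiceOrder r

theorem size_le_twiceOrder (S : Planar) : S.size ≤ twiceOrder S := by
  induction S with
  | nil => exact le_rfl
  | black c r ihc ihr => simp only [size, twiceOrder]; omega
  | white r ih => simp only [size, twiceOrder]; omega

theorem twiceOrder_eq (S : Planar) :
    twiceOrder S = 2 * Fintype.card (Black S) + Fintype.card (White S) := by
  induction S with
  | nil => rfl
  | black c r ihc ihr =>
    have h1 : Fintype.card (Black (.black c r)) =
        Fintype.card (Option (Black c ⊕ Black r)) := rfl
    have h2 : Fintype.card (White (.black c r)) = Fintype.card (White c ⊕ White r) := rfl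
    rw [h1, h2, Fintype.card_option, Fintype.card_sum, Fintype.card_sum, twiceOrder, ihc, ihr]
    ring
  | white r ih =>
    have h1 : Fintype.card (Black (.white r)) = Fintype.card (Black r) := rfl
    have h2 : Fintype.card (White (.white r)) = Fintype.card (Unit ⊕ White r) := rfl
    rw [h1, h2, Fintype.card_sum, twiceOrder, ih, Fintype.card_unit]
    ring

theorem finite_twiceOrder_lt (n : ℕ) : {S : Planar | twiceOrder S < n}.Finite :=
  (finite_size_le n).subset fun S hS => (size_le_twiceOrder S).trans (le_of_lt hS)

/-- The planar forests of order less than `n / 2`. -/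
def forestsBelow (n : ℕ) : Finset Planar := (finite_twiceOrder_lt n).toFinset

theorem mem_forestsBelow {n : ℕ} {S : Planar} : S ∈ forestsBelow n ↔ twiceOrder S < n := by
  simp [forestsBelow]

open Classical in
/-- The forests with less than `m` roots such that the children of each root form a forest in
`G`. -/
def forestsOver (G : Finset Planar) : ℕ → Finset Planar
  | 0 => ∅
  | m + 1 => insert nil
      (((G ×ˢ forestsOver G m).image fun q => Planar.black q.1 q.2) ∪
        (forestsOver G m).image Planar.white)

/-- A forest of order at most `n / 2` has at most `n` roots, and the children of its roots form
forests of smaller order. -/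
theorem forestsBelow_subset_forestsOver (n : ℕ) :
    forestsBelow (n + 1) ⊆ forestsOver (forestsBelow n) (n + 1) := by
  have h : ∀ (m : ℕ) (S : Planar), twiceOrder S < m → twiceOrder S < n + 1 →
      S ∈ forestsOver (forestsBelow n) m := by
    intro m
    induction m with
    | zero => exact fun S h => absurd h (Nat.not_lt_zero _)
    | succ m ih =>
      intro S h1 h2
      simp only [forestsOver, Finset.mem_insert, Finset.mem_union, Finset.mem_image,
        Finset.mem_product, Prod.exists]
      cases S with
      | nil => exact Or.inl rfl
      | black c r =>
        simp only [twiceOrder] at h1 h2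
        exact Or.inr (Or.inl ⟨c, r, ⟨mem_forestsBelow.2 (by omega), ih r (by omega) (by omega)⟩,
          rfl⟩)
      | white r =>
        simp only [twiceOrder] at h1 h2
        exact Or.inr (Or.inr ⟨r, ih r (by omega) (by omega), rfl⟩)
  intro S hS
  rw [mem_forestsBelow] at hS
  exact h _ S hS hS

theorem sum_forestsOver_succ (G : Finset Planar) (m : ℕ) (F : Planar → ℝ) :
    ∑ S ∈ forestsOver G (m + 1), F S = F nil +
      (∑ c ∈ G, ∑ r ∈ forestsOver G m, F (.black c r) + ∑ r ∈ forestsOver G m, F (.white r)) := by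
  classical
  rw [forestsOver, Finset.sum_insert, Finset.sum_union, Finset.sum_image, Finset.sum_image,
    Finset.sum_product]
  · intro a _ b _ h
    exact Planar.white.inj h
  · intro a _ b _ h
    exact Prod.ext (Planar.black.inj h).1 (Planar.black.inj h).2
  · rw [Finset.disjoint_left]
    intro S h1 h2
    obtain ⟨q, -, rfl⟩ := Finset.mem_image.1 h1
    obtain ⟨r, -, h⟩ := Finset.mem_image.1 h2
    exact Planar.noConfusion h
  · intro h
    rcases Finset.mem_union.1 h with h | h
    · obtain ⟨q, -, h⟩ := Finset.mem_image.1 h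
      exact Planar.noConfusion h
    · obtain ⟨q, -, h⟩ := Finset.mem_image.1 h
      exact Planar.noConfusion h

section Substitution

variable {s : ℕ} {κ : Type*} [Fintype κ]

/-- The coefficient of one exponential, in which the values at the stages are expanded in the
forests in `G`. -/
def Weights.letter (T : Weights s κ Unit) (G : Finset Planar) (e : ℝ) (o : Option (Fin s))
    (x : κ) : ℝ :=
  e ^ 2 * ∑ i, T.black o i x *
    ∑ c ∈ G, e ^ twiceOrder c * T.gen (some i) c (fun _ => ()) (T.family x) + e * T.white o x ()

theorem sum_wordSum_succ (m : ℕ) (F : List κ → ℝ) :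
    ∑ j ∈ Finset.range (m + 1), wordSum j F =
      F [] + ∑ x, ∑ j ∈ Finset.range m, wordSum j fun w => F (x :: w) := by
  rw [Finset.sum_range_succ', Finset.sum_comm, add_comm]
  rfl

/-- Substituting expansions in forests into a sum over words yields an expansion in forests: a
letter of the word becomes a white root, or a black root whose children form a forest in `G`. -/
theorem Weights.sum_wordSum_letter (T : Weights s κ Unit) (G : Finset Planar) (e : ℝ)
    (o : Option (Fin s)) (m : ℕ) (b : List κ → ℝ) :
    ∑ j ∈ Finset.range m, wordSum j (fun w => (w.map (T.letter G e o)).prod * b w) =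
      ∑ S ∈ forestsOver G m, e ^ twiceOrder S * T.gen o S (fun _ => ()) b := by
  induction m generalizing b with
  | zero => simp [forestsOver]
  | succ m ih =>
    rw [sum_wordSum_succ, sum_forestsOver_succ]
    have h1 : ∀ x, ∑ j ∈ Finset.range m,
        wordSum j (fun w => ((x :: w).map (T.letter G e o)).prod * b (x :: w)) =
        T.letter G e o x * ∑ S ∈ forestsOver G m,
          e ^ twiceOrder S * T.gen o S (fun _ => ()) fun w => b (x :: w) := by
      intro x
      rw [← ih, Finset.mul_sum]
      refine Finset.sum_congr rfl fun j _ => ?_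
      rw [← wordSum_const_mul]
      simp only [List.map_cons, List.prod_cons, mul_assoc]
    simp only [h1, letter, add_mul, Finset.sum_add_distrib]
    have h2 : ∀ x, ∑ i, T.black o i x * ∑ c ∈ G, e ^ twiceOrder c *
        T.gen (some i) c (fun _ => ()) (T.family x) =
        ∑ c ∈ G, e ^ twiceOrder c *
          ∑ i, T.black o i x * T.gen (some i) c (fun _ => ()) (T.family x) := by
      intro x
      simp only [Finset.mul_sum]
      rw [Finset.sum_comm]
      refine Finset.sum_congr rfl fun c _ => Finset.sum_congr rfl fun i _ => ?_
      ring
    have h3 : ∑ x, (e ^ 2 * ∑ i, T.black o i x * ∑ c ∈ G, e ^ twiceOrder c *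
        T.gen (some i) c (fun _ => ()) (T.family x)) * ∑ S ∈ forestsOver G m,
          e ^ twiceOrder S * T.gen o S (fun _ => ()) (fun w => b (x :: w)) =
        ∑ c ∈ G, ∑ r ∈ forestsOver G m, e ^ twiceOrder (.black c r) *
          T.gen o (.black c r) (fun _ => ()) b := by
      have h4 : ∀ x, (e ^ 2 * ∑ i, T.black o i x * ∑ c ∈ G, e ^ twiceOrder c *
          T.gen (some i) c (fun _ => ()) (T.family x)) * ∑ S ∈ forestsOver G m,
            e ^ twiceOrder S * T.gen o S (fun _ => ()) (fun w => b (x :: w)) =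
          ∑ c ∈ G, ∑ r ∈ forestsOver G m, e ^ twiceOrder (.black c r) *
            ((∑ i, T.black o i x * T.gen (some i) c (fun _ => ()) (T.family x)) *
              T.gen o r (fun _ => ()) (fun w => b (x :: w))) := by
        intro x
        rw [h2, mul_assoc, Finset.sum_mul_sum, Finset.mul_sum]
        refine Finset.sum_congr rfl fun c _ => ?_
        rw [Finset.mul_sum]
        refine Finset.sum_congr rfl fun r _ => ?_
        rw [twiceOrder]
        ring
      simp only [h4]
      rw [Finset.sum_comm]
      refine Finset.sum_congr rfl fun c _ => ?_
      rw [Finset.sum_comm]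
      refine Finset.sum_congr rfl fun r _ => ?_
      rw [gen, Finset.mul_sum]
    have h5 : ∑ x, e * T.white o x () * ∑ S ∈ forestsOver G m,
          e ^ twiceOrder S * T.gen o S (fun _ => ()) (fun w => b (x :: w)) =
        ∑ r ∈ forestsOver G m, e ^ twiceOrder (.white r) *
          T.gen o (.white r) (fun _ => ()) b := by
      simp only [gen, twiceOrder, Finset.mul_sum]
      rw [Finset.sum_comm]
      refine Finset.sum_congr rfl fun r _ => Finset.sum_congr rfl fun x _ => ?_
      ring
    rw [h3, h5]
    simp [twiceOrder, gen]

theorem PolyO.gen {ι : Type*} {W ε : ι → ℝ} (hs : IsScale W ε) {T : ι → Weights s κ Unit}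
    (hb : ∀ o i x, PolyO W ε 0 fun t => (T t).black o i x)
    (hw : ∀ o x, PolyO W ε 0 fun t => (T t).white o x ())
    (hf : ∀ x w, PolyO W ε 0 fun t => (T t).family x w) (o : Option (Fin s)) (S : Planar)
    {b : ι → List κ → ℝ} (h : ∀ w, PolyO W ε 0 fun t => b t w) :
    PolyO W ε 0 (fun t => (T t).gen o S (fun _ => ()) (b t)) := by
  induction S generalizing o b with
  | nil => exact h []
  | black c r ihc ihr =>
    exact PolyO.sum hs _ fun x _ => (PolyO.sum hs _ fun i _ =>
      (hb o i x).mul (ihc (some i) (hf x))).mul (ihr o fun w => h (x :: w))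
  | white r ihr =>
    exact PolyO.sum hs _ fun x _ => (hw o x).mul (ihr o fun w => h (x :: w))

end Substitution

theorem PolyO.wordSum_prod_sub {ι κ : Type*} [Fintype κ] {W ε : ι → ℝ} (hs : IsScale W ε)
    {n : ℕ} {a b : κ → ι → ℝ} (ha : ∀ x, PolyO W ε 1 (a x)) (hb : ∀ x, PolyO W ε 1 (b x))
    (hab : ∀ x, PolyO W ε n (fun t => a x t - b x t)) {c : List κ → ι → ℝ}
    (hc : ∀ w, PolyO W ε 0 (c w)) (m : ℕ) :
    PolyO W ε n (fun t => ∑ j ∈ Finset.range m, FrozenFlow.wordSum j fun w : List κ =>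
      ((w.map fun x => a x t).prod - (w.map fun x => b x t).prod) * c w t) :=
  PolyO.sum hs _ fun j _ => PolyO.wordSum hs j fun w _ =>
    (PolyO.list_prod_sub hs ha hb hab w).mul (hc w)

section Method

open scoped Bundle

variable {m : ℕ} {M : Type*} [MetricSpace M] [ChartedSpace (EuclideanSpace ℝ (Fin m)) M]
  {D s K L : ℕ}

/-- The value of a word of pairs of a label and a direction at a function. -/
def wordValue (E : Fin D → (x : M) → TangentSpace (𝓡 m) x) (ψ : M → ℝ) (p : M)
    (w : List (Fin K × Fin D)) : ℝ :=
  sortedWeight (w.map Prod.fst) * iterDeriv E (w.map Prod.snd) ψ p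

/-- The weights whose sums over decorations are the terms of the expansion of a step in powers of
`√h`, for the value `x` of the noise. -/
def forestWeights (A : Tableau s K L) (E : Fin D → (x : M) → TangentSpace (𝓡 m) x)
    (f : Fin D → M → ℝ) (x : Fin D → Fin L → ℝ) (p : M) : Weights s (Fin K × Fin D) Unit where
  black o i c := A.weights.black o i c.1
  white o c _ := ∑ l, A.weights.white o c.1 l * x c.2 l
  family c := wordValue E (f c.2) p

variable {E : Fin D → (x : M) → TangentSpace (𝓡 m) x} {o : M} [IsManifold (𝓡 m) ∞ M]
  [Bundle.RiemannianBundle (fun x : M => TangentSpace (𝓡 m) x)] [IsRiemannianManifold (𝓡 m) M]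

/-- The expansion of a step of the method in planar forests, in powers of `ε = √h`. The stages and
the update are treated alike; the induction closes because the values at the stages carry a factor
`ε ^ 2`, so that an expansion of them with remainder `ε ^ n` suffices for the remainder
`ε ^ (n + 1)`. -/
theorem polyO_step (hE : IsFrame E) (hEb : ∃ C : ℝ, ∀ d x, ‖E d x‖ ≤ C) {f : Fin D → M → ℝ}
    (hf : ∀ d, IsTestFunction E o (f d)) (A : Tableau s K L)
    {ι : Type*} {W ε : ι → ℝ} (hs : IsScale W ε) {x : ι → Fin D → Fin L → ℝ}
    (hx : ∀ d l, PolyO W ε 0 (fun t => x t d l)) {p q : ι → M} {H : ι → Fin s → M}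
    (hp : PolyO W ε 0 (fun t => dist o (p t))) (hH : ∀ j, PolyO W ε 0 (fun t => dist o (H t j)))
    (hstep : ∀ t, IsStep A E f (ε t ^ 2) (x t) (p t) (H t) (q t)) (n : ℕ) {ψ : M → ℝ}
    (hψ : IsTestFunction E o ψ) :
    PolyO W ε n (fun t => ψ (q t) - ∑ S ∈ forestsBelow n, ε t ^ twiceOrder S *
      (forestWeights A E f (x t) (p t)).gen none S (fun _ => ()) (wordValue E ψ (p t))) := by
  classical
  -- `none` stands for the update, `some i` for the stage number `i`.
  let Q : Option (Fin s) → ι → M := fun o t => o.elim (q t) (H t)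
  let T : ι → Weights s (Fin K × Fin D) Unit := fun t => forestWeights A E f (x t) (p t)
  let g : Option (Fin s) → ι → Fin K → Fin D → ℝ := fun o t k d =>
    ε t ^ 2 * ∑ j, A.weights.black o j k * f d (H t j) +
      ε t * ∑ l, A.weights.white o k l * x t d l
  have hflow : ∀ o t, FlowsThrough E (g o t) (p t) (Q o t) := by
    intro o t
    have hsq : √(ε t ^ 2) = ε t := Real.sqrt_sq (hs.nonneg t)
    cases o with
    | none =>
      have := (hstep t).update
      rw [hsq] at this
      exact this
    | some i =>
      have := (hstep t).stage i
      rw [hsq] at this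
      exact this
  have hε1 : PolyO W ε 1 ε := by simpa using PolyO.step_pow hs 1
  have hTw : ∀ o c, PolyO W ε 0 fun t => (T t).white o c () := fun o c =>
    PolyO.sum hs Finset.univ fun l _ => (hx c.2 l).const_mul (A.weights.white o c.1 l)
  have hg : ∀ o k d, PolyO W ε 1 (fun t => g o t k d) := by
    intro o k d
    refine PolyO.add hs ?_ (hε1.mul (hTw o (k, d)))
    refine PolyO.mono hs ((PolyO.step_pow hs 2).mul (PolyO.sum hs _ fun j _ =>
      (((hf d).polyO hs (hH j)).const_mul _))) (by omega)
  have hwv : ∀ {ψ : M → ℝ}, IsTestFunction E o ψ → ∀ w : List (Fin K × Fin D),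
      PolyO W ε 0 fun t => wordValue E ψ (p t) w := fun hψ w =>
    ((hψ.iterDeriv hE _).polyO hs hp).const_mul _
  have hgen : ∀ {ψ : M → ℝ}, IsTestFunction E o ψ → ∀ o S, PolyO W ε 0 fun t =>
      (T t).gen o S (fun _ => ()) (wordValue E ψ (p t)) := fun hψ o S =>
    PolyO.gen (T := T) hs (fun o i c => PolyO.const (A.weights.black o i c.1)) hTw
      (fun c w => hwv (hf c.2) w) o S (hwv hψ)
  suffices main : ∀ (n : ℕ) (ψ : M → ℝ), IsTestFunction E o ψ → ∀ o', PolyO W ε n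
      (fun t => ψ (Q o' t) - ∑ S ∈ forestsBelow n, ε t ^ twiceOrder S *
        (T t).gen o' S (fun _ => ()) (wordValue E ψ (p t))) from main n ψ hψ none
  intro n
  induction n with
  | zero =>
    intro ψ hψ o'
    have h := polyO_flowsThrough hE hEb hs (hg o') hp (hflow o') 0 hψ
    have h0 : forestsBelow 0 = ∅ := by
      ext S
      simp [mem_forestsBelow]
    simpa [wordExpansion, h0] using h
  | succ n ih =>
    intro ψ hψ o'
    -- The coefficients of the frozen fields, with the values at the stages replaced by their
    -- expansions.
    let g' : ι → Fin K × Fin D → ℝ := fun t => (T t).letter (forestsBelow n) (ε t) o'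
    have hdiff : ∀ c, PolyO W ε (n + 1) (fun t => g o' t c.1 c.2 - g' t c) := by
      intro c
      have h := (PolyO.step_pow hs 2).mul (PolyO.sum hs Finset.univ fun j _ =>
        (ih (f c.2) (hf c.2) (some j)).const_mul (A.weights.black o' j c.1))
      refine (h.mono hs (by omega)).of_le fun t => le_of_eq (congrArg abs ?_)
      simp only [g, g', Weights.letter, mul_sub, Finset.sum_sub_distrib]
      change _ = ε t ^ 2 * ∑ j, A.weights.black o' j c.1 * f c.2 (H t j) -
        ε t ^ 2 * ∑ j, A.weights.black o' j c.1 * ∑ S ∈ forestsBelow n, ε t ^ twiceOrder S *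
          (T t).gen (some j) S (fun _ => ()) (wordValue E (f c.2) (p t))
      change ε t ^ 2 * ∑ j, A.weights.black o' j c.1 * f c.2 (H t j) +
          ε t * ∑ l, A.weights.white o' c.1 l * x t c.2 l -
        (ε t ^ 2 * ∑ j, A.weights.black o' j c.1 * ∑ S ∈ forestsBelow n, ε t ^ twiceOrder S *
          (T t).gen (some j) S (fun _ => ()) (wordValue E (f c.2) (p t)) +
          ε t * ∑ l, A.weights.white o' c.1 l * x t c.2 l) = _
      ring
    have hg' : ∀ c, PolyO W ε 1 (fun t => g' t c) := fun c =>
      ((hg o' c.1 c.2).sub hs ((hdiff c).mono hs (Nat.le_add_left 1 n))).of_le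
        fun t => le_of_eq (congrArg abs (sub_sub_cancel (g o' t c.1 c.2) (g' t c)).symm)
    have h1 := polyO_flowsThrough hE hEb hs (hg o') hp (hflow o') (n + 1) hψ
    have h2 := PolyO.wordSum_prod_sub hs (a := fun (c : Fin K × Fin D) t => g o' t c.1 c.2)
      (b := fun c t => g' t c) (c := fun w t => wordValue E ψ (p t) w)
      (fun c => hg o' c.1 c.2) hg' hdiff (hwv hψ) (n + 1)
    -- The substitution also yields forests of higher order, which belong to the remainder.
    have h3 : PolyO W ε (n + 1) (fun t =>
        ∑ S ∈ forestsOver (forestsBelow n) (n + 1) \ forestsBelow (n + 1), ε t ^ twiceOrder S *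
          (T t).gen o' S (fun _ => ()) (wordValue E ψ (p t))) := by
      refine PolyO.sum hs _ fun S hS => ?_
      have hS' : n + 1 ≤ twiceOrder S := by
        rw [Finset.mem_sdiff, mem_forestsBelow, not_lt] at hS
        exact hS.2
      exact ((PolyO.step_pow hs _).mul (hgen hψ o' S)).mono hs hS'
    refine ((h1.add hs h2).add hs h3).of_le fun t => le_of_eq (congrArg abs ?_)
    have e1 := Finset.sum_sdiff (forestsBelow_subset_forestsOver n) (f := fun S =>
      ε t ^ twiceOrder S * (T t).gen o' S (fun _ => ()) (wordValue E ψ (p t)))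
    have e2 := (T t).sum_wordSum_letter (forestsBelow n) (ε t) o' (n + 1) (wordValue E ψ (p t))
    have e3 : wordExpansion E (g o' t) sortedWeight (n + 1) ψ (p t) =
        ∑ j ∈ Finset.range (n + 1), wordSum j fun w : List (Fin K × Fin D) =>
          (w.map fun c => g o' t c.1 c.2).prod * wordValue E ψ (p t) w := by
      refine Finset.sum_congr rfl fun j _ => congrArg _ (funext fun w => ?_)
      rw [wordValue]
      ring
    rw [e3]
    simp only [sub_mul, wordSum_sub, Finset.sum_sub_distrib]
    have e4 : ∑ j ∈ Finset.range (n + 1), wordSum j (fun w : List (Fin K × Fin D) =>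
          (w.map fun c => g' t c).prod * wordValue E ψ (p t) w) =
        ∑ S ∈ forestsOver (forestsBelow n) (n + 1), ε t ^ twiceOrder S *
          (T t).gen o' S (fun _ => ()) (wordValue E ψ (p t)) := e2
    rw [e4, ← e1]
    ring

end Method

/-! ### A priori bounds and the expansion of a single step -/

theorem dist_le_sum_dist {M : Type*} [PseudoMetricSpace M] {K : ℕ} (y : Fin (K + 1) → M) :
    dist (y 0) (y (Fin.last K)) ≤ ∑ k : Fin K, dist (y k.castSucc) (y k.succ) := by
  induction K with
  | zero => simp
  | succ K ih =>
    rw [Fin.sum_univ_castSucc]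
    refine (dist_triangle _ (y (Fin.last K).castSucc) _).trans (add_le_add ?_ ?_)
    · exact ih fun k => y k.castSucc
    · rw [Fin.succ_last]

section Step

open scoped Bundle

variable {m : ℕ} {M : Type*} [MetricSpace M] [ChartedSpace (EuclideanSpace ℝ (Fin m)) M]
  {D s K L : ℕ} {E : Fin D → (x : M) → TangentSpace (𝓡 m) x} [IsManifold (𝓡 m) ∞ M]
  [Bundle.RiemannianBundle (fun x : M => TangentSpace (𝓡 m) x)] [IsRiemannianManifold (𝓡 m) M]

theorem dist_flowsThrough_le (hE : IsFrame E) {C : ℝ} (hC : 0 ≤ C) (hEb : ∀ d x, ‖E d x‖ ≤ C)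
    {g : Fin K → Fin D → ℝ} {p q : M} (h : FlowsThrough E g p q) :
    dist p q ≤ C * ∑ k, ∑ d, |g k d| := by
  obtain ⟨y, rfl, rfl, hy⟩ := h
  refine (dist_le_sum_dist y).trans ?_
  rw [Finset.mul_sum]
  refine Finset.sum_le_sum fun k _ => ?_
  obtain ⟨γ, hγ, h0, h1⟩ := hy k
  rw [← h0, ← h1]
  exact dist_integralCurve_le hE hC hEb hγ zero_le_one le_rfl

theorem exists_lipschitz_bound {f : Fin D → M → ℝ} (hfL : ∀ d, ∃ C : NNReal, LipschitzWith C (f d))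
    (o : M) : ∃ Λ : ℝ, 0 ≤ Λ ∧ ∀ d p y, |f d y| ≤ Λ * (1 + dist o p + dist p y) := by
  choose c hc using hfL
  refine ⟨∑ d, ((c d : ℝ) + |f d o|), Finset.sum_nonneg fun d _ => by positivity,
    fun d p y => ?_⟩
  have h1 : (c d : ℝ) + |f d o| ≤ ∑ d, ((c d : ℝ) + |f d o|) :=
    Finset.single_le_sum (f := fun d => (c d : ℝ) + |f d o|) (fun d _ => by positivity)
      (Finset.mem_univ d)
  have h2 : |f d y - f d o| ≤ c d * dist y o := (hc d).dist_le_mul y o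
  have h3 : dist y o ≤ dist o p + dist p y := by
    rw [dist_comm]
    exact dist_triangle _ _ _
  have h4 : |f d y| ≤ |f d y - f d o| + |f d o| := by
    simpa using abs_add_le (f d y - f d o) (f d o)
  have h5 : (c d : ℝ) * dist y o ≤ c d * (dist o p + dist p y) :=
    mul_le_mul_of_nonneg_left h3 (c d).2
  have h6 := mul_nonneg (abs_nonneg (f d o)) (add_nonneg (dist_nonneg (x := o) (y := p))
    (dist_nonneg (x := p) (y := y)))
  have h7 : (0 : ℝ) ≤ c d := (c d).2
  calc |f d y| ≤ (c d + |f d o|) * (1 + dist o p + dist p y) := by linarith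
    _ ≤ _ := by gcongr

/-- For small stepsizes, the stages stay at a distance from the initial point that is linear in the
size of the data. For an implicit method, this follows from the Lipschitz continuity of the
coefficients: the sum of these distances is bounded by half of itself and by the data. -/
theorem exists_dist_stage_le (hE : IsFrame E) (hEb : ∃ C : ℝ, ∀ d x, ‖E d x‖ ≤ C)
    {f : Fin D → M → ℝ} (hfL : ∀ d, ∃ C : NNReal, LipschitzWith C (f d)) (A : Tableau s K L)
    (o : M) : ∃ h₀ : ℝ, 0 < h₀ ∧ h₀ ≤ 1 ∧ ∃ B : ℝ, 0 ≤ B ∧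
      ∀ (h : ℝ) (x : Fin D → Fin L → ℝ) (p : M) (H : Fin s → M) (q : M), 0 < h → h ≤ h₀ →
        IsStep A E f h x p H q → ∀ j, dist p (H j) ≤ B * ((1 + dist o p) * noiseWeight x) := by
  obtain ⟨C, hC⟩ := hEb
  obtain ⟨Λ, hΛ, hf⟩ := exists_lipschitz_bound hfL o
  have hC' : ∀ d x, ‖E d x‖ ≤ |C| := fun d x => (hC d x).trans (le_abs_self C)
  let ζ : ℝ := ∑ i, ∑ k, (∑ j, |A.Z0 i j k| + ∑ l, |A.Zhat i k l|)
  have hζ : 0 ≤ ζ := by positivity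
  have hin : ∀ i k, (∑ j, |A.Z0 i j k| + ∑ l, |A.Zhat i k l|) ≤ ζ := fun i k =>
    (Finset.single_le_sum (f := fun k => ∑ j, |A.Z0 i j k| + ∑ l, |A.Zhat i k l|)
      (fun k _ => by positivity) (Finset.mem_univ k)).trans
    (Finset.single_le_sum (f := fun i => ∑ k, (∑ j, |A.Z0 i j k| + ∑ l, |A.Zhat i k l|))
      (fun i _ => by positivity) (Finset.mem_univ i))
  have hZ0 : ∀ i j k, |A.Z0 i j k| ≤ ζ := fun i j k => by
    have h1 := Finset.single_le_sum (f := fun j => |A.Z0 i j k|) (fun j _ => abs_nonneg _)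
      (Finset.mem_univ j)
    have h2 : 0 ≤ ∑ l, |A.Zhat i k l| := by positivity
    linarith [hin i k]
  have hZhat : ∀ i k l, |A.Zhat i k l| ≤ ζ := fun i k l => by
    have h1 := Finset.single_le_sum (f := fun l => |A.Zhat i k l|) (fun l _ => abs_nonneg _)
      (Finset.mem_univ l)
    have h2 : 0 ≤ ∑ j, |A.Z0 i j k| := by positivity
    linarith [hin i k]
  let b : ℝ := s * (|C| * (K * D)) * ζ
  have hb : 0 ≤ b := by positivity
  have hpos : 0 < 2 * (b * Λ + 1) := by positivity
  -- With `h * b * Λ ≤ 1 / 2`, the sum `δ` of the distances can be absorbed.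
  refine ⟨min 1 (1 / (2 * (b * Λ + 1))), by positivity, min_le_left _ _, s + 2 * b,
    by positivity, ?_⟩
  intro h x p H q h0 hh hst
  have hh1 : h ≤ 1 := hh.trans (min_le_left _ _)
  have hhb : h * (b * Λ) ≤ 1 / 2 := by
    have h3 := (le_div_iff₀ hpos).1 (hh.trans (min_le_right _ _))
    nlinarith
  have hsq : √h ≤ 1 := Real.sqrt_le_one.2 hh1
  have hsq0 := Real.sqrt_nonneg h
  set r := dist o p with hr
  have hr0 : 0 ≤ r := dist_nonneg
  set δ := ∑ j, dist p (H j) with hδ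
  have hδ0 : 0 ≤ δ := Finset.sum_nonneg fun _ _ => dist_nonneg
  have hw := one_le_noiseWeight x
  have hg : ∀ i k d, |h * ∑ j, A.Z0 i j k * f d (H j) + √h * ∑ l, A.Zhat i k l * x d l| ≤
      ζ * (h * (Λ * (s * (1 + r) + δ)) + noiseWeight x) := by
    intro i k d
    have h1 : |∑ j, A.Z0 i j k * f d (H j)| ≤ ζ * (Λ * (s * (1 + r) + δ)) := by
      calc |∑ j, A.Z0 i j k * f d (H j)| ≤ ∑ j, ζ * (Λ * (1 + r + dist p (H j))) := by
            refine (Finset.abs_sum_le_sum_abs _ _).trans (Finset.sum_le_sum fun j _ => ?_)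
            rw [abs_mul]
            exact mul_le_mul (hZ0 i j k) (hf d p (H j)) (abs_nonneg _) hζ
        _ = ζ * (Λ * (s * (1 + r) + δ)) := by
            rw [← Finset.mul_sum, ← Finset.mul_sum, Finset.sum_add_distrib]
            simp only [Finset.sum_const, Finset.card_univ, Fintype.card_fin, nsmul_eq_mul, hδ]
    have h2 : |∑ l, A.Zhat i k l * x d l| ≤ ζ * noiseWeight x := by
      calc |∑ l, A.Zhat i k l * x d l| ≤ ∑ l, ζ * |x d l| := by
            refine (Finset.abs_sum_le_sum_abs _ _).trans (Finset.sum_le_sum fun l _ => ?_)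
            rw [abs_mul]
            exact mul_le_mul_of_nonneg_right (hZhat i k l) (abs_nonneg _)
        _ = ζ * ∑ l, |x d l| := (Finset.mul_sum _ _ _).symm
        _ ≤ ζ * noiseWeight x := by
            refine mul_le_mul_of_nonneg_left ?_ hζ
            have h3 := Finset.single_le_sum (f := fun d => ∑ l, |x d l|)
              (fun d _ => by positivity) (Finset.mem_univ d)
            rw [noiseWeight]
            linarith
    calc _ ≤ |h * ∑ j, A.Z0 i j k * f d (H j)| + |√h * ∑ l, A.Zhat i k l * x d l| :=
          abs_add_le _ _
      _ = h * |∑ j, A.Z0 i j k * f d (H j)| + √h * |∑ l, A.Zhat i k l * x d l| := by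
          rw [abs_mul, abs_mul, abs_of_pos h0, abs_of_nonneg hsq0]
      _ ≤ h * (ζ * (Λ * (s * (1 + r) + δ))) + 1 * (ζ * noiseWeight x) := by
          gcongr
      _ = _ := by ring
  have hd : ∀ i, dist p (H i) ≤
      |C| * (K * D) * (ζ * (h * (Λ * (s * (1 + r) + δ)) + noiseWeight x)) := by
    intro i
    refine (dist_flowsThrough_le hE (abs_nonneg C) hC' (hst.stage i)).trans ?_
    rw [mul_assoc]
    refine mul_le_mul_of_nonneg_left ?_ (abs_nonneg C)
    refine (Finset.sum_le_sum fun k _ => Finset.sum_le_sum fun d _ => hg i k d).trans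
      (le_of_eq ?_)
    simp only [Finset.sum_const, Finset.card_univ, Fintype.card_fin, nsmul_eq_mul]
    ring
  have hsum : δ ≤ h * (b * Λ) * (s * (1 + r) + δ) + b * noiseWeight x := by
    refine (Finset.sum_le_sum fun i _ => hd i).trans (le_of_eq ?_)
    simp only [Finset.sum_const, Finset.card_univ, Fintype.card_fin, nsmul_eq_mul, b]
    ring
  have hs1 : h * (b * Λ) * (s * (1 + r) + δ) ≤ 1 / 2 * (s * (1 + r) + δ) :=
    mul_le_mul_of_nonneg_right hhb (by positivity)
  intro j
  have hj : dist p (H j) ≤ δ :=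
    Finset.single_le_sum (f := fun j => dist p (H j)) (fun _ _ => dist_nonneg)
      (Finset.mem_univ j)
  have h8 : 1 + r ≤ (1 + r) * noiseWeight x := le_mul_of_one_le_right (by positivity) hw
  have h9 : noiseWeight x ≤ (1 + r) * noiseWeight x :=
    le_mul_of_one_le_left (by positivity) (by linarith)
  calc dist p (H j) ≤ s * (1 + r) + 2 * b * noiseWeight x := by linarith
    _ ≤ s * ((1 + r) * noiseWeight x) + 2 * b * ((1 + r) * noiseWeight x) := by gcongr
    _ = _ := by ring

/-- The expansion of a step in planar forests, uniformly over all small steps of the method. -/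
theorem exists_expansion_step (hE : IsFrame E) (hEb : ∃ C : ℝ, ∀ d x, ‖E d x‖ ≤ C) {o : M}
    {f : Fin D → M → ℝ} (hf : ∀ d, IsTestFunction E o (f d))
    (hfL : ∀ d, ∃ C : NNReal, LipschitzWith C (f d)) (A : Tableau s K L) :
    ∃ h₀ : ℝ, 0 < h₀ ∧ ∀ (n : ℕ) (ψ : M → ℝ), IsTestFunction E o ψ →
      ∃ (C : ℝ) (κ : ℕ), 0 ≤ C ∧ ∀ (h : ℝ) (x : Fin D → Fin L → ℝ) (p : M) (H : Fin s → M)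
        (q : M), 0 < h → h ≤ h₀ → IsStep A E f h x p H q →
          |ψ q - ∑ S ∈ forestsBelow n, √h ^ twiceOrder S *
              (forestWeights A E f x p).gen none S (fun _ => ()) (wordValue E ψ p)| ≤
            C * ((1 + dist o p) * noiseWeight x) ^ κ * √h ^ n := by
  obtain ⟨h₀, h0, h1, B, hB, hdist⟩ := exists_dist_stage_le hE hEb hfL A o
  refine ⟨h₀, h0, fun n ψ hψ => ?_⟩
  -- Uniformity is expressed by taking all small steps of the method as the index set.
  let ι := {t : ℝ × (Fin D → Fin L → ℝ) × M × (Fin s → M) × M //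
    0 < t.1 ∧ t.1 ≤ h₀ ∧ IsStep A E f t.1 t.2.1 t.2.2.1 t.2.2.2.1 t.2.2.2.2}
  let W : ι → ℝ := fun t => (1 + dist o t.1.2.2.1) * noiseWeight t.1.2.1
  let ε : ι → ℝ := fun t => √t.1.1
  have hs : IsScale W ε :=
    { one_le := fun t => one_le_mul_of_one_le_of_one_le
        (le_add_of_nonneg_right dist_nonneg) (one_le_noiseWeight _)
      nonneg := fun t => Real.sqrt_nonneg _
      le_one := fun t => Real.sqrt_le_one.2 (t.2.2.1.trans h1) }
  have hW : PolyO W ε 0 W := PolyO.size hs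
  have hr : ∀ t : ι, dist o t.1.2.2.1 ≤ W t := fun t =>
    (le_add_of_nonneg_left zero_le_one).trans
      (le_mul_of_one_le_right (by positivity) (one_le_noiseWeight _))
  have hx : ∀ d l, PolyO W ε 0 fun t => t.1.2.1 d l := fun d l => hW.of_le fun t =>
    (abs_le_noiseWeight _ d l).trans <| (le_mul_of_one_le_left
      (zero_le_one.trans (one_le_noiseWeight _)) (le_add_of_nonneg_right dist_nonneg)).trans
        (le_abs_self _)
  have hp : PolyO W ε 0 fun t => dist o t.1.2.2.1 := hW.of_le fun t => by
    rw [abs_of_nonneg dist_nonneg]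
    exact (hr t).trans (le_abs_self _)
  have hH : ∀ j, PolyO W ε 0 fun t => dist o (t.1.2.2.2.1 j) := fun j =>
    (hW.const_mul (1 + B)).of_le fun t => by
      rw [abs_of_nonneg dist_nonneg]
      have h2 := hdist _ _ _ _ _ t.2.1 t.2.2.1 t.2.2.2 j
      have h3 := dist_triangle o t.1.2.2.1 (t.1.2.2.2.1 j)
      refine le_trans ?_ (le_abs_self _)
      have h4 : dist t.1.2.2.1 (t.1.2.2.2.1 j) ≤ B * W t := h2
      linarith [hr t]
  have hstep : ∀ t : ι, IsStep A E f (ε t ^ 2) t.1.2.1 t.1.2.2.1 t.1.2.2.2.1 t.1.2.2.2.2 := by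
    intro t
    rw [Real.sq_sqrt t.2.1.le]
    exact t.2.2.2
  obtain ⟨C, κ, hC, h⟩ := polyO_step hE hEb hf A hs hx hp hH hstep n hψ
  exact ⟨C, κ, hC, fun h' x p H q h2 h3 h4 => h ⟨(h', x, p, H, q), h2, h3, h4⟩⟩

end Step

/-! ### Expectation of the expansion -/

/-- The exotic forest with a given shape and given lianas. -/
def Pairing.toForest {S : Planar} (q : Pairing (White S)) : ExoticForest :=
  ⟨S, q.toFun, q.apply_apply, q.apply_ne⟩

/-- A paired forest has an even number of white nodes, so that the halving in its order is exact. -/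
theorem two_mul_order_toForest {S : Planar} (q : Pairing (White S)) :
    2 * q.toForest.order = twiceOrder S := by
  have h : Even (Fintype.card (White S)) := by
    rw [← Nat.not_odd_iff_even]
    exact fun h => (isEmpty_pairing h).false q
  have h2 := Nat.div_mul_cancel h.two_dvd
  have h3 : q.toForest.order = Fintype.card (Black S) + Fintype.card (White S) / 2 := rfl
  rw [twiceOrder_eq, h3]
  omega

/-- A sum over the planar forests of order at most `N` and over the pairings of their white nodes
is a sum over the exotic forests of order at most `N`. -/
theorem sum_forestsBelow_pairing (N : ℕ) (F : ExoticForest → ℝ) :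
    ∑ S ∈ forestsBelow (2 * N + 2), ∑ q : Pairing (White S), F q.toForest =
      ∑ j ∈ Finset.range (N + 1), ∑ π ∈ ExoticForest.ofOrder j, F π := by
  rw [Finset.sum_sigma', Finset.sum_sigma']
  refine Finset.sum_bij' (fun a _ => ⟨a.2.toForest.order, a.2.toForest⟩)
    (fun b _ => ⟨b.2.shape, ⟨b.2.pair, b.2.pair_pair, b.2.pair_ne⟩⟩) ?_ ?_ ?_ ?_ ?_
  · rintro ⟨S, q⟩ h
    have h1 := two_mul_order_toForest q
    simp only [Finset.mem_sigma, mem_forestsBelow, Finset.mem_univ, and_true] at h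
    simp only [Finset.mem_sigma, Finset.mem_range, ExoticForest.ofOrder,
      Set.Finite.mem_toFinset, Set.mem_ofPred_eq, and_true]
    omega
  · rintro ⟨j, π⟩ h
    have h1 := two_mul_order_toForest ⟨π.pair, π.pair_pair, π.pair_ne⟩
    simp only [Finset.mem_sigma, Finset.mem_range, ExoticForest.ofOrder,
      Set.Finite.mem_toFinset, Set.mem_ofPred_eq] at h
    simp only [Finset.mem_sigma, mem_forestsBelow, Finset.mem_univ, and_true]
    have h2 : (Pairing.toForest ⟨π.pair, π.pair_pair, π.pair_ne⟩).order = π.order := rfl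
    omega
  · rintro ⟨S, q⟩ _
    rfl
  · rintro ⟨j, π⟩ h
    simp only [Finset.mem_sigma, ExoticForest.ofOrder, Set.Finite.mem_toFinset,
      Set.mem_ofPred_eq] at h
    obtain ⟨-, rfl⟩ := h
    rfl
  · rintro ⟨S, q⟩ _
    rfl

section Expectation

variable {m : ℕ} {M : Type*} [MetricSpace M] [ChartedSpace (EuclideanSpace ℝ (Fin m)) M]
  {D s K L N : ℕ}

/-- The summand of an elementary differential for a choice of the directions of all nodes, the
lianas being left aside. -/
def directionTerm (E : Fin D → (x : M) → TangentSpace (𝓡 m) x) (f : Fin D → M → ℝ) (S : Planar)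
    (φ : M → ℝ) (p : M) (d : Node S → Fin D) : ℝ :=
  (∏ v : Black S, iterDeriv E ((children S v).map d) (f (d (Sum.inl v))) p) *
    iterDeriv E ((roots S).map d) φ p

theorem elemDiff_toForest (E : Fin D → (x : M) → TangentSpace (𝓡 m) x) (f : Fin D → M → ℝ)
    {S : Planar} (q : Pairing (White S)) (φ : M → ℝ) (p : M) :
    elemDiff E f q.toForest φ p = ∑ d : Node S → Fin D,
      (if ∀ v : White S, d (Sum.inr v) = d (Sum.inr (q.toFun v)) then 1 else 0) *
        directionTerm E f S φ p d := by
  simp only [directionTerm, ← mul_assoc]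
  rfl

theorem forestWeights_term (A : Tableau s K L) (E : Fin D → (x : M) → TangentSpace (𝓡 m) x)
    (f : Fin D → M → ℝ) (x : Fin D → Fin L → ℝ) (φ : M → ℝ) (p : M) (S : Planar)
    (i : Black S → Fin s) (k : Node S → Fin K) (d : Node S → Fin D) :
    (forestWeights A E f x p).term none S (fun _ => ()) (wordValue E φ p) i
        (fun v => (k v, d v)) =
      directionTerm E f S φ p d * ∑ l : White S → Fin L,
        A.weights.term none S l sortedWeight i k * ∏ v, x (d (Sum.inr v)) (l v) := by
  classical
  have hb : ∀ v, (forestWeights A E f x p).blackAt none S i (fun v => (k v, d v)) v =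
      A.weights.blackAt none S i k v := fun v => rfl
  have hf : ∀ v : Black S, (forestWeights A E f x p).family (k (Sum.inl v), d (Sum.inl v))
      ((children S v).map fun v => (k v, d v)) = sortedWeight ((children S v).map k) *
        iterDeriv E ((children S v).map d) (f (d (Sum.inl v))) p := by
    intro v
    simp only [forestWeights, wordValue, List.map_map]
    rfl
  have hr : wordValue E φ p ((roots S).map fun v => (k v, d v)) =
      sortedWeight ((roots S).map k) * iterDeriv E ((roots S).map d) φ p := by
    simp only [wordValue, List.map_map]
    rfl
  have hw : ∏ v, (forestWeights A E f x p).whiteAt none S i (fun v => (k v, d v))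
      (fun _ => ()) v = ∑ l : White S → Fin L, (∏ v, A.weights.whiteAt none S i k l v) *
        ∏ v, x (d (Sum.inr v)) (l v) := by
    simp only [← Finset.prod_mul_distrib]
    have h := Finset.prod_univ_sum (fun _ : White S => (Finset.univ : Finset (Fin L)))
      (fun v l => A.weights.white ((whiteParent S v).elim none fun w => some (i w))
        (k (Sum.inr v)) l * x (d (Sum.inr v)) l)
    rw [Fintype.piFinset_univ] at h
    exact h
  have hA : ∀ y w, A.weights.family y w = sortedWeight w := fun _ _ => rfl
  simp only [Weights.term, hb, hf, hr, hw, hA, directionTerm, Finset.prod_mul_distrib,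
    Finset.mul_sum, Finset.sum_mul]
  refine Finset.sum_congr rfl fun l _ => ?_
  ring

theorem forestWeights_gen (A : Tableau s K L) (E : Fin D → (x : M) → TangentSpace (𝓡 m) x)
    (f : Fin D → M → ℝ) (x : Fin D → Fin L → ℝ) (φ : M → ℝ) (p : M) (S : Planar) :
    (forestWeights A E f x p).gen none S (fun _ => ()) (wordValue E φ p) =
      ∑ d : Node S → Fin D, directionTerm E f S φ p d * ∑ l : White S → Fin L,
        A.weights.gen none S l sortedWeight * ∏ v, x (d (Sum.inr v)) (l v) := by
  classical
  have h : ∀ F : (Node S → Fin K × Fin D) → ℝ, ∑ c, F c =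
      ∑ d : Node S → Fin D, ∑ k : Node S → Fin K, F fun v => (k v, d v) := by
    intro F
    rw [Finset.sum_comm, ← (Equiv.arrowProdEquivProdArrow (Node S) (fun _ => Fin K)
      (fun _ => Fin D)).symm.sum_comp F, Fintype.sum_prod_type]
    rfl
  simp only [Weights.gen_eq_sum, h, forestWeights_term, Finset.sum_mul]
  rw [Finset.sum_comm]
  refine Finset.sum_congr rfl fun d _ => ?_
  simp only [← Finset.mul_sum]
  congr 1
  exact (Finset.sum_congr rfl fun i _ => Finset.sum_comm).trans Finset.sum_comm

variable {Ω : Type*} [MeasurableSpace Ω] {P : Measure Ω} [IsProbabilityMeasure P]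
  {ξ : Fin D → Fin L → Ω → ℝ}

theorem integrable_forestWeights_gen (hξ : IsNoise P N ξ) (A : Tableau s K L)
    (E : Fin D → (x : M) → TangentSpace (𝓡 m) x) (f : Fin D → M → ℝ) (φ : M → ℝ) (p : M)
    (S : Planar) : Integrable (fun z => (forestWeights A E f (fun d l => ξ d l z) p).gen none S
      (fun _ => ()) (wordValue E φ p)) P := by
  simp only [forestWeights_gen]
  exact integrable_finsetSum _ fun d _ => (integrable_finsetSum _ fun l _ =>
    (hξ.integrable_prod Finset.univ fun v => (d (Sum.inr v), l v)).const_mul _).const_mul _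

/-- The expectation of the contribution of a planar forest: Wick's formula turns it into a sum over
the lianas between the white nodes. -/
theorem integral_forestWeights_gen (hξ : IsNoise P N ξ) (A : Tableau s K L)
    (E : Fin D → (x : M) → TangentSpace (𝓡 m) x) (f : Fin D → M → ℝ) (φ : M → ℝ) (p : M)
    {S : Planar} (hS : Fintype.card (White S) ≤ 2 * N + 1) :
    ∫ z, (forestWeights A E f (fun d l => ξ d l z) p).gen none S (fun _ => ())
        (wordValue E φ p) ∂P =
      ∑ q : Pairing (White S), coeff A q.toForest * elemDiff E f q.toForest φ p := by
  classical
  have hint : ∀ (d : Node S → Fin D) (l : White S → Fin L),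
      Integrable (fun z => ∏ v, ξ (d (Sum.inr v)) (l v) z) P := fun d l =>
    hξ.integrable_prod Finset.univ fun v => (d (Sum.inr v), l v)
  have hmom : ∀ (d : Node S → Fin D) (l : White S → Fin L),
      ∫ z, ∏ v, ξ (d (Sum.inr v)) (l v) z ∂P = ∑ q : Pairing (White S),
        (if ∀ v, d (Sum.inr v) = d (Sum.inr (q.toFun v)) then 1 else 0) *
          (if ∀ v, l v = l (q.toFun v) then 1 else 0) := by
    intro d l
    refine (hξ.integral_prod hS fun v => (d (Sum.inr v), l v)).trans
      (Finset.sum_congr rfl fun q _ => ?_)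
    simp only [Prod.mk.injEq, forall_and, ite_and, ite_mul, one_mul, zero_mul]
  have hc : ∀ q : Pairing (White S), coeff A q.toForest = ∑ l : White S → Fin L,
      A.weights.gen none S l sortedWeight * if ∀ v, l v = l (q.toFun v) then 1 else 0 := by
    intro q
    refine (coeff_eq_sum_gen A q.toForest).trans (Finset.sum_congr rfl fun l _ => ?_)
    rw [mul_ite, mul_one, mul_zero]
    rfl
  simp only [forestWeights_gen]
  rw [integral_finsetSum _ fun d _ => (integrable_finsetSum _ fun l _ =>
    (hint d l).const_mul _).const_mul _]
  simp only [integral_const_mul]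
  have h1 : ∀ d : Node S → Fin D, ∫ z, ∑ l : White S → Fin L,
      A.weights.gen none S l sortedWeight * ∏ v, ξ (d (Sum.inr v)) (l v) z ∂P =
      ∑ q : Pairing (White S), coeff A q.toForest *
        (if ∀ v, d (Sum.inr v) = d (Sum.inr (q.toFun v)) then 1 else 0) := by
    intro d
    rw [integral_finsetSum _ fun l _ => (hint d l).const_mul _]
    simp only [integral_const_mul, hmom, hc, Finset.mul_sum, Finset.sum_mul]
    rw [Finset.sum_comm]
    refine Finset.sum_congr rfl fun q _ => Finset.sum_congr rfl fun l _ => ?_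
    ring
  simp only [h1, elemDiff_toForest, Finset.mul_sum]
  rw [Finset.sum_comm]
  refine Finset.sum_congr rfl fun q _ => Finset.sum_congr rfl fun d _ => ?_
  ring

/-- The expectation of the expansion of a step is the truncation of the exotic Lie series. -/
theorem integral_sum_forestsBelow (hξ : IsNoise P N ξ) (A : Tableau s K L)
    (E : Fin D → (x : M) → TangentSpace (𝓡 m) x) (f : Fin D → M → ℝ) (φ : M → ℝ) (p : M)
    {h : ℝ} (hh : 0 ≤ h) :
    ∫ z, ∑ S ∈ forestsBelow (2 * N + 2), √h ^ twiceOrder S *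
        (forestWeights A E f (fun d l => ξ d l z) p).gen none S (fun _ => ())
          (wordValue E φ p) ∂P =
      (PowerSeries.trunc (N + 1) (lieSeries E f (coeffMap A) φ p)).eval h := by
  have h1 : (PowerSeries.trunc (N + 1) (lieSeries E f (coeffMap A) φ p)).eval h =
      ∑ j ∈ Finset.range (N + 1), ∑ π ∈ ExoticForest.ofOrder j,
        h ^ π.order * (coeff A π * elemDiff E f π φ p) := by
    rw [← Polynomial.eval₂_id, PowerSeries.eval₂_trunc_eq_sum_range]
    refine Finset.sum_congr rfl fun j _ => ?_
    rw [lieSeries, PowerSeries.coeff_mk, RingHom.id_apply, Finset.sum_mul]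
    refine Finset.sum_congr rfl fun π hπ => ?_
    simp only [ExoticForest.ofOrder, Set.Finite.mem_toFinset, Set.mem_ofPred_eq] at hπ
    rw [coeffMap_single, hπ]
    ring
  rw [h1, ← sum_forestsBelow_pairing, integral_finsetSum _ fun S _ =>
    (integrable_forestWeights_gen hξ A E f φ p S).const_mul _]
  refine Finset.sum_congr rfl fun S hS => ?_
  have hc : Fintype.card (White S) ≤ 2 * N + 1 := by
    have h2 := twiceOrder_eq S
    have h3 := mem_forestsBelow.1 hS
    omega
  rw [integral_const_mul, integral_forestWeights_gen hξ A E f φ p hc, Finset.mul_sum]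
  refine Finset.sum_congr rfl fun q _ => ?_
  rw [← two_mul_order_toForest q, pow_mul, Real.sq_sqrt hh]

end Expectation

section Remainder

open scoped Bundle

variable {m : ℕ} {M : Type*} [MetricSpace M] [ChartedSpace (EuclideanSpace ℝ (Fin m)) M]
  {D s K L N : ℕ} {E : Fin D → (x : M) → TangentSpace (𝓡 m) x} [IsManifold (𝓡 m) ∞ M]
  [Bundle.RiemannianBundle (fun x : M => TangentSpace (𝓡 m) x)] [IsRiemannianManifold (𝓡 m) M]

/-- The expectation of the deterministic expansion is the truncated exotic Lie series; the remainder
of order `h ^ (N + 1)` is dominated by a power of the noise, which is integrable. -/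
theorem hasTalayTubaroExpansion_lieSeries [MeasurableSpace M] [BorelSpace M]
    (hE : IsFrame E) (hEb : ∃ C : ℝ, ∀ d x, ‖E d x‖ ≤ C) {o : M}
    {f : Fin D → M → ℝ} (hf : ∀ d, IsTestFunction E o (f d))
    (hfL : ∀ d, ∃ C : NNReal, LipschitzWith C (f d))
    {Ω : Type*} [MeasurableSpace Ω] {P : Measure Ω} [IsProbabilityMeasure P]
    {ξ : Fin D → Fin L → Ω → ℝ} (hξ : IsNoise P N ξ) (A : Tableau s K L)
    {h₁ : ℝ} (hh₁ : 0 < h₁) {X : ℝ → M → Ω → M}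
    (hXm : ∀ h, 0 < h → h < h₁ → ∀ p, AEMeasurable (X h p) P)
    (hX : ∀ h, 0 < h → h < h₁ → ∀ p, ∀ᵐ z ∂P,
      ∃ H : Fin s → M, IsStep A E f h (fun d l => ξ d l z) p H (X h p z)) :
    HasTalayTubaroExpansion P E o X N (lieSeries E f (coeffMap A)) := by
  obtain ⟨h₀, h0, hexp⟩ := exists_expansion_step hE hEb hf hfL A
  refine ⟨min h₀ (h₁ / 2), lt_min h0 (half_pos hh₁), fun φ hφ => ?_⟩
  obtain ⟨C, κ, hC, hbound⟩ := hexp (2 * N + 2) φ hφ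
  have hI := hξ.integrable_noiseWeight_pow κ
  set I := ∫ z, noiseWeight (fun d l => ξ d l z) ^ κ ∂P with hIdef
  have hI0 : 0 ≤ I := integral_nonneg fun z =>
    pow_nonneg (zero_le_one.trans (one_le_noiseWeight _)) κ
  refine ⟨C * I * 2 ^ (κ - 1), κ, fun h hpos hle p => ?_⟩
  have hlt : h < h₁ := (hle.trans (min_le_right _ _)).trans_lt (half_lt_self hh₁)
  set G : Ω → ℝ := fun z => ∑ S ∈ forestsBelow (2 * N + 2), √h ^ twiceOrder S *
    (forestWeights A E f (fun d l => ξ d l z) p).gen none S (fun _ => ()) (wordValue E φ p)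
    with hG
  have hGi : Integrable G P := integrable_finsetSum _ fun S _ =>
    (integrable_forestWeights_gen hξ A E f φ p S).const_mul _
  have hGe : ∫ z, G z ∂P = (PowerSeries.trunc (N + 1) (lieSeries E f (coeffMap A) φ p)).eval h :=
    integral_sum_forestsBelow hξ A E f φ p hpos.le
  have hm : AEStronglyMeasurable (fun z => φ (X h p z)) P :=
    (hφ.1.continuous.measurable.comp_aemeasurable (hXm h hpos hlt p)).aestronglyMeasurable
  have hsq : √h ^ (2 * N + 2) = h ^ (N + 1) := by
    rw [show 2 * N + 2 = 2 * (N + 1) by ring, pow_mul, Real.sq_sqrt hpos.le]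
  have hae : ∀ᵐ z ∂P, ‖φ (X h p z) - G z‖ ≤
      C * (1 + dist o p) ^ κ * h ^ (N + 1) * noiseWeight (fun d l => ξ d l z) ^ κ := by
    filter_upwards [hX h hpos hlt p] with z hz
    obtain ⟨H, hH⟩ := hz
    refine (hbound h _ p H _ hpos (hle.trans (min_le_left _ _)) hH).trans (le_of_eq ?_)
    rw [hsq, mul_pow]
    ring
  have hdom := hI.const_mul (C * (1 + dist o p) ^ κ * h ^ (N + 1))
  -- The expansion is integrable, hence so is `φ` at the random point.
  have hR : Integrable (fun z => φ (X h p z) - G z) P :=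
    hdom.mono' (hm.sub hGi.aestronglyMeasurable) hae
  have hφi : Integrable (fun z => φ (X h p z)) P :=
    (hR.add hGi).congr (ae_of_all _ fun z => sub_add_cancel (φ (X h p z)) (G z))
  refine ⟨hφi, ?_⟩
  rw [← hGe, ← integral_sub hφi hGi]
  have h2 : (1 + dist o p) ^ κ ≤ 2 ^ (κ - 1) * (1 + dist o p ^ κ) := by
    simpa using add_pow_le zero_le_one (dist_nonneg (x := o) (y := p)) κ
  calc |∫ z, (φ (X h p z) - G z) ∂P|
      ≤ ∫ z, C * (1 + dist o p) ^ κ * h ^ (N + 1) *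
          noiseWeight (fun d l => ξ d l z) ^ κ ∂P := norm_integral_le_of_norm_le hdom hae
    _ = C * I * (1 + dist o p) ^ κ * h ^ (N + 1) := by
        rw [integral_const_mul]
        ring
    _ ≤ C * I * (2 ^ (κ - 1) * (1 + dist o p ^ κ)) * h ^ (N + 1) := by gcongr
    _ = _ := by ring

end Remainder

end FrozenFlow

end

open FrozenFlow in
open scoped Bundle in
theorem theorem3p3 {m D s K L N : ℕ} (hN : 1 ≤ N)
    {M : Type*} [MetricSpace M] [CompleteSpace M] [ConnectedSpace M]
    [ChartedSpace (EuclideanSpace ℝ (Fin m)) M] [IsManifold (𝓡 m) ∞ M]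
    [Bundle.RiemannianBundle (fun x : M => TangentSpace (𝓡 m) x)]
    [IsContMDiffRiemannianBundle (𝓡 m) ∞ (EuclideanSpace ℝ (Fin m))
      (fun x : M => TangentSpace (𝓡 m) x)]
    [IsRiemannianManifold (𝓡 m) M]
    [MeasurableSpace M] [BorelSpace M]
    (o : M)
    (E : Fin D → (x : M) → TangentSpace (𝓡 m) x)
    (hE : IsFrame E) (hEb : ∃ C : ℝ, ∀ d x, ‖E d x‖ ≤ C)
    (f : Fin D → M → ℝ)
    (hf : ∀ d, IsTestFunction E o (f d)) (hfL : ∀ d, ∃ C : NNReal, LipschitzWith C (f d))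
    {Ω : Type*} [MeasurableSpace Ω] (P : Measure Ω) [IsProbabilityMeasure P]
    (ξ : Fin D → Fin L → Ω → ℝ) (hξ : IsNoise P N ξ)
    (A : Tableau s K L)
    (h₁ : ℝ) (hh₁ : 0 < h₁) (X : ℝ → M → Ω → M)
    (hXm : ∀ h, 0 < h → h < h₁ → ∀ p, AEMeasurable (X h p) P)
    (hX : ∀ h, 0 < h → h < h₁ → ∀ p, ∀ᵐ z ∂P,
      ∃ H : Fin s → M, IsStep A E f h (fun d l => ξ d l z) p H (X h p z)) :
    HasTalayTubaroExpansion P E o X N (lieSeries E f (coeffMap A)) ∧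
    (∀ (τ : ExoticForest) (d : Planar.White τ.shape → Fin D), (∀ v, d v = d (τ.pair v)) →
      coeffMap A (Finsupp.single τ 1) = coeffByExpectation P ξ A τ d) ∧
    IsShuffleCharacter (coeffMap A) :=
  ⟨hasTalayTubaroExpansion_lieSeries hE hEb hf hfL hξ A hh₁ hXm hX,
    fun τ d hd => (coeffMap_single A τ).trans (coeff_eq_coeffByExpectation hN P ξ hξ A τ d hd),
    isShuffleCharacter_coeffMap A⟩
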